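/- Let $L_2=\mathbb Z_2\wr\mathbb Z$ be the lamplighter group, that is, the set $\mathbb Z\times\mathbb Z_2[z^{\pm1}]$ with the product $(\delta_1,f_1)(\delta_2,f_2)=(\delta_1+\delta_2,\;f_1z^{-\delta_2}+f_2)$, generated by $a=(0,1)$ and $t=(1,0)$. The Diophantine problem $\mathbf{DP}_1(L_2)$ for one-variable equations over $L_2$ asks, for a given $w=w(a,t,x)$ in the free group $F(a,t,x)$, whether there is $s\in F(a,t)$ with $w(a,t,s(a,t))=1$ in $L_2$. Write $|w|$ for the length of the reduced word $w$, write $\sigma_x(w)$ for the sum of the exponents of $x$ in $w$, and put $S_m=\{w\in F(a,t,x) : |w|=m\}$. A set $S\subseteq F(a,t,x)$ is called generic if $|S\cap S_m|/|S_m|\to 1$ as $m\to\infty$. The model of computation is the random access machine with indirect addressing, whose instructions (constants, copying to and from memory, $+$, truncated $-$, $\cdot$, integer division, jump on zero) have unit cost. A possibly partial decision algorithm for a problem is a program whose answer is correct on every input on which it halts. It runs on $w$ within time $k$ if it halts on the reduced word $w$ after at most $k$ steps and all contents of its registers and memory cells are at most $(|w|+2)^d$ throughout, where $d$ is a constant that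 depends only on the program (so machine words have $O(\log|w|)$ bits). A problem has generic-case time complexity $O(f)$ if there are a possibly partial decision algorithm for it, a constant $d$ and a function $T\in O(f)$ such that the set of the inputs $w$ on which the algorithm runs within time $T(|w|)$ is generic. **Theorem.** $\mathbf{DP}_1(L_2)$ has generic-case time complexity $O(|w|^2\log|w|\,\log\log|w|)$. More precisely, the set $\{w\in F(a,t,x) : \sigma_x(w)\neq 0\}$ is generic, and there are a possibly partial decision algorithm for $\mathbf{DP}_1(L_2)$, a constant $d$ and a function $T(n)\in O(n^2\log n\,\log\log n)$ such that the algorithm runs within time $T(|w|)$ on every $w$ with $\sigma_x(w)\neq 0$. -/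

import Mathlib

open Filter Topology Asymptotics

/-! ### The lamplighter group -/

/-- The lamplighter group `L₂ = ℤ₂ ≀ ℤ`, as the semidirect product of `ℤ` with the additive group of
finitely supported functions `ℤ → ℤ₂`, the latter identified with Laurent polynomials over `ℤ₂`. -/
@[ext] structure Lamplighter where
  pos : ℤ
  lamps : LaurentPolynomial (ZMod 2)

namespace Lamplighter

noncomputable section

/-- `(δ₁, f₁)(δ₂, f₂) = (δ₁ + δ₂, f₁ ^ δ₂ + f₂)`, where `f ^ δ = f · z ^ (-δ)`
(as functions, `f ^ δ` sends `i` to `f (i + δ)`). -/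
instance : Mul Lamplighter where
  mul g h := ⟨g.pos + h.pos, g.lamps * LaurentPolynomial.T (-h.pos) + h.lamps⟩

instance : One Lamplighter where
  one := ⟨0, 0⟩

instance : Inv Lamplighter where
  inv g := ⟨-g.pos, -(g.lamps * LaurentPolynomial.T g.pos)⟩

@[simp] theorem mul_pos (g h : Lamplighter) : (g * h).pos = g.pos + h.pos := rfl

@[simp] theorem mul_lamps (g h : Lamplighter) :
    (g * h).lamps = g.lamps * LaurentPolynomial.T (-h.pos) + h.lamps := rfl

@[simp] theorem one_pos : (1 : Lamplighter).pos = 0 := rfl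

@[simp] theorem one_lamps : (1 : Lamplighter).lamps = 0 := rfl

@[simp] theorem inv_pos (g : Lamplighter) : (g⁻¹).pos = -g.pos := rfl

@[simp] theorem inv_lamps (g : Lamplighter) :
    (g⁻¹).lamps = -(g.lamps * LaurentPolynomial.T g.pos) := rfl

instance : Group Lamplighter :=
  Group.ofLeftAxioms
    (by
      intro g h k
      ext1
      · simp [add_assoc]
      · simp only [mul_lamps, mul_pos, neg_add, LaurentPolynomial.T_add]
        ring)
    (by
      intro g
      ext1
      · simp
      · simp)
    (by
      intro g
      ext1
      · simp
      · rw [mul_lamps, inv_lamps, neg_mul, mul_assoc, ← LaurentPolynomial.T_add, add_neg_cancel,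
          LaurentPolynomial.T_zero, mul_one, neg_add_cancel, one_lamps])

/-- The generator `a`: the lamplighter stays at `0` and the lamp at `0` is switched on. -/
def a : Lamplighter := ⟨0, 1⟩

/-- The generator `t`: the lamplighter moves to `1` and all lamps are off. -/
def t : Lamplighter := ⟨1, 0⟩

end

end Lamplighter

/-! ### One-variable equations -/

/-- The generators of the lamplighter group, as formal letters. -/
inductive ConstLetter
  | a
  | t
  deriving DecidableEq

/-- The generators of the lamplighter group together with the variable `x`. -/
inductive EqLetter
  | a
  | t
  | x
  deriving DecidableEq

/-- The element `s(a, t)` of the lamplighter group that a group word `s ∈ F(a, t)` represents. -/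
noncomputable def evalConst : FreeGroup ConstLetter →* Lamplighter :=
  FreeGroup.lift fun l => match l with
    | .a => Lamplighter.a
    | .t => Lamplighter.t

/-- The element `w(a, t, g)` of the lamplighter group, for a group word `w ∈ F(a, t, x)`. -/
noncomputable def evalEq (g : Lamplighter) : FreeGroup EqLetter →* Lamplighter :=
  FreeGroup.lift fun l => match l with
    | .a => Lamplighter.a
    | .t => Lamplighter.t
    | .x => g

/-- The Diophantine problem for one-variable equations over the lamplighter group, as the set of its
positive instances: those `w ∈ F(a, t, x)` for which `w(a, t, s(a, t)) = 1` for some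
`s ∈ F(a, t)`. -/
def DP1Lamplighter : Set (FreeGroup EqLetter) :=
  {w | ∃ s : FreeGroup ConstLetter, evalEq (evalConst s) w = 1}

/-- `σ_x(w)`: the sum of the exponents of `x` in the reduced word `w`. -/
def sigmaX (w : FreeGroup EqLetter) : ℤ :=
  (w.toWord.map fun p => if p.1 = EqLetter.x then (if p.2 then (1 : ℤ) else -1) else 0).sum

/-! ### Generic sets -/

/-- The sphere of radius `m` in `F(a, t, x)`: the reduced words of length `m`. -/
def wordSphere (m : ℕ) : Set (FreeGroup EqLetter) :=
  {w | w.norm = m}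

/-- `S` is generic in `F(a, t, x)`: the proportion of `S` in the sphere of radius `m`
tends to `1` as `m → ∞`. -/
def IsGenericSet (S : Set (FreeGroup EqLetter)) : Prop :=
  Tendsto (fun m : ℕ => ((S ∩ wordSphere m).ncard : ℝ) / ((wordSphere m).ncard : ℝ)) atTop (𝓝 1)

/-! ### Random access machines -/

namespace RAM

/-- The instructions of a random access machine with registers `R[0], R[1], …` (of which a program
names only finitely many) and a memory `M[0], M[1], …` that is addressed indirectly. -/
inductive Instr
  /-- `R[r] := k` -/
  | const (r k : ℕ)
  /-- `R[r] := R[s] + R[u]` -/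
  | add (r s u : ℕ)
  /-- `R[r] := max (R[s] - R[u]) 0` -/
  | sub (r s u : ℕ)
  /-- `R[r] := R[s] * R[u]` -/
  | mul (r s u : ℕ)
  /-- `R[r] := ⌊R[s] / R[u]⌋`, and `0` if `R[u] = 0` -/
  | div (r s u : ℕ)
  /-- `R[r] := M[R[s]]` -/
  | load (r s : ℕ)
  /-- `M[R[r]] := R[s]` -/
  | store (r s : ℕ)
  /-- go to instruction `l` if `R[r] = 0`, and to the next instruction otherwise -/
  | jumpZero (r l : ℕ)

/-- A program is a finite list of instructions, numbered from `0`. -/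
abbrev Program := List Instr

/-- A configuration: the number of the next instruction, the registers and the memory. -/
structure Config where
  pc : ℕ
  reg : ℕ → ℕ
  mem : ℕ → ℕ

/-- The effect of one instruction. -/
def exec (i : Instr) (c : Config) : Config :=
  match i with
  | .const r k => ⟨c.pc + 1, Function.update c.reg r k, c.mem⟩
  | .add r s u => ⟨c.pc + 1, Function.update c.reg r (c.reg s + c.reg u), c.mem⟩
  | .sub r s u => ⟨c.pc + 1, Function.update c.reg r (c.reg s - c.reg u), c.mem⟩
  | .mul r s u => ⟨c.pc + 1, Function.update c.reg r (c.reg s * c.reg u), c.mem⟩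
  | .div r s u => ⟨c.pc + 1, Function.update c.reg r (c.reg s / c.reg u), c.mem⟩
  | .load r s => ⟨c.pc + 1, Function.update c.reg r (c.mem (c.reg s)), c.mem⟩
  | .store r s => ⟨c.pc + 1, c.reg, Function.update c.mem (c.reg r) (c.reg s)⟩
  | .jumpZero r l => ⟨if c.reg r = 0 then l else c.pc + 1, c.reg, c.mem⟩

/-- One step of the machine. It has halted when there is no instruction with the current number, and
then the configuration no longer changes. -/
def step (P : Program) (c : Config) : Config :=
  match P[c.pc]? with
  | some i => exec i c
  | none => c

/-- The code of a letter `a, a⁻¹, t, t⁻¹, x, x⁻¹` is `0, 1, 2, 3, 4, 5`, respectively. -/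
def letterCode (p : EqLetter × Bool) : ℕ :=
  (match p.1 with
    | .a => 0
    | .t => 2
    | .x => 4) + (if p.2 then 0 else 1)

/-- The initial configuration on input `w`: `R[0]` holds the length of the reduced word `w`, the
cells `M[0], …, M[|w| - 1]` hold the codes of its letters, and everything else is `0`. -/
def init (w : FreeGroup EqLetter) : Config where
  pc := 0
  reg := Function.update (fun _ => 0) 0 w.norm
  mem := fun i => (w.toWord.map letterCode).getD i 0

/-- The configuration after `k` steps on input `w`. -/
def run (P : Program) (w : FreeGroup EqLetter) (k : ℕ) : Config :=
  (step P)^[k] (init w)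

/-- `P` has halted on input `w` after at most `k` steps. -/
def HaltsBy (P : Program) (w : FreeGroup EqLetter) (k : ℕ) : Prop :=
  P.length ≤ (run P w k).pc

/-- `P` is a (possibly partial) decision algorithm for `D`: whenever `P` halts on an input, its answer
is correct. The answer is positive if the final content of `R[0]` is nonzero, and negative if it
is zero. -/
def PartiallyDecides (P : Program) (D : Set (FreeGroup EqLetter)) : Prop :=
  ∀ w k, HaltsBy P w k → ((run P w k).reg 0 ≠ 0 ↔ w ∈ D)

/-- On input `w`, `P` halts after at most `k` unit-cost steps and uses only machine words of
logarithmic length: all contents of registers and memory cells are at most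
`(|w| + 2) ^ d` throughout. -/
def RunsWithin (P : Program) (d : ℕ) (w : FreeGroup EqLetter) (k : ℕ) : Prop :=
  HaltsBy P w k ∧
    ∀ j ≤ k, ∀ i, (run P w j).reg i ≤ (w.norm + 2) ^ d ∧ (run P w j).mem i ≤ (w.norm + 2) ^ d

/-- The decision problem `D` has generic-case time complexity `O(f)`: there is a (possibly partial)
decision algorithm for `D` and a time bound `T ∈ O(f)` such that the set of the inputs `w` on which
the algorithm halts within time `T(|w|)` is generic. -/
def HasGenericCaseTime (D : Set (FreeGroup EqLetter)) (f : ℕ → ℝ) : Prop :=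
  ∃ (P : Program) (d : ℕ) (T : ℕ → ℕ),
    PartiallyDecides P D ∧ ((fun n => (T n : ℝ)) =O[atTop] f) ∧
      IsGenericSet {w | RunsWithin P d w (T w.norm)}

end RAM

/-! Write `n = |w|` and `x = (δ, f)`. The position of `w(a, t, x)` is `σ_x δ + σ_t`, where `σ_t` is
the exponent sum of `t`. Hence, if `σ_x ≠ 0`, there is at most one candidate for `δ`, and `|δ| ≤ n`.
For this `δ` the lamps of `w` are `Q + P f` with Laurent polynomials `P` and `Q` over `ℤ₂`: every
`x` or `x⁻¹` contributes a shifted copy of `f`, every `a` or `a⁻¹` a monomial. The lamplighter moves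
by at most `n + 1` per letter, so `P` and `Q` live on an interval of length `O(n²)` (`Scanned`). The
question becomes whether `P` divides `Q` in the Laurent polynomials
(`mem_DP1Lamplighter_iff_of_sigmaX_ne_zero`).

Up to a unit `X ^ lo`, either `P` is zero or it is a polynomial `p` with constant term `1`. In the
latter case `p` is coprime to `X`, so it may be divided by among ordinary polynomials, and a
quotient of degree below `K` is determined by its residue modulo `X ^ K`. It suffices to invert `p`
modulo `X ^ K`, multiply, truncate and check (`exists_laurent_iff`). The inverse comes from Newton's
iteration, which in characteristic two reads `v ↦ p * v(X²)` (`dvd_inverse_step`). The lengths of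
the products double from step to step, so the total cost is that of boundedly many products of
length `O(n²)`.

Such a product takes `O(K log K)` unit-cost operations on words of `O(log n)` bits, by a complex
Fourier transform in fixed-point arithmetic (`mulProg_tri`). With a power of two `N` of order `n²`
and the scale `N ^ 20`, each of the `O(log N)` levels multiplies the error by a constant, so the
error grows by a power of `N` only and the rounded result is exact. The roots of unity are computed
by half-angle formulas (`rootTable_tri`). Altogether the time is `O(n² log n)`, which is even better
than required.

The algorithm is written in a small language of integer expressions and bounded loops. Its
compilation to the machine is proved correct together with the step count and the bound on all
contents (`Cmd.executed`). The compiled program loops forever when `σ_x = 0`.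

For genericity, the sums of `u ^ σ_x` over reduced words, with `|u| = 1`, obey a linear recursion
with three components. For `u ≠ 1` they grow more slowly than `5 ^ m` (`norm_triple_le`). Averaging
over the `q`-th roots of unity bounds the limiting proportion of `σ_x = 0` by `1 / q`, for every `q`
(`tendsto_card_filter`). -/

/-! ### Traces of random access machines -/

namespace RAM

/-- All contents of registers and memory cells are at most `m`. -/
def Config.Bounded (m : ℕ) (c : Config) : Prop :=
  ∀ i, c.reg i ≤ m ∧ c.mem i ≤ m

/-- `P` passes from `c` to `c'` in `k` steps, and all contents stay bounded by `m`. -/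
def Reach (P : Program) (m : ℕ) (c : Config) (k : ℕ) (c' : Config) : Prop :=
  (step P)^[k] c = c' ∧ ∀ j ≤ k, ((step P)^[j] c).Bounded m

/-- The instructions of `P` from number `off` on begin with `l`. -/
def CodeAt (P : Program) (off : ℕ) (l : List Instr) : Prop :=
  ∀ i, ∀ x, l[i]? = some x → P[off + i]? = some x

/-- Executing a list of instructions one after the other. -/
def execs : List Instr → Config → Config
  | [], c => c
  | i :: l, c => execs l (exec i c)

/-- The instruction is not a jump, and the value it produces is at most `m`. -/
def ValueOk (m : ℕ) (c : Config) : Instr → Prop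
  | .const _ k => k ≤ m
  | .add _ s u => c.reg s + c.reg u ≤ m
  | .sub _ _ _ => True
  | .mul _ s u => c.reg s * c.reg u ≤ m
  | .div _ _ _ => True
  | .load _ _ => True
  | .store _ _ => True
  | .jumpZero _ _ => False

def ValuesOk (m : ℕ) : List Instr → Config → Prop
  | [], _ => True
  | i :: l, c => ValueOk m c i ∧ ValuesOk m l (exec i c)

theorem Reach.refl {P : Program} {m : ℕ} {c : Config} (h : c.Bounded m) : Reach P m c 0 c := by
  refine ⟨rfl, fun j hj => ?_⟩
  obtain rfl : j = 0 := by omega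
  exact h

theorem Reach.trans {P : Program} {m : ℕ} {c₁ c₂ c₃ : Config} {k l : ℕ}
    (h₁ : Reach P m c₁ k c₂) (h₂ : Reach P m c₂ l c₃) : Reach P m c₁ (k + l) c₃ := by
  obtain ⟨rfl, h₁⟩ := h₁
  obtain ⟨rfl, h₂⟩ := h₂
  refine ⟨by rw [Nat.add_comm, Function.iterate_add_apply], fun j hj => ?_⟩
  by_cases hjk : j ≤ k
  · exact h₁ j hjk
  · obtain ⟨i, rfl⟩ : ∃ i, j = i + k := ⟨j - k, by omega⟩
    rw [Function.iterate_add_apply]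
    exact h₂ i (by omega)

theorem Reach.bounded {P : Program} {m : ℕ} {c₁ c₂ : Config} {k : ℕ}
    (h : Reach P m c₁ k c₂) : c₂.Bounded m := h.1 ▸ h.2 k le_rfl

theorem Reach.single {P : Program} {m : ℕ} {c : Config} {i : Instr} (hi : P[c.pc]? = some i)
    (h₁ : c.Bounded m) (h₂ : (exec i c).Bounded m) : Reach P m c 1 (exec i c) := by
  have hs : step P c = exec i c := by simp [step, hi]
  refine ⟨by simp [hs], fun j hj => ?_⟩
  obtain rfl | rfl : j = 0 ∨ j = 1 := by omega
  · exact h₁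
  · simpa [hs] using h₂

theorem CodeAt.head {P : Program} {off : ℕ} {i : Instr} {l : List Instr}
    (h : CodeAt P off (i :: l)) : P[off]? = some i := h 0 i rfl

theorem CodeAt.tail {P : Program} {off : ℕ} {i : Instr} {l : List Instr}
    (h : CodeAt P off (i :: l)) : CodeAt P (off + 1) l := fun j x hx => by
  have := h (j + 1) x (by simpa using hx)
  rwa [show off + (j + 1) = off + 1 + j by omega] at this

theorem CodeAt.left {P : Program} {off : ℕ} {l₁ l₂ : List Instr}
    (h : CodeAt P off (l₁ ++ l₂)) : CodeAt P off l₁ := fun j x hx => h j x (by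
  have : j < l₁.length := by
    by_contra hc
    rw [List.getElem?_eq_none (by omega)] at hx
    cases hx
  rw [List.getElem?_append_left this, hx])

theorem CodeAt.right {P : Program} {off : ℕ} {l₁ l₂ : List Instr}
    (h : CodeAt P off (l₁ ++ l₂)) : CodeAt P (off + l₁.length) l₂ := fun j x hx => by
  have := h (l₁.length + j) x (by rw [List.getElem?_append_right (by omega)]; simpa using hx)
  rwa [← Nat.add_assoc] at this

/-- Only constants, sums and products can create something larger than what is already present.
Truncated differences, quotients, loads and stores cannot, which is why `ValueOk` asks nothing of
them. -/
theorem Config.Bounded.exec {m : ℕ} {c : Config} {i : Instr} (h : c.Bounded m)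
    (hi : ValueOk m c i) : (exec i c).Bounded m := by
  intro x
  cases i <;> simp only [RAM.exec, ValueOk, Function.update_apply] at hi ⊢ <;>
    constructor <;> try split_ifs
  all_goals first
    | exact hi
    | exact (h _).1
    | exact (h _).2
    | exact (Nat.sub_le _ _).trans (h _).1
    | exact (Nat.div_le_self _ _).trans (h _).1

theorem exec_pc {m : ℕ} {c : Config} {i : Instr} (hi : ValueOk m c i) :
    (exec i c).pc = c.pc + 1 := by
  cases i <;> simp_all [exec, ValueOk]

/-- Straight-line code runs to its end. -/
theorem Reach.execs {P : Program} {m : ℕ} (l : List Instr) {c : Config} (hP : CodeAt P c.pc l)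
    (hc : c.Bounded m) (hl : ValuesOk m l c) :
    Reach P m c l.length (execs l c) ∧ (RAM.execs l c).pc = c.pc + l.length := by
  induction l generalizing c with
  | nil => exact ⟨Reach.refl hc, rfl⟩
  | cons i l ih =>
    have hb := hc.exec hl.1
    have hpc := exec_pc hl.1
    obtain ⟨h₁, h₂⟩ := ih (c := exec i c) (by rw [hpc]; exact hP.tail) hb hl.2
    refine ⟨?_, ?_⟩
    · have := (Reach.single hP.head hc hb).trans h₁
      rwa [Nat.add_comm] at this
    · rw [RAM.execs, h₂, hpc, List.length_cons]; omega

end RAM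

/-! ### Bounded-loop programs over the integers -/

namespace IntProg

open RAM

/-- Integer expressions. -/
inductive Ex
  | var (v : ℕ)
  | num (k : ℤ)
  | add (a b : Ex)
  | sub (a b : Ex)
  | mul (a b : Ex)
  /-- division, rounded towards zero -/
  | div (a b : Ex)
  /-- an entry of an array -/
  | get (j : Fin 16) (e : Ex)
  /-- an entry of the input -/
  | inp (e : Ex)

/-- Programs with integer variables and arrays, and with bounded loops only. -/
inductive Cmd
  | assign (v : ℕ) (e : Ex)
  | store (j : Fin 16) (e₁ e₂ : Ex)
  | seq (c₁ c₂ : Cmd)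
  /-- `c₁` if `0 < e`, and `c₂` otherwise -/
  | ite (e : Ex) (c₁ c₂ : Cmd)
  /-- `c` for `v = 0, …, e - 1` -/
  | loop (v : ℕ) (e : Ex) (c : Cmd)

/-- The state of a program. -/
@[ext] structure St where
  var : ℕ → ℤ
  arr : Fin 16 → ℕ → ℤ
  inp : List ℕ

namespace St

def setVar (s : St) (v : ℕ) (x : ℤ) : St := ⟨Function.update s.var v x, s.arr, s.inp⟩

def setArr (s : St) (j : Fin 16) (i : ℕ) (x : ℤ) : St :=
  ⟨s.var, Function.update s.arr j (Function.update (s.arr j) i x), s.inp⟩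

/-- All contents of the state have absolute value at most `B`. -/
def Bounded (B : ℤ) (s : St) : Prop :=
  (∀ v, |s.var v| ≤ B) ∧ (∀ j i, |s.arr j i| ≤ B) ∧ ∀ x ∈ s.inp, (x : ℤ) ≤ B

end St

namespace Ex

def eval (s : St) : Ex → ℤ
  | var v => s.var v
  | num k => k
  | add a b => a.eval s + b.eval s
  | sub a b => a.eval s - b.eval s
  | mul a b => a.eval s * b.eval s
  | div a b => (a.eval s).tdiv (b.eval s)
  | get j e => s.arr j (e.eval s).toNat
  | inp e => (s.inp.getD (e.eval s).toNat 0 : ℕ)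

/-- All intermediate results have absolute value at most `B`, and all indices are valid. -/
def Safe (B : ℤ) (s : St) : Ex → Prop
  | var _ => True
  | num k => |k| ≤ B
  | add a b => a.Safe B s ∧ b.Safe B s ∧ |a.eval s + b.eval s| ≤ B
  | sub a b => a.Safe B s ∧ b.Safe B s ∧ |a.eval s - b.eval s| ≤ B
  | mul a b => a.Safe B s ∧ b.Safe B s ∧ |a.eval s * b.eval s| ≤ B
  | div a b => a.Safe B s ∧ b.Safe B s
  | get _ e => e.Safe B s ∧ 0 ≤ e.eval s
  | inp e => e.Safe B s ∧ 0 ≤ e.eval s ∧ e.eval s < s.inp.length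

/-- The number of instructions that evaluate the expression. -/
def size : Ex → ℕ
  | var _ => 2
  | num _ => 2
  | add a b => a.size + b.size + 4
  | sub a b => a.size + b.size + 4
  | mul a b => a.size + b.size + 8
  | div a b => a.size + b.size + 8
  | get _ e => e.size + 9
  | inp e => e.size + 2

/-- Code that evaluates an expression into the temporary registers `8 d + 2` (positive part) and
`8 d + 3` (negative part). -/
def code (d : ℕ) : Ex → List Instr
  | var v => [.add (8 * d + 2) (8 * v) 14, .add (8 * d + 3) (8 * v + 1) 14]
  | num k => [.const (8 * d + 2) k.toNat, .const (8 * d + 3) (-k).toNat]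
  | add a b => a.code d ++ (b.code (d + 1) ++
      [.add 22 (8 * d + 2) (8 * d + 10), .add 30 (8 * d + 3) (8 * d + 11),
        .sub (8 * d + 2) 22 30, .sub (8 * d + 3) 30 22])
  | sub a b => a.code d ++ (b.code (d + 1) ++
      [.add 22 (8 * d + 2) (8 * d + 11), .add 30 (8 * d + 3) (8 * d + 10),
        .sub (8 * d + 2) 22 30, .sub (8 * d + 3) 30 22])
  | mul a b => a.code d ++ (b.code (d + 1) ++
      [.mul 22 (8 * d + 2) (8 * d + 10), .mul 30 (8 * d + 3) (8 * d + 11), .add 22 22 30,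
        .mul 30 (8 * d + 2) (8 * d + 11), .mul 38 (8 * d + 3) (8 * d + 10), .add 30 30 38,
        .sub (8 * d + 2) 22 30, .sub (8 * d + 3) 30 22])
  | div a b => a.code d ++ (b.code (d + 1) ++
      [.div 22 (8 * d + 2) (8 * d + 10), .div 30 (8 * d + 3) (8 * d + 11), .add 22 22 30,
        .div 30 (8 * d + 2) (8 * d + 11), .div 38 (8 * d + 3) (8 * d + 10), .add 30 30 38,
        .sub (8 * d + 2) 22 30, .sub (8 * d + 3) 30 22])
  | get j e => e.code d ++
      [.const 22 32, .mul 22 22 (8 * d + 2), .add 22 22 6, .const 30 (2 * j.val), .add 22 22 30,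
        .load (8 * d + 2) 22, .const 30 1, .add 22 22 30, .load (8 * d + 3) 22]
  | inp e => e.code d ++ [.load (8 * d + 2) (8 * d + 2), .const (8 * d + 3) 0]

theorem length_code (e : Ex) (d : ℕ) : (e.code d).length = e.size := by
  induction e generalizing d <;> simp_all [code, size] <;> omega

end Ex

/-- The configuration `c` represents the state `s`. -/
structure Rep (s : St) (c : Config) : Prop where
  pos : ∀ v, c.reg (8 * v) = (s.var v).toNat
  neg : ∀ v, c.reg (8 * v + 1) = (-s.var v).toNat
  base : c.reg 6 = s.inp.length
  zero : c.reg 14 = 0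
  arrPos : ∀ (j : Fin 16) i, c.mem (s.inp.length + 32 * i + 2 * j.val) = (s.arr j i).toNat
  arrNeg : ∀ (j : Fin 16) i, c.mem (s.inp.length + 32 * i + 2 * j.val + 1) = (-s.arr j i).toNat
  inp : ∀ i < s.inp.length, c.mem i = s.inp.getD i 0

/-- The bound `m` for the machine is large enough for the bound `B` for programs. -/
def Fits (B : ℤ) (s : St) (m : ℕ) : Prop := 0 ≤ B ∧ 32 * B.toNat + s.inp.length + 64 ≤ m

theorem Ex.abs_eval_le {B : ℤ} {s : St} {e : Ex} (hs : s.Bounded B) (h : e.Safe B s)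
    (hB : 0 ≤ B) : |e.eval s| ≤ B := by
  induction e with
  | var v => exact hs.1 v
  | num k => exact h
  | add a b iha ihb => exact h.2.2
  | sub a b iha ihb => exact h.2.2
  | mul a b iha ihb => exact h.2.2
  | div a b iha ihb =>
    refine le_trans ?_ (iha h.1)
    rw [Int.abs_eq_natAbs, Int.abs_eq_natAbs, Ex.eval, Int.natAbs_tdiv]
    exact_mod_cast Nat.div_le_self _ _
  | get j e ih => exact hs.2.1 _ _
  | inp e ih =>
    simp only [Ex.eval, List.getD_eq_getElem?_getD]
    rcases h' : s.inp[(e.eval s).toNat]? with _ | x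
    · simpa using hB
    · simpa using hs.2.2 x (List.mem_of_getElem? h')

/-- Registers that the evaluation of an expression at depth `d` leaves unchanged. -/
def Kept (d r : ℕ) : Prop := r ≠ 22 ∧ r ≠ 30 ∧ r ≠ 38 ∧ ((r % 8 = 2 ∨ r % 8 = 3) → r < 8 * d)

/-- Registers are laid out by residue modulo 8: residues 0 and 1 hold the positive and negative
parts of variables, 2 and 3 the temporaries of expressions by depth, 4 and 5 the counters and bounds
of loops by nesting depth. Of residue 6, register 6 is the start of the arrays in memory, 14 is
constantly zero, and 22, 30 and 38 are scratch. Evaluating an expression therefore touches nothing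
that represents the state. -/
theorem Rep.of_kept {s : St} {c c' : Config} {d : ℕ} (h : Rep s c)
    (hr : ∀ r, Kept d r → c'.reg r = c.reg r) (hm : c'.mem = c.mem) : Rep s c' where
  pos v := by rw [hr _ (by unfold Kept; omega)]; exact h.pos v
  neg v := by rw [hr _ (by unfold Kept; omega)]; exact h.neg v
  base := by rw [hr _ (by unfold Kept; omega)]; exact h.base
  zero := by rw [hr _ (by unfold Kept; omega)]; exact h.zero
  arrPos j i := by rw [hm]; exact h.arrPos j i
  arrNeg j i := by rw [hm]; exact h.arrNeg j i
  inp i hi := by rw [hm]; exact h.inp i hi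

/-- What running the code of an expression achieves. -/
structure Evaluated (P : Program) (m : ℕ) (c : Config) (e : Ex) (s : St) (d : ℕ)
    (c' : Config) : Prop where
  reach : Reach P m c e.size c'
  pc : c'.pc = c.pc + e.size
  pos : c'.reg (8 * d + 2) = (e.eval s).toNat
  neg : c'.reg (8 * d + 3) = (-e.eval s).toNat
  kept : ∀ r, Kept d r → c'.reg r = c.reg r
  mem : c'.mem = c.mem

theorem Evaluated.rep {P : Program} {m : ℕ} {c c' : Config} {e : Ex} {s : St} {d : ℕ}
    (h : Evaluated P m c e s d c') (hs : Rep s c) : Rep s c' := hs.of_kept h.kept h.mem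

/-- One part of each factor vanishes, so at most one of the four products survives, on the side
given by the sign. No cancellation takes place, hence no intermediate value of the machine exceeds
the absolute value of the result. -/
theorem toNat_mul_parts (x y : ℤ) :
    x.toNat * y.toNat + (-x).toNat * (-y).toNat = (x * y).toNat ∧
      x.toNat * (-y).toNat + (-x).toNat * y.toNat = (-(x * y)).toNat := by
  rcases le_total 0 x with hx | hx <;> rcases le_total 0 y with hy | hy
  · obtain ⟨a, rfl⟩ := Int.eq_ofNat_of_zero_le hx
    obtain ⟨b, rfl⟩ := Int.eq_ofNat_of_zero_le hy
    constructor <;> zify <;> simp <;> positivity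
  · obtain ⟨a, rfl⟩ := Int.eq_ofNat_of_zero_le hx
    obtain ⟨b, hb⟩ := Int.eq_ofNat_of_zero_le (neg_nonneg.2 hy)
    obtain rfl : y = -b := by omega
    constructor <;> zify <;> simp <;> positivity
  · obtain ⟨b, rfl⟩ := Int.eq_ofNat_of_zero_le hy
    obtain ⟨a, ha⟩ := Int.eq_ofNat_of_zero_le (neg_nonneg.2 hx)
    obtain rfl : x = -a := by omega
    constructor <;> zify <;> simp <;> positivity
  · obtain ⟨a, ha⟩ := Int.eq_ofNat_of_zero_le (neg_nonneg.2 hx)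
    obtain rfl : x = -a := by omega
    obtain ⟨b, hb⟩ := Int.eq_ofNat_of_zero_le (neg_nonneg.2 hy)
    obtain rfl : y = -b := by omega
    constructor <;> zify <;> simp <;> positivity

/-- As for products; this is why the division of the language rounds towards zero. Division by zero
gives zero on both sides. -/
theorem toNat_tdiv_parts (x y : ℤ) :
    x.toNat / y.toNat + (-x).toNat / (-y).toNat = (x.tdiv y).toNat ∧
      x.toNat / (-y).toNat + (-x).toNat / y.toNat = (-(x.tdiv y)).toNat := by
  have key : ∀ a b : ℕ, ((a : ℤ).tdiv b) = ((a / b : ℕ) : ℤ) := fun a b => by simp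
  rcases le_total 0 x with hx | hx <;> rcases le_total 0 y with hy | hy
  · obtain ⟨a, rfl⟩ := Int.eq_ofNat_of_zero_le hx
    obtain ⟨b, rfl⟩ := Int.eq_ofNat_of_zero_le hy
    rw [key]
    simp only [Int.toNat_natCast, Int.toNat_neg_natCast, Nat.zero_div, Nat.div_zero]
    simp
  · obtain ⟨a, rfl⟩ := Int.eq_ofNat_of_zero_le hx
    obtain ⟨b, hb⟩ := Int.eq_ofNat_of_zero_le (neg_nonneg.2 hy)
    obtain rfl : y = -b := by omega
    rw [Int.tdiv_neg, key]
    simp only [neg_neg, Int.toNat_natCast, Int.toNat_neg_natCast, Nat.zero_div, Nat.div_zero]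
    simp
  · obtain ⟨b, rfl⟩ := Int.eq_ofNat_of_zero_le hy
    obtain ⟨a, ha⟩ := Int.eq_ofNat_of_zero_le (neg_nonneg.2 hx)
    obtain rfl : x = -a := by omega
    rw [Int.neg_tdiv, key]
    simp only [neg_neg, Int.toNat_natCast, Int.toNat_neg_natCast, Nat.zero_div, Nat.div_zero]
    simp
  · obtain ⟨a, ha⟩ := Int.eq_ofNat_of_zero_le (neg_nonneg.2 hx)
    obtain rfl : x = -a := by omega
    obtain ⟨b, hb⟩ := Int.eq_ofNat_of_zero_le (neg_nonneg.2 hy)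
    obtain rfl : y = -b := by omega
    rw [Int.tdiv_neg, Int.neg_tdiv, neg_neg, key]
    simp only [neg_neg, Int.toNat_natCast, Int.toNat_neg_natCast, Nat.zero_div, Nat.div_zero]
    simp

end IntProg

/-! ### Correctness of the code for expressions -/

namespace IntProg

open RAM

/-- The common pattern of the binary operations: the left operand is evaluated at depth `d`, the
right one at depth `d + 1`, where it cannot disturb the first, and the instructions `l` combine
them. -/
theorem Evaluated.then {P : Program} {m : ℕ} {c c₁ c₂ : Config} {e e' e'' : Ex} {s : St} {d : ℕ}
    {l : List Instr} (h₁ : Evaluated P m c e s d c₁) (h₂ : Evaluated P m c₁ e' s (d + 1) c₂)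
    (hP : CodeAt P c.pc (e.code d ++ (e'.code (d + 1) ++ l)))
    (hs : e''.size = e.size + e'.size + l.length)
    (hl : ValuesOk m l c₂)
    (hpos : (execs l c₂).reg (8 * d + 2) = (e''.eval s).toNat)
    (hneg : (execs l c₂).reg (8 * d + 3) = (-e''.eval s).toNat)
    (hkept : ∀ r, Kept d r → (execs l c₂).reg r = c₂.reg r)
    (hmem : (execs l c₂).mem = c₂.mem) : Evaluated P m c e'' s d (execs l c₂) := by
  have hP' : CodeAt P c₂.pc l := by
    have := hP.right.right
    rwa [Ex.length_code, Ex.length_code, ← h₁.pc, ← h₂.pc] at this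
  obtain ⟨hr, hpc⟩ := Reach.execs l hP' h₂.reach.bounded hl
  refine ⟨?_, ?_, hpos, hneg, fun r hr => ?_, ?_⟩
  · rw [hs]; exact (h₁.reach.trans h₂.reach).trans hr
  · rw [hpc, h₂.pc, h₁.pc, hs]; omega
  · rw [hkept r hr, h₂.kept r (by unfold Kept at *; omega), h₁.kept r hr]
  · rw [hmem, h₂.mem, h₁.mem]

/-- The two truncated differences, taken in both directions, turn any pair with the right difference
into the normal form in which one part is zero. -/
theorem execs_finish (d : ℕ) (c : Config) (x : ℤ)
    (h : (c.reg 22 : ℤ) - c.reg 30 = x) :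
    let c' := execs [.sub (8 * d + 2) 22 30, .sub (8 * d + 3) 30 22] c
    c'.reg (8 * d + 2) = x.toNat ∧ c'.reg (8 * d + 3) = (-x).toNat ∧
      (∀ r, Kept d r → c'.reg r = c.reg r) ∧ c'.mem = c.mem := by
  refine ⟨?_, ?_, fun r hr => ?_, rfl⟩
  · simp (disch := omega) only [execs, exec, Function.update_of_ne, Function.update_self]
    omega
  · simp (disch := omega) only [execs, exec, Function.update_of_ne, Function.update_self]
    omega
  · unfold Kept at hr
    simp (disch := omega) only [execs, exec, Function.update_of_ne]

theorem toNat_le_of_abs_le {x B : ℤ} {b : ℕ} (h : |x| ≤ B) (hb : B.toNat ≤ b) :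
    x.toNat ≤ b ∧ (-x).toNat ≤ b := by
  rw [abs_le] at h
  omega

theorem Evaluated.args {P : Program} {m : ℕ} {c c₁ c₂ : Config} {e e' : Ex} {s : St} {d : ℕ}
    (h₁ : Evaluated P m c e s d c₁) (h₂ : Evaluated P m c₁ e' s (d + 1) c₂) :
    c₂.reg (8 * d + 2) = (e.eval s).toNat ∧ c₂.reg (8 * d + 3) = (-e.eval s).toNat ∧
    c₂.reg (8 * d + 10) = (e'.eval s).toNat ∧ c₂.reg (8 * d + 11) = (-e'.eval s).toNat := by
  refine ⟨?_, ?_, h₂.pos, h₂.neg⟩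
  · rw [h₂.kept _ (by unfold Kept; omega), h₁.pos]
  · rw [h₂.kept _ (by unfold Kept; omega), h₁.neg]

theorem Ex.evaluated {P : Program} {m : ℕ} {B : ℤ} {s : St} (hs : s.Bounded B)
    (hfit : Fits B s m) (e : Ex) (d : ℕ) (c : Config) (hP : CodeAt P c.pc (e.code d))
    (hc : c.Bounded m) (hr : Rep s c) (he : e.Safe B s) : ∃ c', Evaluated P m c e s d c' := by
  obtain ⟨hB, hm⟩ := hfit
  induction e generalizing d c with
  | var v =>
    have hv : ValuesOk m ((Ex.var v).code d) c := by
      simp (disch := omega) only [code, ValuesOk, ValueOk, exec, Function.update_of_ne, hr.zero]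
      exact ⟨(hc _).1, (hc _).1, trivial⟩
    obtain ⟨h₁, h₂⟩ := Reach.execs _ hP hc hv
    refine ⟨_, h₁, h₂, ?_, ?_, fun r hk => ?_, rfl⟩
    · simp (disch := omega) only [code, execs, exec, Function.update_of_ne, Function.update_self,
        hr.zero, hr.pos, add_zero, Ex.eval]
    · simp (disch := omega) only [code, execs, exec, Function.update_of_ne, Function.update_self,
        hr.zero, hr.neg, add_zero, Ex.eval]
    · unfold Kept at hk
      simp (disch := omega) only [code, execs, exec, Function.update_of_ne]
  | num k =>
    have hk := toNat_le_of_abs_le he le_rfl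
    have hv : ValuesOk m ((Ex.num k).code d) c := by
      simp only [code, ValuesOk, ValueOk, and_true]
      omega
    obtain ⟨h₁, h₂⟩ := Reach.execs _ hP hc hv
    refine ⟨_, h₁, h₂, ?_, ?_, fun r hk => ?_, rfl⟩
    · simp (disch := omega) only [code, execs, exec, Function.update_of_ne, Function.update_self,
        Ex.eval]
    · simp (disch := omega) only [code, execs, exec, Function.update_self, Ex.eval]
    · unfold Kept at hk
      simp (disch := omega) only [code, execs, exec, Function.update_of_ne]
  | add a b iha ihb =>
    obtain ⟨c₁, h₁⟩ := iha d c hP.left hc hr he.1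
    obtain ⟨c₂, h₂⟩ := ihb (d + 1) c₁ (by
      have := hP.right.left; rwa [length_code, ← h₁.pc] at this) h₁.reach.bounded (h₁.rep hr) he.2.1
    obtain ⟨g₁, g₂, g₃, g₄⟩ := h₁.args h₂
    have ha := toNat_le_of_abs_le (abs_eval_le hs he.1 hB) le_rfl
    have hb := toNat_le_of_abs_le (abs_eval_le hs he.2.1 hB) le_rfl
    obtain ⟨f₁, f₂, f₃, f₄⟩ := execs_finish d
      (execs [.add 22 (8 * d + 2) (8 * d + 10), .add 30 (8 * d + 3) (8 * d + 11)] c₂)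
      (a.eval s + b.eval s) (by
        simp (disch := omega) only [execs, exec, Function.update_of_ne, Function.update_self, *]
        omega)
    refine ⟨_, h₁.then h₂ hP rfl ?_ f₁ f₂ (fun r hk => ?_) f₄⟩
    · simp (disch := omega) only [ValuesOk, ValueOk, and_true, exec, Function.update_of_ne, *]
      omega
    · refine (f₃ r hk).trans ?_
      unfold Kept at hk
      simp (disch := omega) only [execs, exec, Function.update_of_ne]
  | sub a b iha ihb =>
    obtain ⟨c₁, h₁⟩ := iha d c hP.left hc hr he.1
    obtain ⟨c₂, h₂⟩ := ihb (d + 1) c₁ (by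
      have := hP.right.left; rwa [length_code, ← h₁.pc] at this) h₁.reach.bounded (h₁.rep hr) he.2.1
    obtain ⟨g₁, g₂, g₃, g₄⟩ := h₁.args h₂
    have ha := toNat_le_of_abs_le (abs_eval_le hs he.1 hB) le_rfl
    have hb := toNat_le_of_abs_le (abs_eval_le hs he.2.1 hB) le_rfl
    obtain ⟨f₁, f₂, f₃, f₄⟩ := execs_finish d
      (execs [.add 22 (8 * d + 2) (8 * d + 11), .add 30 (8 * d + 3) (8 * d + 10)] c₂)
      (a.eval s - b.eval s) (by
        simp (disch := omega) only [execs, exec, Function.update_of_ne, Function.update_self, *]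
        omega)
    refine ⟨_, h₁.then h₂ hP rfl ?_ f₁ f₂ (fun r hk => ?_) f₄⟩
    · simp (disch := omega) only [ValuesOk, ValueOk, and_true, exec, Function.update_of_ne, *]
      omega
    · refine (f₃ r hk).trans ?_
      unfold Kept at hk
      simp (disch := omega) only [execs, exec, Function.update_of_ne]
  | mul a b iha ihb =>
    obtain ⟨c₁, h₁⟩ := iha d c hP.left hc hr he.1
    obtain ⟨c₂, h₂⟩ := ihb (d + 1) c₁ (by
      have := hP.right.left; rwa [length_code, ← h₁.pc] at this) h₁.reach.bounded (h₁.rep hr) he.2.1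
    obtain ⟨g₁, g₂, g₃, g₄⟩ := h₁.args h₂
    obtain ⟨k₁, k₂⟩ := toNat_mul_parts (a.eval s) (b.eval s)
    have hab := toNat_le_of_abs_le he.2.2 le_rfl
    obtain ⟨f₁, f₂, f₃, f₄⟩ := execs_finish d
      (execs [.mul 22 (8 * d + 2) (8 * d + 10), .mul 30 (8 * d + 3) (8 * d + 11), .add 22 22 30,
        .mul 30 (8 * d + 2) (8 * d + 11), .mul 38 (8 * d + 3) (8 * d + 10), .add 30 30 38] c₂)
      (a.eval s * b.eval s) (by
        simp (disch := omega) only [execs, exec, Function.update_of_ne, Function.update_self, *]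
        omega)
    refine ⟨_, h₁.then h₂ hP rfl ?_ f₁ f₂ (fun r hk => ?_) f₄⟩
    · simp (disch := omega) only [ValuesOk, ValueOk, and_true, exec, Function.update_of_ne,
        Function.update_self, *]
      omega
    · refine (f₃ r hk).trans ?_
      unfold Kept at hk
      simp (disch := omega) only [execs, exec, Function.update_of_ne]
  | div a b iha ihb =>
    obtain ⟨c₁, h₁⟩ := iha d c hP.left hc hr he.1
    obtain ⟨c₂, h₂⟩ := ihb (d + 1) c₁ (by
      have := hP.right.left; rwa [length_code, ← h₁.pc] at this) h₁.reach.bounded (h₁.rep hr) he.2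
    obtain ⟨g₁, g₂, g₃, g₄⟩ := h₁.args h₂
    obtain ⟨k₁, k₂⟩ := toNat_tdiv_parts (a.eval s) (b.eval s)
    have hab := toNat_le_of_abs_le (abs_eval_le (e := .div a b) hs he hB) le_rfl
    simp only [Ex.eval] at hab
    obtain ⟨f₁, f₂, f₃, f₄⟩ := execs_finish d
      (execs [.div 22 (8 * d + 2) (8 * d + 10), .div 30 (8 * d + 3) (8 * d + 11), .add 22 22 30,
        .div 30 (8 * d + 2) (8 * d + 11), .div 38 (8 * d + 3) (8 * d + 10), .add 30 30 38] c₂)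
      ((a.eval s).tdiv (b.eval s)) (by
        simp (disch := omega) only [execs, exec, Function.update_of_ne, Function.update_self, *]
        omega)
    refine ⟨_, h₁.then h₂ hP rfl ?_ f₁ f₂ (fun r hk => ?_) f₄⟩
    · simp (disch := omega) only [ValuesOk, ValueOk, and_true, true_and, exec, Function.update_of_ne,
        Function.update_self, *]
      omega
    · refine (f₃ r hk).trans ?_
      unfold Kept at hk
      simp (disch := omega) only [execs, exec, Function.update_of_ne]
  | get j e ih =>
    obtain ⟨c₁, h₁⟩ := ih d c hP.left hc hr he.1
    have hr₁ := h₁.rep hr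
    have hb := toNat_le_of_abs_le (abs_eval_le hs he.1 hB) le_rfl
    have hj := j.2
    have hv : ValuesOk m [.const 22 32, .mul 22 22 (8 * d + 2), .add 22 22 6, .const 30 (2 * j.val),
        .add 22 22 30, .load (8 * d + 2) 22, .const 30 1, .add 22 22 30, .load (8 * d + 3) 22]
        c₁ := by
      simp (disch := omega) only [ValuesOk, ValueOk, and_true, true_and, exec, Function.update_of_ne,
        Function.update_self, h₁.pos, hr₁.base]
      omega
    have hP' := hP.right
    rw [length_code, ← h₁.pc] at hP'
    obtain ⟨h₂, h₃⟩ := Reach.execs _ hP' h₁.reach.bounded hv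
    have key : ∀ n i j, 32 * i + n + 2 * j = n + 32 * i + 2 * j := fun n i j => by omega
    refine ⟨_, h₁.reach.trans h₂, ?_, ?_, ?_, fun r hk => ?_, h₁.mem⟩
    · rw [h₃, h₁.pc]; simp only [List.length_cons, List.length_nil, size]; omega
    · simp (disch := omega) only [execs, exec, Function.update_of_ne, Function.update_self, h₁.pos,
        hr₁.base, Ex.eval, key, hr₁.arrPos]
    · simp (disch := omega) only [execs, exec, Function.update_of_ne, Function.update_self, h₁.pos,
        hr₁.base, Ex.eval, key, hr₁.arrNeg]
    · refine Eq.trans ?_ (h₁.kept r hk)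
      unfold Kept at hk
      simp (disch := omega) only [execs, exec, Function.update_of_ne]
  | inp e ih =>
    obtain ⟨c₁, h₁⟩ := ih d c hP.left hc hr he.1
    have hr₁ := h₁.rep hr
    have hP' := hP.right
    rw [length_code, ← h₁.pc] at hP'
    obtain ⟨h₂, h₃⟩ := Reach.execs _ hP' h₁.reach.bounded (m := m)
      (by simp only [ValuesOk, ValueOk, and_true, true_and]; omega)
    have hlt := he.2.2
    have h0 := he.2.1
    refine ⟨_, h₁.reach.trans h₂, ?_, ?_, ?_, fun r hk => ?_, h₁.mem⟩
    · rw [h₃, h₁.pc]; simp only [List.length_cons, List.length_nil, size]; omega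
    · simp (disch := omega) only [execs, exec, Function.update_of_ne, Function.update_self, h₁.pos,
        Ex.eval, Int.toNat_natCast, hr₁.inp]
    · simp (disch := omega) only [execs, exec, Function.update_self, Ex.eval,
        Int.toNat_neg_natCast]
    · refine Eq.trans ?_ (h₁.kept r hk)
      unfold Kept at hk
      simp (disch := omega) only [execs, exec, Function.update_of_ne]

end IntProg

/-! ### Commands, their cost and their machine code -/

namespace IntProg

open RAM

/-- The state after `j` rounds of a loop with counter `v` and body `f`. -/
def iter (f : St → St) (v : ℕ) : ℕ → St → St
  | 0, s => s
  | j + 1, s => f ((iter f v j s).setVar v j)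

namespace Cmd

def eval : Cmd → St → St
  | assign v e, s => s.setVar v (e.eval s)
  | store j e₁ e₂, s => s.setArr j (e₁.eval s).toNat (e₂.eval s)
  | seq c₁ c₂, s => c₂.eval (c₁.eval s)
  | ite e c₁ c₂, s => if 0 < e.eval s then c₁.eval s else c₂.eval s
  | loop v e c, s => iter c.eval v (e.eval s).toNat s

/-- All intermediate results have absolute value at most `B`, and all indices are valid. -/
def Safe (B : ℤ) : Cmd → St → Prop
  | assign _ e, s => e.Safe B s
  | store _ e₁ e₂, s => e₁.Safe B s ∧ e₂.Safe B s ∧ 0 ≤ e₁.eval s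
  | seq c₁ c₂, s => c₁.Safe B s ∧ c₂.Safe B (c₁.eval s)
  | ite e c₁ c₂, s => e.Safe B s ∧ if 0 < e.eval s then c₁.Safe B s else c₂.Safe B s
  | loop v e c, s => e.Safe B s ∧
      ∀ j < (e.eval s).toNat, c.Safe B ((iter c.eval v j s).setVar v j)

/-- The number of machine steps. -/
def cost : Cmd → St → ℕ
  | assign _ e, _ => e.size + 2
  | store _ e₁ e₂, _ => e₁.size + e₂.size + 9
  | seq c₁ c₂, s => c₁.cost s + c₂.cost (c₁.eval s)
  | ite e c₁ c₂, s => e.size + 1 + if 0 < e.eval s then c₁.cost s + 1 else c₂.cost s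
  | loop v e c, s => e.size + 2 +
      ∑ j ∈ Finset.range (e.eval s).toNat, (c.cost ((iter c.eval v j s).setVar v j) + 7) + 2

/-- The number of instructions. -/
def size : Cmd → ℕ
  | assign _ e => e.size + 2
  | store _ e₁ e₂ => e₁.size + e₂.size + 9
  | seq c₁ c₂ => c₁.size + c₂.size
  | ite e c₁ c₂ => e.size + c₁.size + c₂.size + 2
  | loop _ e c => e.size + c.size + 9

/-- Machine code, to be placed at `off`, in a context of `ld` nested loops. -/
def code : Cmd → ℕ → ℕ → List Instr
  | assign v e, _, _ => e.code 0 ++ [.add (8 * v) 2 14, .add (8 * v + 1) 3 14]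
  | store j e₁ e₂, _, _ => e₁.code 0 ++ (e₂.code 1 ++
      [.const 22 32, .mul 22 22 2, .add 22 22 6, .const 30 (2 * j.val), .add 22 22 30,
        .store 22 10, .const 30 1, .add 22 22 30, .store 22 11])
  | seq c₁ c₂, off, ld => c₁.code off ld ++ c₂.code (off + c₁.size) ld
  | ite e c₁ c₂, off, ld => e.code 0 ++ (.jumpZero 2 (off + e.size + c₁.size + 2) ::
      (c₁.code (off + e.size + 1) ld ++
        (.jumpZero 14 (off + e.size + c₁.size + c₂.size + 2) ::
          c₂.code (off + e.size + c₁.size + 2) ld)))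
  | loop v e c, off, ld => e.code 0 ++ (.add (8 * ld + 5) 2 14 :: .const (8 * ld + 4) 0 ::
      ([.sub 22 (8 * ld + 5) (8 * ld + 4), .jumpZero 22 (off + e.size + c.size + 9),
        .add (8 * v) (8 * ld + 4) 14, .const (8 * v + 1) 0] ++
        (c.code (off + e.size + 6) (ld + 1) ++
          [.const 22 1, .add (8 * ld + 4) (8 * ld + 4) 22, .jumpZero 14 (off + e.size + 2)])))

theorem length_code (c : Cmd) (off ld : ℕ) : (c.code off ld).length = c.size := by
  induction c generalizing off ld <;> simp_all [code, size, Ex.length_code] <;> omega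

end Cmd

theorem iter_inp {f : St → St} (hf : ∀ s, (f s).inp = s.inp) (v j : ℕ) (s : St) :
    (iter f v j s).inp = s.inp := by
  induction j with
  | zero => rfl
  | succ j ih => rw [iter, hf]; exact ih

theorem Cmd.eval_inp (c : Cmd) (s : St) : (c.eval s).inp = s.inp := by
  induction c generalizing s with
  | assign v e => rfl
  | store j e₁ e₂ => rfl
  | seq c₁ c₂ h₁ h₂ => rw [eval, h₂, h₁]
  | ite e c₁ c₂ h₁ h₂ => rw [eval]; split_ifs <;> simp [*]
  | loop v e c h => exact iter_inp h _ _ _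

theorem St.Bounded.setVar {B : ℤ} {s : St} (h : s.Bounded B) (v : ℕ) {x : ℤ} (hx : |x| ≤ B) :
    (s.setVar v x).Bounded B := by
  refine ⟨fun w => ?_, h.2⟩
  simp only [St.setVar, Function.update_apply]
  split_ifs
  exacts [hx, h.1 w]

theorem St.Bounded.setArr {B : ℤ} {s : St} (h : s.Bounded B) (j : Fin 16) (i : ℕ) {x : ℤ}
    (hx : |x| ≤ B) : (s.setArr j i x).Bounded B := by
  refine ⟨h.1, fun j' i' => ?_, h.2.2⟩
  simp only [St.setArr, Function.update_apply]
  split_ifs with h₁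
  · simp only [Function.update_apply]
    split_ifs
    exacts [hx, h.2.1 _ _]
  · exact h.2.1 _ _

theorem abs_natCast_le_of_lt_toNat {B x : ℤ} {j : ℕ} (hx : |x| ≤ B) (hj : j < x.toNat) :
    |(j : ℤ)| ≤ B := by
  rw [abs_le] at *
  omega

theorem Cmd.bounded_eval {B : ℤ} (hB : 0 ≤ B) (c : Cmd) {s : St} (hs : s.Bounded B)
    (hc : c.Safe B s) : (c.eval s).Bounded B := by
  induction c generalizing s with
  | assign v e => exact hs.setVar v (Ex.abs_eval_le hs hc hB)
  | store j e₁ e₂ => exact hs.setArr j _ (Ex.abs_eval_le hs hc.2.1 hB)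
  | seq c₁ c₂ h₁ h₂ => exact h₂ (h₁ hs hc.1) hc.2
  | ite e c₁ c₂ h₁ h₂ =>
    obtain ⟨_, h⟩ := hc
    rw [eval]
    split_ifs at h ⊢ with h'
    exacts [h₁ hs h, h₂ hs h]
  | loop v e c h =>
    have key : ∀ j ≤ (e.eval s).toNat, (iter c.eval v j s).Bounded B := by
      intro j
      induction j with
      | zero => exact fun _ => hs
      | succ j ih =>
        intro hj
        exact h ((ih (by omega)).setVar v
          (abs_natCast_le_of_lt_toNat (Ex.abs_eval_le hs hc.1 hB) hj)) (hc.2 j hj)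
    exact key _ le_rfl

theorem Cmd.iter_bounded {B : ℤ} (hB : 0 ≤ B) {v : ℕ} {e : Ex} {c : Cmd} {s : St}
    (hs : s.Bounded B) (hc : (Cmd.loop v e c).Safe B s) :
    ∀ j ≤ (e.eval s).toNat, (iter c.eval v j s).Bounded B := by
  intro j
  induction j with
  | zero => exact fun _ => hs
  | succ j ih =>
    intro hj
    exact c.bounded_eval hB ((ih (by omega)).setVar v
      (abs_natCast_le_of_lt_toNat (Ex.abs_eval_le hs hc.1 hB) hj)) (hc.2 j hj)

theorem Rep.setVar {s : St} {c c' : Config} {v : ℕ} {x : ℤ} (h : Rep s c)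
    (h₁ : c'.reg (8 * v) = x.toNat) (h₂ : c'.reg (8 * v + 1) = (-x).toNat)
    (h₃ : ∀ r, r ≠ 8 * v → r ≠ 8 * v + 1 → (r % 8 = 0 ∨ r % 8 = 1 ∨ r = 6 ∨ r = 14) →
      c'.reg r = c.reg r) (hm : c'.mem = c.mem) : Rep (s.setVar v x) c' where
  pos w := by
    simp only [St.setVar, Function.update_apply]
    split_ifs with hw
    · rw [hw, h₁]
    · rw [h₃ _ (by omega) (by omega) (by omega), h.pos]
  neg w := by
    simp only [St.setVar, Function.update_apply]
    split_ifs with hw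
    · rw [hw, h₂]
    · rw [h₃ _ (by omega) (by omega) (by omega), h.neg]
  base := by rw [h₃ _ (by omega) (by omega) (by omega)]; exact h.base
  zero := by rw [h₃ _ (by omega) (by omega) (by omega)]; exact h.zero
  arrPos j i := by rw [hm]; exact h.arrPos j i
  arrNeg j i := by rw [hm]; exact h.arrNeg j i
  inp i hi := by rw [hm]; exact h.inp i hi

/-- The cells of array `j` at index `i` have offset `32 * i + 2 * j` and the next one from the end
of the input. As `j < 16`, these pairs of cells are disjoint from each other and from the input. -/
theorem Rep.setArr {s : St} {c c' : Config} {j : Fin 16} {i : ℕ} {x : ℤ} (h : Rep s c)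
    (h₁ : ∀ r, (r % 8 = 0 ∨ r % 8 = 1 ∨ r = 6 ∨ r = 14) → c'.reg r = c.reg r)
    (hm : c'.mem = Function.update (Function.update c.mem (s.inp.length + 32 * i + 2 * j.val)
      x.toNat) (s.inp.length + 32 * i + 2 * j.val + 1) (-x).toNat) : Rep (s.setArr j i x) c' where
  pos v := by rw [h₁ _ (by omega)]; exact h.pos v
  neg v := by rw [h₁ _ (by omega)]; exact h.neg v
  base := by rw [h₁ _ (by omega)]; exact h.base
  zero := by rw [h₁ _ (by omega)]; exact h.zero
  arrPos j' i' := by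
    have hj := j.2
    have hj' := j'.2
    rw [hm]
    simp only [St.setArr]
    by_cases hjj : j' = j
    · subst hjj
      by_cases hii : i' = i
      · subst hii
        simp
      · rw [Function.update_of_ne (by omega), Function.update_of_ne (by omega),
          Function.update_self, Function.update_of_ne hii, h.arrPos]
    · have : j'.val ≠ j.val := fun hc => hjj (Fin.ext hc)
      rw [Function.update_of_ne (by omega), Function.update_of_ne (by omega),
        Function.update_of_ne hjj, h.arrPos]
  arrNeg j' i' := by
    have hj := j.2
    have hj' := j'.2
    rw [hm]
    simp only [St.setArr]
    by_cases hjj : j' = j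
    · subst hjj
      by_cases hii : i' = i
      · subst hii
        simp
      · rw [Function.update_of_ne (by omega), Function.update_of_ne (by omega),
          Function.update_self, Function.update_of_ne hii, h.arrNeg]
    · have : j'.val ≠ j.val := fun hc => hjj (Fin.ext hc)
      rw [Function.update_of_ne (by omega), Function.update_of_ne (by omega),
        Function.update_of_ne hjj, h.arrNeg]
  inp k hk := by
    simp only [St.setArr] at hk ⊢
    rw [hm, Function.update_of_ne (by omega), Function.update_of_ne (by omega), h.inp k hk]

/-- What running the code of a program achieves. -/
structure Executed (P : Program) (m : ℕ) (cf : Config) (c : Cmd) (s : St) (ld : ℕ)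
    (cf' : Config) : Prop where
  reach : Reach P m cf (c.cost s) cf'
  pc : cf'.pc = cf.pc + c.size
  rep : Rep (c.eval s) cf'
  kept : ∀ l < ld, cf'.reg (8 * l + 4) = cf.reg (8 * l + 4) ∧
    cf'.reg (8 * l + 5) = cf.reg (8 * l + 5)

theorem reach_jump {P : Program} {m : ℕ} {cf : Config} {r l : ℕ} (hP : P[cf.pc]? = some (.jumpZero r l))
    (hc : cf.Bounded m) :
    Reach P m cf 1 ⟨if cf.reg r = 0 then l else cf.pc + 1, cf.reg, cf.mem⟩ :=
  Reach.single hP hc hc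

/-- The compiled program computes what the program computes, at the same cost. -/
theorem Cmd.executed {P : Program} {m : ℕ} {B : ℤ} (c : Cmd) (ld : ℕ) {s : St} (cf : Config)
    (hs : s.Bounded B) (hfit : Fits B s m) (hP : CodeAt P cf.pc (c.code cf.pc ld))
    (hcf : cf.Bounded m) (hr : Rep s cf) (hc : c.Safe B s) :
    ∃ cf', Executed P m cf c s ld cf' := by
  induction c generalizing ld s cf with
  | assign v e =>
    obtain ⟨c₁, h₁⟩ := Ex.evaluated hs hfit e 0 cf hP.left hcf hr hc
    have hr₁ := h₁.rep hr
    have hP' := hP.right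
    rw [Ex.length_code, ← h₁.pc] at hP'
    obtain ⟨h₂, h₃⟩ := Reach.execs _ hP' h₁.reach.bounded (m := m) (by
      simp (disch := omega) only [ValuesOk, ValueOk, and_true, exec, Function.update_of_ne,
        hr₁.zero]
      exact ⟨(h₁.reach.bounded _).1, (h₁.reach.bounded _).1⟩)
    have hp := h₁.pos
    have hn := h₁.neg
    norm_num at hp hn
    refine ⟨_, h₁.reach.trans h₂, ?_, hr₁.setVar ?_ ?_ (fun r _ _ hr => ?_) rfl, fun l hl => ?_⟩
    · rw [h₃, h₁.pc]; simp [size]; omega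
    · simp (disch := omega) only [execs, exec, Function.update_of_ne, Function.update_self, hp,
        hr₁.zero, add_zero]
    · simp (disch := omega) only [execs, exec, Function.update_of_ne, Function.update_self, hn,
        hr₁.zero, add_zero]
    · simp (disch := omega) only [execs, exec, Function.update_of_ne]
    · rw [← h₁.kept (8 * l + 4) (by unfold Kept; omega),
        ← h₁.kept (8 * l + 5) (by unfold Kept; omega)]
      simp (disch := omega) only [execs, exec, Function.update_of_ne, and_self]
  | store j e₁ e₂ =>
    obtain ⟨c₁, h₁⟩ := Ex.evaluated hs hfit e₁ 0 cf hP.left hcf hr hc.1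
    obtain ⟨c₂, h₂⟩ := Ex.evaluated hs hfit e₂ 1 c₁ (by
      have := hP.right.left; rwa [Ex.length_code, ← h₁.pc] at this) h₁.reach.bounded
      (h₁.rep hr) hc.2.1
    have hr₂ := h₂.rep (h₁.rep hr)
    obtain ⟨g₁, g₂, g₃, g₄⟩ := h₁.args h₂
    norm_num at g₁ g₂ g₃ g₄
    have hP' := hP.right.right
    rw [Ex.length_code, Ex.length_code, ← h₁.pc, ← h₂.pc] at hP'
    have hb := toNat_le_of_abs_le (Ex.abs_eval_le hs hc.1 hfit.1) le_rfl
    have hfit' := hfit.2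
    have hj := j.2
    obtain ⟨h₃, h₄⟩ := Reach.execs _ hP' h₂.reach.bounded (m := m) (by
      simp (disch := omega) only [ValuesOk, ValueOk, and_true, true_and, exec,
        Function.update_of_ne, Function.update_self, g₁, hr₂.base]
      omega)
    have key : ∀ n i j, 32 * i + n + 2 * j = n + 32 * i + 2 * j := fun n i j => by omega
    refine ⟨_, (h₁.reach.trans h₂.reach).trans h₃, ?_,
      hr₂.setArr (fun r hr => ?_) ?_, fun l hl => ?_⟩
    · rw [h₄, h₂.pc, h₁.pc]; simp [size]; omega
    · simp (disch := omega) only [execs, exec, Function.update_of_ne]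
    · simp (disch := omega) only [execs, exec, Function.update_of_ne, Function.update_self, g₁, g₃,
        g₄, hr₂.base, key]
    · rw [← h₁.kept (8 * l + 4) (by unfold Kept; omega),
        ← h₁.kept (8 * l + 5) (by unfold Kept; omega),
        ← h₂.kept (8 * l + 4) (by unfold Kept; omega),
        ← h₂.kept (8 * l + 5) (by unfold Kept; omega)]
      simp (disch := omega) only [execs, exec, Function.update_of_ne, and_self]
  | seq c₁ c₂ ih₁ ih₂ =>
    obtain ⟨d₁, h₁⟩ := ih₁ ld cf hs hfit hP.left hcf hr hc.1
    obtain ⟨d₂, h₂⟩ := ih₂ ld d₁ (c₁.bounded_eval hfit.1 hs hc.1)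
      (by unfold Fits at *; rwa [eval_inp])
      (by have := hP.right; rwa [length_code, ← h₁.pc] at this) h₁.reach.bounded h₁.rep hc.2
    refine ⟨d₂, h₁.reach.trans h₂.reach, ?_, h₂.rep, fun l hl => ?_⟩
    · rw [h₂.pc, h₁.pc, size]; omega
    · rw [(h₂.kept l hl).1, (h₂.kept l hl).2]; exact h₁.kept l hl
  | ite e c₁ c₂ ih₁ ih₂ =>
    obtain ⟨d, h⟩ := Ex.evaluated hs hfit e 0 cf hP.left hcf hr hc.1
    have hP₁ := hP.right
    rw [Ex.length_code] at hP₁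
    have hp := h.pos
    norm_num at hp
    have hj := reach_jump (m := m) (r := 2) (l := cf.pc + e.size + c₁.size + 2)
      (by rw [h.pc]; exact hP₁.head) h.reach.bounded
    have hr₁ := h.rep hr
    by_cases hpos : 0 < e.eval s
    · have h2 : d.reg 2 ≠ 0 := by omega
      rw [if_neg h2, h.pc] at hj
      have hrd : Rep s ⟨cf.pc + e.size + 1, d.reg, d.mem⟩ :=
        hr₁.of_kept (d := 0) (fun _ _ => rfl) rfl
      obtain ⟨d', h'⟩ := ih₁ ld ⟨cf.pc + e.size + 1, d.reg, d.mem⟩ hs hfit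
        hP₁.tail.left h.reach.bounded hrd (by have := hc.2; rwa [if_pos hpos] at this)
      have hP₂ := hP₁.tail.right
      rw [length_code] at hP₂
      -- Register 14 is always zero, so this jump over the second branch is unconditional.
      have hj' := reach_jump (m := m) (r := 14) (l := cf.pc + e.size + c₁.size + c₂.size + 2)
        (by rw [h'.pc]; exact hP₂.head) h'.reach.bounded
      rw [if_pos h'.rep.zero] at hj'
      refine ⟨⟨cf.pc + e.size + c₁.size + c₂.size + 2, d'.reg, d'.mem⟩, ?_, ?_, ?_, fun l hl => ?_⟩
      · have := ((h.reach.trans hj).trans h'.reach).trans hj'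
        rw [cost, if_pos hpos, ← Nat.add_assoc]
        exact this
      · simp only [size]; omega
      · rw [eval, if_pos hpos]
        exact h'.rep.of_kept (d := 0) (fun _ _ => rfl) rfl
      · rw [← h.kept (8 * l + 4) (by unfold Kept; omega),
          ← h.kept (8 * l + 5) (by unfold Kept; omega)]
        exact h'.kept l hl
    · have h2 : d.reg 2 = 0 := by omega
      rw [if_pos h2] at hj
      have hrd : Rep s ⟨cf.pc + e.size + c₁.size + 2, d.reg, d.mem⟩ :=
        hr₁.of_kept (d := 0) (fun _ _ => rfl) rfl
      obtain ⟨d', h'⟩ := ih₂ ld ⟨cf.pc + e.size + c₁.size + 2, d.reg, d.mem⟩ hs hfit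
        (by
          have := hP₁.tail.right.tail
          rw [length_code] at this
          rwa [show cf.pc + e.size + 1 + c₁.size + 1 = cf.pc + e.size + c₁.size + 2 by omega]
            at this) h.reach.bounded hrd (by have := hc.2; rwa [if_neg hpos] at this)
      refine ⟨d', ?_, ?_, ?_, fun l hl => ?_⟩
      · have := (h.reach.trans hj).trans h'.reach
        rw [cost, if_neg hpos]
        exact this
      · rw [h'.pc, size]; simp only; omega
      · rw [eval, if_neg hpos]
        exact h'.rep
      · rw [← h.kept (8 * l + 4) (by unfold Kept; omega),
          ← h.kept (8 * l + 5) (by unfold Kept; omega)]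
        exact h'.kept l hl
  | loop v e c ih =>
    obtain ⟨d₀, h₀⟩ := Ex.evaluated hs hfit e 0 cf hP.left hcf hr hc.1
    have hr₀ := h₀.rep hr
    have hP₁ := hP.right
    rw [Ex.length_code] at hP₁
    have hp := h₀.pos
    norm_num at hp
    set n := (e.eval s).toNat with hn
    have hnB := toNat_le_of_abs_le (Ex.abs_eval_le hs hc.1 hfit.1) le_rfl
    have hfit' := hfit.2
    have hinit : CodeAt P d₀.pc [.add (8 * ld + 5) 2 14, .const (8 * ld + 4) 0] := by
      rw [h₀.pc]
      intro i x hx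
      rcases i with _ | _ | i
      · exact hP₁ 0 x hx
      · exact hP₁ 1 x hx
      · simp at hx
    obtain ⟨hi₁, hi₂⟩ := Reach.execs _ hinit h₀.reach.bounded (m := m) (by
      simp (disch := omega) only [ValuesOk, ValueOk, and_true, Nat.zero_le, hr₀.zero]
      exact (h₀.reach.bounded _).1)
    have hP₂ : CodeAt P (cf.pc + e.size + 2) _ := hP₁.tail.tail
    -- The situation at the loop head after `j` rounds. Counter and bound have registers of their
    -- own, so the body may change `v` and the variables of `e` without affecting the number of
    -- rounds.
    have key : ∀ j ≤ n, ∃ d, Reach P m cf (e.size + 2 + ∑ i ∈ Finset.range j,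
        (c.cost ((iter c.eval v i s).setVar v i) + 7)) d ∧ d.pc = cf.pc + e.size + 2 ∧
        Rep (iter c.eval v j s) d ∧ d.reg (8 * ld + 4) = j ∧ d.reg (8 * ld + 5) = n ∧
        ∀ l < ld, d.reg (8 * l + 4) = cf.reg (8 * l + 4) ∧
          d.reg (8 * l + 5) = cf.reg (8 * l + 5) := by
      intro j
      induction j with
      | zero =>
        intro _
        refine ⟨_, h₀.reach.trans hi₁, ?_, ?_, ?_, ?_, fun l hl => ?_⟩
        · rw [hi₂, h₀.pc]; rfl
        · constructor
          · intro w
            simp (disch := omega) only [execs, exec, Function.update_of_ne]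
            exact hr₀.pos w
          · intro w
            simp (disch := omega) only [execs, exec, Function.update_of_ne]
            exact hr₀.neg w
          · simp (disch := omega) only [execs, exec, Function.update_of_ne]
            exact hr₀.base
          · simp (disch := omega) only [execs, exec, Function.update_of_ne]
            exact hr₀.zero
          · exact hr₀.arrPos
          · exact hr₀.arrNeg
          · exact hr₀.inp
        · simp (disch := omega) only [execs, exec, Function.update_self]
        · simp (disch := omega) only [execs, exec, Function.update_of_ne, Function.update_self,
            hr₀.zero, hp, add_zero]
        · rw [← h₀.kept (8 * l + 4) (by unfold Kept; omega),
            ← h₀.kept (8 * l + 5) (by unfold Kept; omega)]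
          simp (disch := omega) only [execs, exec, Function.update_of_ne, and_self]
      | succ j ihj =>
        intro hj
        obtain ⟨d, hd₁, hd₂, hd₃, hd₄, hd₅, hd₆⟩ := ihj (by omega)
        have hP₃ := hP₂.left
        have hq : ∀ i x, [Instr.sub 22 (8 * ld + 5) (8 * ld + 4),
            .jumpZero 22 (cf.pc + e.size + c.size + 9),
            .add (8 * v) (8 * ld + 4) 14, .const (8 * v + 1) 0][i]? = some x →
            P[cf.pc + e.size + 2 + i]? = some x := hP₃
        have hb := hd₁.bounded
        have s₁ := Reach.single (i := .sub 22 (8 * ld + 5) (8 * ld + 4))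
          (by rw [hd₂]; exact hq 0 _ rfl) hb (hb.exec (i := .sub 22 _ _) trivial)
        set d₁ := exec (.sub 22 (8 * ld + 5) (8 * ld + 4)) d with hd₁'
        have s₂ := reach_jump (r := 22) (l := cf.pc + e.size + c.size + 9) (cf := d₁)
          (by rw [show d₁.pc = _ from congrArg (· + 1) hd₂]; exact hq 1 _ rfl) s₁.bounded
        rw [if_neg (by
          simp (disch := omega) only [hd₁', exec, Function.update_self, hd₄, hd₅]; omega),
          show d₁.pc = _ from congrArg (· + 1) hd₂] at s₂
        obtain ⟨s₃, s₄⟩ := Reach.execs [.add (8 * v) (8 * ld + 4) 14, .const (8 * v + 1) 0]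
          (P := P) (m := m) (c := ⟨cf.pc + e.size + 2 + 1 + 1, d₁.reg, d₁.mem⟩)
          (fun i x hx => by
            have := hq (i + 2) x hx
            rwa [show cf.pc + e.size + 2 + (i + 2) = cf.pc + e.size + 2 + 1 + 1 + i by omega]
              at this) s₂.bounded
          (by
            simp (disch := omega) only [ValuesOk, ValueOk, and_true, Nat.zero_le, hd₁', exec,
              Function.update_of_ne, hd₃.zero]
            exact (hb _).1)
        set d₂ := execs [.add (8 * v) (8 * ld + 4) 14, .const (8 * v + 1) 0]
          ⟨cf.pc + e.size + 2 + 1 + 1, d₁.reg, d₁.mem⟩ with hd₂'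
        have hd₂pc : d₂.pc = cf.pc + e.size + 6 := s₄
        have hrep : Rep ((iter c.eval v j s).setVar v j) d₂ := by
          refine hd₃.setVar ?_ ?_ (fun r _ _ hr => ?_) rfl
          · simp (disch := omega) only [hd₂', hd₁', execs, exec, Function.update_of_ne,
              Function.update_self, hd₄, hd₃.zero, add_zero, Int.toNat_natCast]
          · simp (disch := omega) only [hd₂', hd₁', execs, exec, Function.update_self,
              Int.toNat_neg_natCast]
          · simp (disch := omega) only [hd₂', hd₁', execs, exec, Function.update_of_ne]
        have hinp : ((iter c.eval v j s).setVar v j).inp = s.inp :=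
          iter_inp c.eval_inp v j s
        obtain ⟨d₃, h₃⟩ := ih (ld + 1) d₂
          ((iter_bounded hfit.1 hs hc j (by omega)).setVar v
            (abs_natCast_le_of_lt_toNat (Ex.abs_eval_le hs hc.1 hfit.1) hj))
          (by unfold Fits at *; rwa [hinp])
          (by
            rw [hd₂pc]
            exact hP₂.right.left) s₃.bounded hrep (hc.2 j hj)
        have hP₄ := hP₂.right.right
        rw [length_code] at hP₄
        have hq' : ∀ i x, [Instr.const 22 1, .add (8 * ld + 4) (8 * ld + 4) 22,
            .jumpZero 14 (cf.pc + e.size + 2)][i]? = some x → P[d₃.pc + i]? = some x := by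
          rw [h₃.pc, hd₂pc]; exact hP₄
        -- The body is compiled for nesting depth `ld + 1`, so it preserves counter and bound at
        -- depth `ld`.
        have k₁ := (h₃.kept ld (by omega)).1
        have k₂ := (h₃.kept ld (by omega)).2
        have k₃ : d₂.reg (8 * ld + 4) = j := by
          simp (disch := omega) only [hd₂', hd₁', execs, exec, Function.update_of_ne, hd₄]
        have k₄ : d₂.reg (8 * ld + 5) = n := by
          simp (disch := omega) only [hd₂', hd₁', execs, exec, Function.update_of_ne, hd₅]
        obtain ⟨s₅, s₆⟩ := Reach.execs [.const 22 1, .add (8 * ld + 4) (8 * ld + 4) 22]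
          (P := P) (m := m) (c := d₃)
          (fun i x hx => hq' i x (by
            rcases i with _ | _ | i
            · exact hx
            · exact hx
            · simp at hx)) h₃.reach.bounded
          (by
            simp (disch := omega) only [ValuesOk, ValueOk, and_true, exec,
              Function.update_of_ne, Function.update_self, k₁, k₃]
            omega)
        set d₄ := execs [.const 22 1, .add (8 * ld + 4) (8 * ld + 4) 22] d₃ with hd₄'
        have s₇ := reach_jump (r := 14) (l := cf.pc + e.size + 2) (cf := d₄)
          (by rw [s₆]; exact hq' 2 _ rfl) s₅.bounded
        rw [if_pos (by
          simp (disch := omega) only [hd₄', execs, exec, Function.update_of_ne, h₃.rep.zero])] at s₇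
        refine ⟨⟨cf.pc + e.size + 2, d₄.reg, d₄.mem⟩, ?_, rfl, ?_, ?_, ?_, fun l hl => ?_⟩
        · have := ((((hd₁.trans s₁).trans s₂).trans s₃).trans h₃.reach).trans (s₅.trans s₇)
          convert this using 1
          rw [Finset.sum_range_succ]
          simp only [List.length_cons, List.length_nil]
          omega
        · constructor
          · intro w
            simp (disch := omega) only [hd₄', execs, exec, Function.update_of_ne]
            exact h₃.rep.pos w
          · intro w
            simp (disch := omega) only [hd₄', execs, exec, Function.update_of_ne]
            exact h₃.rep.neg w
          · simp (disch := omega) only [hd₄', execs, exec, Function.update_of_ne]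
            exact h₃.rep.base
          · simp (disch := omega) only [hd₄', execs, exec, Function.update_of_ne]
            exact h₃.rep.zero
          · exact h₃.rep.arrPos
          · exact h₃.rep.arrNeg
          · exact h₃.rep.inp
        · simp (disch := omega) only [hd₄', execs, exec, Function.update_of_ne,
            Function.update_self, k₁, k₃]
        · simp (disch := omega) only [hd₄', execs, exec, Function.update_of_ne, k₂, k₄]
        · rw [← (hd₆ l hl).1, ← (hd₆ l hl).2]
          simp (disch := omega) only [hd₄', execs, exec, Function.update_of_ne]
          rw [(h₃.kept l (by omega)).1, (h₃.kept l (by omega)).2]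
          simp (disch := omega) only [hd₂', hd₁', execs, exec, Function.update_of_ne, and_self]
    obtain ⟨d, hd₁, hd₂, hd₃, hd₄, hd₅, hd₆⟩ := key n le_rfl
    have hb := hd₁.bounded
    have hP₃ := hP₂.left
    have s₁ := Reach.single (i := .sub 22 (8 * ld + 5) (8 * ld + 4))
      (by rw [hd₂]; exact hP₃ 0 _ rfl) hb (hb.exec (i := .sub 22 _ _) trivial)
    set d₁ := exec (.sub 22 (8 * ld + 5) (8 * ld + 4)) d with hd₁'
    have s₂ := reach_jump (r := 22) (l := cf.pc + e.size + c.size + 9) (cf := d₁)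
      (by rw [show d₁.pc = _ from congrArg (· + 1) hd₂]; exact hP₃ 1 _ rfl) s₁.bounded
    rw [if_pos (by
      simp (disch := omega) only [hd₁', exec, Function.update_self, hd₄, hd₅, Nat.sub_self])] at s₂
    refine ⟨⟨cf.pc + e.size + c.size + 9, d₁.reg, d₁.mem⟩, ?_, ?_, ?_, fun l hl => ?_⟩
    · exact (hd₁.trans s₁).trans s₂
    · simp only [size]; omega
    · constructor
      · intro w
        simp (disch := omega) only [hd₁', exec, Function.update_of_ne]
        exact hd₃.pos w
      · intro w
        simp (disch := omega) only [hd₁', exec, Function.update_of_ne]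
        exact hd₃.neg w
      · simp (disch := omega) only [hd₁', exec, Function.update_of_ne]
        exact hd₃.base
      · simp (disch := omega) only [hd₁', exec, Function.update_of_ne]
        exact hd₃.zero
      · exact hd₃.arrPos
      · exact hd₃.arrNeg
      · exact hd₃.inp
    · rw [← (hd₆ l hl).1, ← (hd₆ l hl).2]
      simp (disch := omega) only [hd₁', exec, Function.update_of_ne, and_self]

end IntProg

namespace IntProg

open RAM

/-! ### Complete programs -/

/-- The input as a list of letter codes. -/
def letterCodes (w : FreeGroup EqLetter) : List ℕ := w.toWord.map letterCode

/-- The initial state on input `w`. -/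
def initSt (w : FreeGroup EqLetter) : St :=
  ⟨Function.update (fun _ => 0) 0 (w.norm : ℤ), fun _ _ => 0, letterCodes w⟩

theorem length_letterCodes (w : FreeGroup EqLetter) : (letterCodes w).length = w.norm := by
  simp [letterCodes, FreeGroup.norm]

/-- The machine program that executes `c`, and then halts if the variable `f` is positive, and
diverges otherwise. -/
def Cmd.program (c : Cmd) (f : ℕ) : Program :=
  .add 6 0 14 :: (c.code 1 0 ++ [.jumpZero (8 * f) (c.size + 1)])

theorem Cmd.length_program (c : Cmd) (f : ℕ) : (c.program f).length = c.size + 2 := by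
  simp [program, length_code]

theorem letterCode_le (p : EqLetter × Bool) : letterCode p ≤ 5 := by
  rcases p with ⟨_ | _ | _, _ | _⟩ <;> simp [letterCode]

theorem initSt_bounded {B : ℤ} {w : FreeGroup EqLetter} (h : (w.norm : ℤ) ≤ B) (h5 : 5 ≤ B) :
    (initSt w).Bounded B := by
  refine ⟨fun v => ?_, fun j i => ?_, fun x hx => ?_⟩
  · simp only [initSt, Function.update_apply]
    split_ifs
    · rwa [Nat.abs_cast]
    · simp; omega
  · simp [initSt]; omega
  · simp only [initSt, letterCodes, List.mem_map] at hx
    obtain ⟨p, _, rfl⟩ := hx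
    have := letterCode_le p
    omega

theorem Cmd.reach_program {c : Cmd} {f m : ℕ} {B : ℤ} {w : FreeGroup EqLetter}
    (hB : (w.norm : ℤ) ≤ B) (h5 : 5 ≤ B) (hm : 32 * B.toNat + w.norm + 64 ≤ m)
    (hc : c.Safe B (initSt w)) :
    ∃ cf, Reach (c.program f) m (init w) (1 + c.cost (initSt w)) cf ∧ cf.pc = c.size + 1 ∧
      Rep (c.eval (initSt w)) cf := by
  have hb : (init w).Bounded m := by
    intro i
    constructor
    · simp only [init, Function.update_apply]
      split_ifs <;> omega
    · simp only [init, List.getD_eq_getElem?_getD]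
      rcases h : (w.toWord.map letterCode)[i]? with _ | x
      · simp
      · have := List.mem_of_getElem? h
        simp only [List.mem_map] at this
        obtain ⟨p, _, rfl⟩ := this
        have := letterCode_le p
        simp only [Option.getD_some]
        omega
  have h14 : (init w).reg 14 = 0 := by simp [init]
  have h0 : (init w).reg 0 = w.norm := by simp [init]
  have hv : ValueOk m (init w) (.add 6 0 14) := by
    simp only [ValueOk, h14, h0]
    omega
  have r₁ := Reach.single (P := c.program f) (i := .add 6 0 14) rfl hb (hb.exec hv)
  set c₁ := exec (.add 6 0 14) (init w) with hc₁
  have hlen := length_letterCodes w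
  have hrep : Rep (initSt w) c₁ := by
    constructor
    · intro v
      rw [hc₁]
      simp only [exec, initSt]
      rw [Function.update_of_ne (by omega)]
      simp only [init, Function.update_apply]
      by_cases hv : v = 0
      · simp [hv]
      · rw [if_neg (by omega), if_neg hv]; rfl
    · intro v
      rw [hc₁]
      simp only [exec, initSt]
      rw [Function.update_of_ne (by omega)]
      simp only [init, Function.update_apply]
      by_cases hv : v = 0
      · simp [hv]
      · rw [if_neg (by omega), if_neg hv]; rfl
    · simp only [hc₁, exec, Function.update_self, h14, h0, initSt, hlen, add_zero]
    · simp only [hc₁, exec]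
      rw [Function.update_of_ne (by omega), h14]
    · intro j i
      simp only [hc₁, exec, init, initSt]
      rw [List.getD_eq_default _ _ (by simp only [letterCodes]; omega)]
      rfl
    · intro j i
      simp only [hc₁, exec, init, initSt]
      rw [List.getD_eq_default _ _ (by simp only [letterCodes]; omega)]
      rfl
    · intro i _
      rfl
  have hP : CodeAt (c.program f) c₁.pc (c.code c₁.pc 0) := by
    have h0 : CodeAt (c.program f) 0 (c.program f) := fun i x hx => by rwa [Nat.zero_add]
    exact h0.tail.left
  obtain ⟨cf, h⟩ := c.executed 0 c₁ (initSt_bounded hB h5)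
    ⟨by omega, by simp only [initSt, hlen]; exact hm⟩ hP r₁.bounded hrep hc
  refine ⟨cf, r₁.trans h.reach, ?_, h.rep⟩
  rw [h.pc, show c₁.pc = 1 from rfl]
  omega

theorem iterate_step_halted {P : Program} {c : Config} (h : P.length ≤ c.pc) (k : ℕ) :
    (step P)^[k] c = c := by
  have : step P c = c := by simp [step, List.getElem?_eq_none h]
  exact Function.iterate_fixed this k

/-- A program that decides `D` correctly whenever the variable `f` is positive in the end yields a
partial decision algorithm. -/
theorem Cmd.partiallyDecides {c : Cmd} {f d : ℕ} {D : Set (FreeGroup EqLetter)}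
    {B : ℕ → ℤ} {T : ℕ → ℕ} (G : Set (FreeGroup EqLetter))
    (hB : ∀ n : ℕ, (n : ℤ) ≤ B n) (h5 : ∀ n, 5 ≤ B n)
    (hd : ∀ n : ℕ, 32 * (B n).toNat + n + 64 ≤ (n + 2) ^ d)
    (hsafe : ∀ w, c.Safe (B w.norm) (initSt w))
    (hcost : ∀ w, c.cost (initSt w) + 2 ≤ T w.norm)
    (hflag : ∀ w, 0 < (c.eval (initSt w)).var f ↔ w ∈ G)
    (hans : ∀ w ∈ G, 0 < (c.eval (initSt w)).var 0 ↔ w ∈ D) :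
    PartiallyDecides (c.program f) D ∧ ∀ w ∈ G, RunsWithin (c.program f) d w (T w.norm) := by
  have hfin : ∀ cf : Config, cf.pc = c.size + 1 →
      (c.program f)[cf.pc]? = some (.jumpZero (8 * f) (c.size + 1)) := by
    intro cf hcf
    rw [hcf, program, List.getElem?_cons_succ, List.getElem?_append_right (by simp [length_code]),
      length_code]
    simp
  have hhalt : ∀ w ∈ G, ∃ cf k, k ≤ T w.norm ∧ Reach (c.program f) ((w.norm + 2) ^ d) (init w) k cf ∧
      (c.program f).length ≤ cf.pc ∧ (cf.reg 0 ≠ 0 ↔ w ∈ D) := by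
    intro w hw
    obtain ⟨cf, h₁, h₂, h₃⟩ := c.reach_program (f := f) (hB w.norm) (h5 w.norm) (hd w.norm)
      (hsafe w)
    have hj := reach_jump (hfin cf h₂) h₁.bounded
    have hpos := (hflag w).2 hw
    rw [if_neg (by rw [h₃.pos]; omega)] at hj
    refine ⟨_, _, ?_, h₁.trans hj, ?_, ?_⟩
    · have := hcost w
      omega
    · rw [length_program, h₂]
    · rw [← hans w hw]
      have := h₃.pos 0
      rw [Nat.mul_zero] at this
      simp only [this]
      omega
  have hiter : ∀ w j k, run (c.program f) w (j + k) =
      (step (c.program f))^[j] (run (c.program f) w k) := fun w j k =>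
    Function.iterate_add_apply _ _ _ _
  refine ⟨fun w k hk => ?_, fun w hw => ?_⟩
  · by_cases hw : w ∈ G
    · obtain ⟨cf, l, -, h₁, h₂, h₃⟩ := hhalt w hw
      -- A halted configuration no longer changes, so any two halting times show the same final
      -- configuration.
      have e₁ : run (c.program f) w (l + k) = run (c.program f) w k := by
        rw [hiter, iterate_step_halted hk]
      have e₂ : run (c.program f) w (k + l) = cf := by
        rw [hiter, show run (c.program f) w l = cf from h₁.1, iterate_step_halted h₂]
      rw [Nat.add_comm, e₂] at e₁
      rw [← e₁, h₃]
    · exfalso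
      obtain ⟨cf, h₁, h₂, h₃⟩ := c.reach_program (f := f) (hB w.norm) (h5 w.norm) (hd w.norm)
        (hsafe w)
      have hj := reach_jump (hfin cf h₂) h₁.bounded
      have hnpos : ¬0 < (c.eval (initSt w)).var f := fun h => hw ((hflag w).1 h)
      rw [if_pos (by rw [h₃.pos]; omega), ← h₂] at hj
      -- With the flag at zero the final jump leads to itself. The configuration is a fixed point
      -- whose instruction number is inside the program, so the machine never halts.
      have hfix : step (c.program f) cf = cf := hj.1
      have e₁ : run (c.program f) w (k + (1 + c.cost (initSt w))) = cf := by
        rw [hiter, show run (c.program f) w (1 + c.cost (initSt w)) = cf from h₁.1,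
          Function.iterate_fixed hfix]
      have e₂ : run (c.program f) w ((1 + c.cost (initSt w)) + k) = run (c.program f) w k := by
        rw [hiter, iterate_step_halted hk]
      rw [Nat.add_comm, e₁] at e₂
      have : (c.program f).length ≤ cf.pc := by rw [e₂]; exact hk
      rw [length_program, h₂] at this
      omega
  · obtain ⟨cf, l, hl, h₁, h₂, -⟩ := hhalt w hw
    have key : ∀ j, l ≤ j → run (c.program f) w j = cf := by
      intro j hj
      obtain ⟨i, rfl⟩ : ∃ i, j = i + l := ⟨j - l, by omega⟩
      rw [hiter, show run (c.program f) w l = cf from h₁.1, iterate_step_halted h₂]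
    refine ⟨?_, fun j _ => ?_⟩
    · rw [HaltsBy, key _ hl]; exact h₂
    · rcases le_total j l with hjl | hjl
      · exact h₁.2 j hjl
      · rw [key j hjl]; exact h₁.bounded

/-! ### Reasoning about programs -/

/-- Started in `s`, the program `c` is safe, needs at most `T` steps, and ends in a state that
satisfies `Q`. -/
structure Tri (B : ℤ) (c : Cmd) (s : St) (T : ℕ) (Q : St → Prop) : Prop where
  safe : c.Safe B s
  cost : c.cost s ≤ T
  post : Q (c.eval s)

theorem Tri.mono {B : ℤ} {c : Cmd} {s : St} {T T' : ℕ} {Q Q' : St → Prop} (h : Tri B c s T Q)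
    (hT : T ≤ T') (hQ : ∀ s', Q s' → Q' s') : Tri B c s T' Q' :=
  ⟨h.safe, h.cost.trans hT, hQ _ h.post⟩

theorem Tri.assign {B : ℤ} {v : ℕ} {e : Ex} {s : St} {Q : St → Prop} (he : e.Safe B s)
    (hQ : Q (s.setVar v (e.eval s))) : Tri B (.assign v e) s (e.size + 2) Q :=
  ⟨he, le_rfl, hQ⟩

theorem Tri.seq {B : ℤ} {c₁ c₂ : Cmd} {s : St} {T₁ T₂ : ℕ} {Q R : St → Prop}
    (h₁ : Tri B c₁ s T₁ Q) (h₂ : ∀ s', Q s' → Tri B c₂ s' T₂ R) :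
    Tri B (.seq c₁ c₂) s (T₁ + T₂) R :=
  have h := h₂ _ h₁.post
  ⟨⟨h₁.safe, h.safe⟩, Nat.add_le_add h₁.cost h.cost, h.post⟩

theorem Tri.ite {B : ℤ} {e : Ex} {c₁ c₂ : Cmd} {s : St} {T : ℕ} {Q : St → Prop}
    (he : e.Safe B s) (h₁ : 0 < e.eval s → Tri B c₁ s T Q) (h₂ : e.eval s ≤ 0 → Tri B c₂ s T Q) :
    Tri B (.ite e c₁ c₂) s (e.size + T + 2) Q := by
  rcases lt_or_ge 0 (e.eval s) with h | h
  · obtain ⟨a, b, c⟩ := h₁ h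
    exact ⟨⟨he, by rwa [if_pos h]⟩, by rw [Cmd.cost, if_pos h]; omega, by rwa [Cmd.eval, if_pos h]⟩
  · obtain ⟨a, b, c⟩ := h₂ h
    exact ⟨⟨he, by rwa [if_neg (by omega)]⟩, by rw [Cmd.cost, if_neg (by omega)]; omega,
      by rwa [Cmd.eval, if_neg (by omega)]⟩

theorem Tri.loop {B : ℤ} {v : ℕ} {e : Ex} {c : Cmd} {s : St} {T n : ℕ} (Inv : ℕ → St → Prop)
    (he : e.Safe B s) (hn : e.eval s = n) (h₀ : Inv 0 s)
    (h : ∀ j < n, ∀ s', Inv j s' → Tri B c (s'.setVar v j) T (Inv (j + 1))) :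
    Tri B (.loop v e c) s (n * (T + 7) + e.size + 4) (Inv n) := by
  have hn' : (e.eval s).toNat = n := by omega
  have key : ∀ j ≤ n, Inv j (iter c.eval v j s) := by
    intro j
    induction j with
    | zero => exact fun _ => h₀
    | succ j ih => exact fun hj => (h j hj _ (ih (by omega))).post
  refine ⟨⟨he, fun j hj => ?_⟩, ?_, ?_⟩
  · rw [hn'] at hj
    exact (h j hj _ (key j hj.le)).safe
  · have : ∑ j ∈ Finset.range n, (c.cost ((iter c.eval v j s).setVar v j) + 7) ≤ n * (T + 7) := by
      refine (Finset.sum_le_card_nsmul _ _ (T + 7) fun j hj => ?_).trans (by simp)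
      have hj := Finset.mem_range.1 hj
      have := (h j hj _ (key j hj.le)).cost
      omega
    rw [Cmd.cost, hn']
    omega
  · rw [Cmd.eval, hn']
    exact key n le_rfl

/-- The program does not assign to the variable `w`. -/
def Cmd.keepsVar (w : ℕ) : Cmd → Bool
  | assign v _ => v != w
  | store _ _ _ => true
  | seq c₁ c₂ => c₁.keepsVar w && c₂.keepsVar w
  | ite _ c₁ c₂ => c₁.keepsVar w && c₂.keepsVar w
  | loop v _ c => v != w && c.keepsVar w

/-- The program does not store to the array `a`. -/
def Cmd.keepsArr (a : Fin 16) : Cmd → Bool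
  | assign _ _ => true
  | store j _ _ => j != a
  | seq c₁ c₂ => c₁.keepsArr a && c₂.keepsArr a
  | ite _ c₁ c₂ => c₁.keepsArr a && c₂.keepsArr a
  | loop _ _ c => c.keepsArr a

theorem Cmd.eval_var {c : Cmd} {w : ℕ} (h : c.keepsVar w = true) (s : St) :
    (c.eval s).var w = s.var w := by
  induction c generalizing s with
  | assign v e =>
    have : v ≠ w := by simpa [keepsVar] using h
    exact Function.update_of_ne this.symm _ _
  | store j e₁ e₂ => rfl
  | seq c₁ c₂ h₁ h₂ =>
    simp only [keepsVar, Bool.and_eq_true] at h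
    rw [eval, h₂ h.2, h₁ h.1]
  | ite e c₁ c₂ h₁ h₂ =>
    simp only [keepsVar, Bool.and_eq_true] at h
    rw [eval]
    split_ifs
    exacts [h₁ h.1 s, h₂ h.2 s]
  | loop v e c ih =>
    simp only [keepsVar, Bool.and_eq_true, bne_iff_ne] at h
    rw [eval]
    induction (Ex.eval s e).toNat with
    | zero => rfl
    | succ j hj =>
      rw [iter, ih h.2, ← hj]
      exact Function.update_of_ne h.1.symm _ _

theorem Cmd.eval_arr {c : Cmd} {a : Fin 16} (h : c.keepsArr a = true) (s : St) :
    (c.eval s).arr a = s.arr a := by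
  induction c generalizing s with
  | assign v e => rfl
  | store j e₁ e₂ =>
    have : j ≠ a := by simpa [keepsArr] using h
    exact Function.update_of_ne this.symm _ _
  | seq c₁ c₂ h₁ h₂ =>
    simp only [keepsArr, Bool.and_eq_true] at h
    rw [eval, h₂ h.2, h₁ h.1]
  | ite e c₁ c₂ h₁ h₂ =>
    simp only [keepsArr, Bool.and_eq_true] at h
    rw [eval]
    split_ifs
    exacts [h₁ h.1 s, h₂ h.2 s]
  | loop v e c ih =>
    simp only [keepsArr] at h
    rw [eval]
    induction (Ex.eval s e).toNat with
    | zero => rfl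
    | succ j hj => rw [iter, ih h, ← hj]; rfl

/-- `s'` agrees with `s` on everything that `c` does not write to. -/
structure Frame (c : Cmd) (s s' : St) : Prop where
  var : ∀ w, c.keepsVar w = true → s'.var w = s.var w
  arr : ∀ a, c.keepsArr a = true → s'.arr a = s.arr a
  inp : s'.inp = s.inp

/-- What a program leaves alone is computed from its text by `keepsVar` and `keepsArr`, so that
later uses of the frame are settled by `rfl` and need not be part of any invariant. -/
theorem Tri.frame {B : ℤ} {c : Cmd} {s : St} {T : ℕ} {Q : St → Prop} (h : Tri B c s T Q) :
    Tri B c s T (fun s' => Q s' ∧ Frame c s s') :=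
  ⟨h.safe, h.cost, h.post, fun _ hw => Cmd.eval_var hw s, fun _ ha => Cmd.eval_arr ha s,
    c.eval_inp s⟩

/-- The loop rule, with the frame as part of the invariant. -/
theorem Tri.loop_frame {B : ℤ} {v : ℕ} {e : Ex} {c : Cmd} {s : St} {T n : ℕ}
    (Inv : ℕ → St → Prop) (he : e.Safe B s) (hn : e.eval s = n) (h₀ : Inv 0 s)
    (h : ∀ j < n, ∀ s', Inv j s' → Frame (.loop v e c) s s' →
      Tri B c (s'.setVar v j) T (Inv (j + 1))) :
    Tri B (.loop v e c) s (n * (T + 7) + e.size + 4)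
      (fun s' => Inv n s' ∧ Frame (.loop v e c) s s') := by
  refine Tri.loop (fun j s' => Inv j s' ∧ Frame (.loop v e c) s s') he hn
    ⟨h₀, fun _ _ => rfl, fun _ _ => rfl, rfl⟩ fun j hj s' hs' => ?_
  have ht := (h j hj s' hs'.1 hs'.2).frame
  refine ht.mono le_rfl fun s'' hs'' => ⟨hs''.1, fun w hw => ?_, fun a ha => ?_, ?_⟩
  · have hw' := hw
    simp only [Cmd.keepsVar, Bool.and_eq_true, bne_iff_ne] at hw'
    rw [hs''.2.var w hw'.2, ← hs'.2.var w hw]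
    exact Function.update_of_ne hw'.1.symm _ _
  · have ha' := ha
    simp only [Cmd.keepsArr] at ha'
    rw [hs''.2.arr a ha', ← hs'.2.arr a ha]
    rfl
  · rw [hs''.2.inp, ← hs'.2.inp]
    rfl

@[simp] theorem St.setVar_var (s : St) (v w : ℕ) (x : ℤ) :
    (s.setVar v x).var w = if w = v then x else s.var w := by
  simp [setVar, Function.update_apply]

@[simp] theorem St.setVar_arr (s : St) (v : ℕ) (x : ℤ) : (s.setVar v x).arr = s.arr := rfl

@[simp] theorem St.setVar_inp (s : St) (v : ℕ) (x : ℤ) : (s.setVar v x).inp = s.inp := rfl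

@[simp] theorem St.setArr_var (s : St) (j : Fin 16) (i : ℕ) (x : ℤ) :
    (s.setArr j i x).var = s.var := rfl

@[simp] theorem St.setArr_inp (s : St) (j : Fin 16) (i : ℕ) (x : ℤ) :
    (s.setArr j i x).inp = s.inp := rfl

@[simp] theorem St.setArr_arr (s : St) (j j' : Fin 16) (i i' : ℕ) (x : ℤ) :
    (s.setArr j i x).arr j' i' = if j' = j ∧ i' = i then x else s.arr j' i' := by
  simp only [setArr, Function.update_apply]
  by_cases h : j' = j
  · subst h; simp [Function.update_apply]
  · simp [h]

end IntProg

/-! ### The fast Fourier transform in fixed-point arithmetic -/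

namespace FixedFFT

/-- The binary digits of `n`, reversed and put behind the binary point. -/
noncomputable def rev : ℕ → ℝ
  | 0 => 0
  | n + 1 => rev ((n + 1) / 2) / 2 + (((n + 1) % 2 : ℕ) : ℝ) / 2

theorem rev_eq (n : ℕ) : rev n = rev (n / 2) / 2 + ((n % 2 : ℕ) : ℝ) / 2 := by
  cases n with
  | zero => simp [rev]
  | succ n => rw [rev]

/-- The `i`-th root of unity in bit-reversed order. -/
noncomputable def root (i : ℕ) : ℂ := Complex.exp ((2 * Real.pi * rev i : ℝ) * Complex.I)

/-- A square root of `root i`. -/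
noncomputable def split (i : ℕ) : ℂ := Complex.exp ((Real.pi * rev i : ℝ) * Complex.I)

/-- In the factorisation of `X ^ (2 * h) - root i` into `X ^ h - split i` and `X ^ h + split i`, the
new constants are the entries `2 * i` and `2 * i + 1` of the same bit-reversed list. Hence one table
serves all levels and all lengths of the transform. -/
theorem root_two_mul (i : ℕ) : root (2 * i) = split i := by
  rw [root, split, rev_eq, Nat.mul_div_cancel_left _ two_pos, Nat.mul_mod_right]
  congr 3
  push_cast
  ring

theorem root_two_mul_add_one (i : ℕ) : root (2 * i + 1) = -split i := by
  rw [root, split, rev_eq, show (2 * i + 1) / 2 = i by omega, show (2 * i + 1) % 2 = 1 by omega]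
  have : ((2 * Real.pi * (rev i / 2 + ((1 : ℕ) : ℝ) / 2) : ℝ) : ℂ) * Complex.I =
      (Real.pi * rev i : ℝ) * Complex.I + Real.pi * Complex.I := by push_cast; ring
  rw [this, Complex.exp_add, Complex.exp_pi_mul_I]
  ring

theorem split_sq (i : ℕ) : split i ^ 2 = root i := by
  rw [split, root, ← Complex.exp_nat_mul]
  congr 1
  push_cast
  ring

theorem norm_split (i : ℕ) : ‖split i‖ = 1 := Complex.norm_exp_ofReal_mul_I _

theorem split_mul_conj (i : ℕ) : split i * (starRingEnd ℂ) (split i) = 1 := by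
  rw [Complex.mul_conj, Complex.normSq_eq_norm_sq, norm_split]; norm_num

theorem split_zero : split 0 = 1 := by simp [split, rev]

/-- The leading digit of `2 ^ j + i` becomes the last one behind the binary point. -/
theorem rev_two_pow_add (j i : ℕ) (hi : i < 2 ^ j) : rev (2 ^ j + i) = rev i + 1 / 2 ^ (j + 1) := by
  induction j generalizing i with
  | zero =>
    obtain rfl : i = 0 := by simpa using hi
    rw [rev_eq]
    norm_num [rev]
  | succ j ih =>
    rw [rev_eq, show (2 ^ (j + 1) + i) / 2 = 2 ^ j + i / 2 by omega,
      show (2 ^ (j + 1) + i) % 2 = i % 2 by omega, ih _ (by omega), rev_eq i]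
    rw [pow_succ 2 (j + 1)]
    ring

/-- The second half of a table of `2 ^ (j + 1)` entries is the first half times a single constant.
This is how `doubleTable` builds the table. -/
theorem split_two_pow_add (j i : ℕ) (hi : i < 2 ^ j) :
    split (2 ^ j + i) = split i * Complex.exp ((Real.pi / 2 ^ (j + 1) : ℝ) * Complex.I) := by
  rw [split, split, rev_two_pow_add j i hi, ← Complex.exp_add]
  congr 1
  push_cast
  ring

/-! #### The exact transform -/

/-- The position in block `u / (2 h)` of the partner of `u` in the lower half. -/
def low (h u : ℕ) : ℕ := u - u % (2 * h) / h * h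

/-- Which half of its block `u` belongs to. -/
def half (h u : ℕ) : ℕ := u % (2 * h) / h

theorem div_low {h b t : ℕ} (ht : t < h) :
    (2 * h * b + t) / (2 * h) = b ∧ half h (2 * h * b + t) = 0 ∧
      low h (2 * h * b + t) = 2 * h * b + t := by
  have h₁ : (2 * h * b + t) % (2 * h) = t := by
    rw [Nat.mul_add_mod, Nat.mod_eq_of_lt (by omega)]
  refine ⟨?_, ?_, ?_⟩
  · rw [Nat.mul_add_div (by omega), Nat.div_eq_of_lt (by omega), add_zero]
  · rw [half, h₁, Nat.div_eq_of_lt ht]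
  · rw [low, h₁, Nat.div_eq_of_lt ht, Nat.zero_mul, Nat.sub_zero]

theorem div_high {h b t : ℕ} (ht : t < h) :
    (2 * h * b + h + t) / (2 * h) = b ∧ half h (2 * h * b + h + t) = 1 ∧
      low h (2 * h * b + h + t) = 2 * h * b + t := by
  have h₁ : (2 * h * b + h + t) % (2 * h) = h + t := by
    rw [add_assoc, Nat.mul_add_mod, Nat.mod_eq_of_lt (by omega)]
  have h₂ : (h + t) / h = 1 := by
    rw [Nat.add_div_left _ (by omega), Nat.div_eq_of_lt ht]
  refine ⟨?_, ?_, ?_⟩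
  · rw [add_assoc, Nat.mul_add_div (by omega), Nat.div_eq_of_lt (by omega), add_zero]
  · rw [half, h₁, h₂]
  · rw [low, h₁, h₂]; omega

theorem exists_position {h : ℕ} (hh : 0 < h) (u : ℕ) :
    ∃ b t, t < h ∧ (u = 2 * h * b + t ∨ u = 2 * h * b + h + t) := by
  have h₁ := Nat.div_add_mod u (2 * h)
  have h₂ := Nat.mod_lt u (show 0 < 2 * h by omega)
  by_cases hc : u % (2 * h) < h
  · exact ⟨u / (2 * h), u % (2 * h), hc, Or.inl h₁.symm⟩
  · exact ⟨u / (2 * h), u % (2 * h) - h, by omega, Or.inr (by omega)⟩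

/-- One level of the transform. -/
noncomputable def level (h : ℕ) (Z : ℕ → ℂ) (u : ℕ) : ℂ :=
  Z (low h u) + (1 - 2 * (half h u : ℂ)) * (Z (low h u + h) * split (u / (2 * h)))

/-- One level of the inverse transform. -/
noncomputable def ilevel (h : ℕ) (W : ℕ → ℂ) (u : ℕ) : ℂ :=
  (W (low h u) + (1 - 2 * (half h u : ℂ)) * W (low h u + h)) *
    ((1 - (half h u : ℂ)) + (half h u : ℂ) * (starRingEnd ℂ) (split (u / (2 * h))))

theorem level_low {h b t : ℕ} (ht : t < h) (Z : ℕ → ℂ) :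
    level h Z (2 * h * b + t) = Z (2 * h * b + t) + Z (2 * h * b + h + t) * split b := by
  obtain ⟨h₁, h₂, h₃⟩ := div_low (b := b) ht
  rw [level, h₁, h₂, h₃, show 2 * h * b + t + h = 2 * h * b + h + t by omega]
  simp

theorem level_high {h b t : ℕ} (ht : t < h) (Z : ℕ → ℂ) :
    level h Z (2 * h * b + h + t) = Z (2 * h * b + t) - Z (2 * h * b + h + t) * split b := by
  obtain ⟨h₁, h₂, h₃⟩ := div_high (b := b) ht
  rw [level, h₁, h₂, h₃, show 2 * h * b + t + h = 2 * h * b + h + t by omega]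
  push_cast
  ring

/-- The first `l` levels of the transform of length `2 ^ m`. -/
noncomputable def stage (m : ℕ) (Z : ℕ → ℂ) : ℕ → ℕ → ℂ
  | 0 => Z
  | l + 1 => level (2 ^ (m - l - 1)) (stage m Z l)

theorem sum_range_two_mul {R : Type*} [AddCommMonoid R] (f : ℕ → R) (n : ℕ) :
    ∑ i ∈ Finset.range (2 * n), f i = ∑ i ∈ Finset.range n, (f (2 * i) + f (2 * i + 1)) := by
  induction n with
  | zero => simp
  | succ n ih =>
    rw [show 2 * (n + 1) = 2 * n + 1 + 1 by ring, Finset.sum_range_succ, Finset.sum_range_succ, ih,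
      Finset.sum_range_succ, add_assoc]

/-- After `l` levels, block `b` contains the remainder of the polynomial `∑ Z i * X ^ i` modulo `X ^
2 ^ (m - l) - root b`. The next level reduces it modulo the two factors of this binomial. -/
theorem stage_eq (m : ℕ) (Z : ℕ → ℂ) (l : ℕ) (hl : l ≤ m) (b r : ℕ) (hb : b < 2 ^ l)
    (hr : r < 2 ^ (m - l)) :
    stage m Z l (2 ^ (m - l) * b + r) =
      ∑ i ∈ Finset.range (2 ^ l), Z (2 ^ (m - l) * i + r) * root b ^ i := by
  induction l generalizing b r with
  | zero =>
    obtain rfl : b = 0 := by simpa using hb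
    simp [stage]
  | succ l ih =>
    have hh : 2 ^ (m - l) = 2 * 2 ^ (m - (l + 1)) := by
      rw [← pow_succ', show m - (l + 1) + 1 = m - l by omega]
    have hm : m - l - 1 = m - (l + 1) := by omega
    set h := 2 ^ (m - (l + 1)) with hdef
    rw [stage, hm, ← hdef, pow_succ', sum_range_two_mul]
    have ih₁ := fun b' hb' => ih (by omega) b' r hb' (by omega)
    have ih₂ := fun b' hb' => ih (by omega) b' (h + r) hb' (by omega)
    simp only [hh, ← add_assoc] at ih₁ ih₂
    rcases Nat.even_or_odd' b with ⟨b', rfl | rfl⟩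
    · rw [show h * (2 * b') + r = 2 * h * b' + r by ring, level_low hr, ih₁ _ (by omega),
        ih₂ _ (by omega), Finset.sum_mul, ← Finset.sum_add_distrib]
      refine Finset.sum_congr rfl fun i _ => ?_
      rw [root_two_mul, ← split_sq, show h * (2 * i) + r = 2 * h * i + r by ring,
        show h * (2 * i + 1) + r = 2 * h * i + h + r by ring]
      ring
    · rw [show h * (2 * b' + 1) + r = 2 * h * b' + h + r by ring, level_high hr, ih₁ _ (by omega),
        ih₂ _ (by omega), Finset.sum_mul, ← Finset.sum_sub_distrib]
      refine Finset.sum_congr rfl fun i _ => ?_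
      rw [root_two_mul_add_one, ← split_sq, show h * (2 * i) + r = 2 * h * i + r by ring,
        show h * (2 * i + 1) + r = 2 * h * i + h + r by ring, (even_two_mul i).neg_pow,
        pow_succ (-split b'), (even_two_mul i).neg_pow]
      ring

theorem stage_last (m : ℕ) (Z : ℕ → ℂ) (u : ℕ) (hu : u < 2 ^ m) :
    stage m Z m u = ∑ i ∈ Finset.range (2 ^ m), Z i * root u ^ i := by
  simpa using stage_eq m Z m le_rfl u 0 hu (by simp)

/-- Sum and difference of the two outputs are twice the lower input and twice the upper input times
`split b`, whose inverse is its conjugate. The factors of two are left to accumulate to `2 ^ m`;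
they are divided out in the final rounding. -/
theorem ilevel_level {M h : ℕ} (hh : 0 < h) (hM : 2 * h ∣ M) {W Z : ℕ → ℂ} {c : ℂ}
    (hW : ∀ u < M, W u = c * level h Z u) {u : ℕ} (hu : u < M) : ilevel h W u = 2 * c * Z u := by
  obtain ⟨k, rfl⟩ := hM
  obtain ⟨b, t, ht, hut⟩ := exists_position hh u
  have hb : b < k := by
    have : 2 * h * b < 2 * h * k := by omega
    exact lt_of_mul_lt_mul_left this (Nat.zero_le _)
  have hbk : 2 * h * b + 2 * h ≤ 2 * h * k := by
    have : 2 * h * (b + 1) ≤ 2 * h * k := Nat.mul_le_mul_left _ hb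
    linarith
  have w₁ := hW (2 * h * b + t) (by omega)
  have w₂ := hW (2 * h * b + h + t) (by omega)
  rw [level_low ht] at w₁
  rw [level_high ht] at w₂
  have hs := split_mul_conj b
  rcases hut with rfl | rfl
  · obtain ⟨h₁, h₂, h₃⟩ := div_low (b := b) ht
    rw [ilevel, h₁, h₂, h₃, show 2 * h * b + t + h = 2 * h * b + h + t by omega, w₁, w₂]
    push_cast
    ring
  · obtain ⟨h₁, h₂, h₃⟩ := div_high (b := b) ht
    rw [ilevel, h₁, h₂, h₃, show 2 * h * b + t + h = 2 * h * b + h + t by omega, w₁, w₂]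
    push_cast
    linear_combination (2 * c * Z (2 * h * b + h + t)) * hs

/-- The first `l` levels of the inverse transform. -/
noncomputable def istage (W : ℕ → ℂ) : ℕ → ℕ → ℂ
  | 0 => W
  | l + 1 => ilevel (2 ^ l) (istage W l)

theorem istage_eq {m : ℕ} {W Z : ℕ → ℂ} (hW : ∀ u < 2 ^ m, W u = stage m Z m u) (l : ℕ)
    (hl : l ≤ m) (u : ℕ) (hu : u < 2 ^ m) : istage W l u = 2 ^ l * stage m Z (m - l) u := by
  induction l generalizing u with
  | zero => simpa [istage] using hW u hu
  | succ l ih =>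
    have key : ∀ u < 2 ^ m,
        istage W l u = 2 ^ l * level (2 ^ l) (stage m Z (m - (l + 1))) u := fun u hu => by
      rw [ih (by omega) u hu, show m - l = m - (l + 1) + 1 by omega, stage,
        show m - (m - (l + 1)) - 1 = l by omega]
    rw [istage, ilevel_level (by positivity) _ key hu]
    · ring
    · rw [← pow_succ']
      exact pow_dvd_pow 2 hl

open Polynomial in
/-- The transform, pointwise squaring and the inverse transform compute the square of a
polynomial. -/
theorem istage_sq {m : ℕ} (F : ℂ[X]) (hF : 2 * F.natDegree < 2 ^ m) (u : ℕ) (hu : u < 2 ^ m) :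
    istage (fun i => stage m F.coeff m i * stage m F.coeff m i) m u =
      2 ^ m * (F * F).coeff u := by
  -- The degree of the square is below the length of the transform, so nothing wraps around.
  have hd : (F * F).natDegree < 2 ^ m := by
    refine lt_of_le_of_lt natDegree_mul_le ?_
    omega
  have key : ∀ G : ℂ[X], G.natDegree < 2 ^ m → ∀ v < 2 ^ m,
      stage m G.coeff m v = G.eval (root v) := fun G hG v hv => by
    rw [stage_last m _ v hv, eval_eq_sum_range' hG]
  rw [istage_eq (Z := (F * F).coeff) (fun v hv => ?_) m le_rfl u hu, Nat.sub_self, stage]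
  rw [key _ hd v hv, key _ (by omega) v hv, eval_mul]

theorem half_le (h u : ℕ) : half h u ≤ 1 := by
  rcases Nat.eq_zero_or_pos h with rfl | hh
  · simp [half]
  · obtain ⟨b, t, ht, rfl | rfl⟩ := exists_position hh u
    · rw [(div_low ht).2.1]; omega
    · rw [(div_high ht).2.1]

theorem half_eq (h u : ℕ) : half h u = 0 ∨ half h u = 1 := by
  have := half_le h u
  omega

theorem low_lt {M h u : ℕ} (hh : 0 < h) (hM : 2 * h ∣ M) (hu : u < M) :
    low h u + h < M ∧ u / (2 * h) < M / (2 * h) := by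
  refine ⟨?_, Nat.div_lt_div_of_lt_of_dvd hM hu⟩
  obtain ⟨k, rfl⟩ := hM
  obtain ⟨b, t, ht, hut⟩ := exists_position hh u
  have hb : b < k := by
    have : 2 * h * b < 2 * h * k := by omega
    exact lt_of_mul_lt_mul_left this (Nat.zero_le _)
  have hbk : 2 * h * (b + 1) ≤ 2 * h * k := Nat.mul_le_mul_left _ hb
  rw [mul_add] at hbk
  rcases hut with rfl | rfl
  · rw [(div_low ht).2.2]; omega
  · rw [(div_high ht).2.2]; omega

/-- All multipliers lie on the unit circle, so a level at most doubles the maximum. The same holds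
for the inverse. -/
theorem norm_level_le {h : ℕ} {Z : ℕ → ℂ} {C : ℝ} (hZ : ∀ u, ‖Z u‖ ≤ C) (u : ℕ) :
    ‖level h Z u‖ ≤ 2 * C := by
  have h₁ : ‖(1 - 2 * (half h u : ℂ))‖ = 1 := by
    rcases half_eq h u with h | h <;> simp [h]
    norm_num
  refine (norm_add_le _ _).trans ?_
  rw [norm_mul, norm_mul, h₁, norm_split]
  have := hZ (low h u)
  have := hZ (low h u + h)
  linarith

theorem norm_ilevel_le {h : ℕ} {Z : ℕ → ℂ} {C : ℝ} (hZ : ∀ u, ‖Z u‖ ≤ C) (u : ℕ) :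
    ‖ilevel h Z u‖ ≤ 2 * C := by
  have h₁ : ‖(1 - 2 * (half h u : ℂ))‖ = 1 := by
    rcases half_eq h u with h | h <;> simp [h]
    norm_num
  have h₂ : ‖(1 - (half h u : ℂ)) + (half h u : ℂ) * (starRingEnd ℂ) (split (u / (2 * h)))‖ = 1 := by
    rcases half_eq h u with h | h <;> simp [h, norm_split]
  rw [ilevel, norm_mul, h₂, mul_one]
  refine (norm_add_le _ _).trans ?_
  rw [norm_mul, h₁]
  have := hZ (low h u)
  have := hZ (low h u + h)
  linarith

theorem norm_stage_le {m : ℕ} {Z : ℕ → ℂ} {C : ℝ} (hZ : ∀ u, ‖Z u‖ ≤ C) (l : ℕ) (u : ℕ) :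
    ‖stage m Z l u‖ ≤ 2 ^ l * C := by
  induction l generalizing u with
  | zero => simpa [stage] using hZ u
  | succ l ih => rw [pow_succ', mul_assoc]; exact norm_level_le ih u

theorem norm_istage_le {Z : ℕ → ℂ} {C : ℝ} (hZ : ∀ u, ‖Z u‖ ≤ C) (l : ℕ) (u : ℕ) :
    ‖istage Z l u‖ ≤ 2 ^ l * C := by
  induction l generalizing u with
  | zero => simpa [istage] using hZ u
  | succ l ih => rw [pow_succ', mul_assoc]; exact norm_ilevel_le ih u

/-! #### Rounding errors -/

/-- The Gaussian integer `a + b i`. -/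
def cx (a b : ℤ) : ℂ := ⟨a, b⟩

theorem cx_add (a b c d : ℤ) : cx a b + cx c d = cx (a + c) (b + d) := by
  apply Complex.ext <;> simp [cx]

theorem cx_mul (a b c d : ℤ) : cx a b * cx c d = cx (a * c - b * d) (a * d + b * c) := by
  apply Complex.ext <;> simp [cx]

theorem int_mul_cx (k a b : ℤ) : (k : ℂ) * cx a b = cx (k * a) (k * b) := by
  apply Complex.ext <;> simp [cx]

theorem abs_tdiv_sub_le (a : ℤ) {S : ℤ} (hS : 0 < S) :
    |((a.tdiv S : ℤ) : ℝ) - a / S| ≤ 1 := by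
  have hS' : (0 : ℝ) < S := by exact_mod_cast hS
  have h₁ : (a : ℝ) = S * (a.tdiv S : ℤ) + (a.tmod S : ℤ) := by
    exact_mod_cast (Int.mul_tdiv_add_tmod a S).symm
  have h₂ : |((a.tmod S : ℤ) : ℝ)| ≤ S := by
    have : |a.tmod S| < S := by
      have := Int.tmod_lt_of_pos a hS
      have := Int.lt_tmod_of_pos a hS
      rw [abs_lt]
      constructor <;> linarith
    exact_mod_cast this.le
  have h₃ : ((a.tdiv S : ℤ) : ℝ) - a / S = -((a.tmod S : ℤ) : ℝ) / S := by
    rw [h₁]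
    field_simp
    ring
  rw [h₃, abs_div, abs_neg, abs_of_pos hS', div_le_one hS']
  exact h₂

theorem norm_tdiv_sub_le (a b : ℤ) {S : ℤ} (hS : 0 < S) :
    ‖cx (a.tdiv S) (b.tdiv S) - cx a b / S‖ ≤ 2 := by
  refine (Complex.norm_le_abs_re_add_abs_im _).trans ?_
  have h₁ := abs_tdiv_sub_le a hS
  have h₂ := abs_tdiv_sub_le b hS
  have e : (S : ℂ) = ((S : ℝ) : ℂ) := by simp
  have hre : (cx (a.tdiv S) (b.tdiv S) - cx a b / S).re = ((a.tdiv S : ℤ) : ℝ) - a / S := by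
    rw [Complex.sub_re, e, Complex.div_ofReal_re]; rfl
  have him : (cx (a.tdiv S) (b.tdiv S) - cx a b / S).im = ((b.tdiv S : ℤ) : ℝ) - b / S := by
    rw [Complex.sub_im, e, Complex.div_ofReal_im]; rfl
  rw [hre, him]
  linarith

/-- The error of a fixed-point multiplication. -/
theorem norm_mul_tdiv_sub_le {a b c d S : ℤ} {z w : ℂ} {e η Z W : ℝ} (hS : 0 < S)
    (hx : ‖cx a b - S * z‖ ≤ e) (hy : ‖cx c d - S * w‖ ≤ η) (hz : ‖z‖ ≤ Z) (hw : ‖w‖ ≤ W)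
    (hη : η ≤ S) :
    ‖cx ((a * c - b * d).tdiv S) ((a * d + b * c).tdiv S) - S * (z * w)‖ ≤
      e * (W + 1) + Z * η + 2 := by
  have hS' : (0 : ℝ) < S := by exact_mod_cast hS
  have hS'' : (S : ℂ) ≠ 0 := by exact_mod_cast hS.ne'
  have h₁ := norm_tdiv_sub_le (a * c - b * d) (a * d + b * c) hS
  rw [← cx_mul] at h₁
  have hnS : ‖(S : ℂ)‖ = S := by rw [Complex.norm_intCast, abs_of_pos hS']
  have e0 : 0 ≤ e := (norm_nonneg _).trans hx
  have Z0 : 0 ≤ Z := (norm_nonneg _).trans hz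
  have h₂ : ‖cx c d‖ ≤ S * (W + 1) := by
    have : cx c d = (cx c d - S * w) + S * w := by ring
    rw [this]
    refine (norm_add_le _ _).trans ?_
    rw [norm_mul, hnS]
    nlinarith
  have h₃ : cx a b * cx c d / S - S * (z * w) =
      ((cx a b - S * z) * cx c d + S * z * (cx c d - S * w)) / S := by
    field_simp
    ring
  have h₄ : ‖cx a b * cx c d / S - S * (z * w)‖ ≤ e * (W + 1) + Z * η := by
    rw [h₃, norm_div, hnS, div_le_iff₀ hS']
    refine (norm_add_le _ _).trans ?_
    rw [norm_mul, norm_mul, norm_mul, hnS]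
    have i₁ : ‖cx a b - S * z‖ * ‖cx c d‖ ≤ e * (S * (W + 1)) :=
      mul_le_mul hx h₂ (norm_nonneg _) e0
    have i₂ : S * ‖z‖ * ‖cx c d - S * w‖ ≤ S * Z * η :=
      mul_le_mul (by gcongr) hy (norm_nonneg _) (by positivity)
    linarith
  have : cx ((a * c - b * d).tdiv S) ((a * d + b * c).tdiv S) - S * (z * w) =
    (cx ((a * c - b * d).tdiv S) ((a * d + b * c).tdiv S) - cx a b * cx c d / S) +
      (cx a b * cx c d / S - S * (z * w)) := by ring
  rw [this]
  refine (norm_add_le _ _).trans ?_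
  linarith

/-- The arrays `XR`, `XI` hold the complex numbers `Z u` for `u < M`, scaled by `S`, with an error
of at most `e`. -/
def Close (S : ℤ) (M : ℕ) (e : ℝ) (XR XI : ℕ → ℤ) (Z : ℕ → ℂ) : Prop :=
  ∀ u < M, ‖cx (XR u) (XI u) - S * Z u‖ ≤ e

/-- The product with an approximate root has error `2 * e + C * η + 2` by `norm_mul_tdiv_sub_le`, as
the exact root has absolute value one; the other summand adds `e`. -/
theorem Close.level {S : ℤ} {M h : ℕ} {e η C : ℝ} {XR XI TR TI YR YI : ℕ → ℤ} {Z : ℕ → ℂ}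
    (hS : 0 < S) (hh : 0 < h) (hM : 2 * h ∣ M) (hX : Close S M e XR XI Z)
    (hT : Close S (M / (2 * h)) η TR TI split) (hZ : ∀ u, ‖Z u‖ ≤ C) (hη : η ≤ S)
    (hY : ∀ u < M, YR u = XR (low h u) + (1 - 2 * (half h u : ℤ)) *
        (XR (low h u + h) * TR (u / (2 * h)) - XI (low h u + h) * TI (u / (2 * h))).tdiv S ∧
      YI u = XI (low h u) + (1 - 2 * (half h u : ℤ)) *
        (XR (low h u + h) * TI (u / (2 * h)) + XI (low h u + h) * TR (u / (2 * h))).tdiv S) :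
    Close S M (3 * e + C * η + 2) YR YI (level h Z) := by
  intro u hu
  obtain ⟨h₁, h₂⟩ := low_lt hh hM hu
  have hp := hX (low h u) (by omega)
  have hm := norm_mul_tdiv_sub_le hS (hX _ h₁) (hT _ h₂) (hZ _) (norm_split _).le hη
  rw [(hY u hu).1, (hY u hu).2, ← cx_add, ← int_mul_cx, FixedFFT.level]
  have h₁ : ‖(1 - 2 * (half h u : ℂ))‖ = 1 := by
    rcases half_eq h u with h | h <;> simp [h]
    norm_num
  set p := cx (XR (low h u)) (XI (low h u))
  set q := cx ((XR (low h u + h) * TR (u / (2 * h)) - XI (low h u + h) * TI (u / (2 * h))).tdiv S)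
    ((XR (low h u + h) * TI (u / (2 * h)) + XI (low h u + h) * TR (u / (2 * h))).tdiv S)
  have : p + ((1 - 2 * (half h u : ℤ) : ℤ) : ℂ) * q - S * (Z (low h u) +
      (1 - 2 * (half h u : ℂ)) * (Z (low h u + h) * split (u / (2 * h)))) =
      (p - S * Z (low h u)) +
        (1 - 2 * (half h u : ℂ)) * (q - S * (Z (low h u + h) * split (u / (2 * h)))) := by
    push_cast
    ring
  rw [this]
  refine (norm_add_le _ _).trans ?_
  rw [norm_mul, h₁]
  linarith

theorem cx_neg_conj (a b : ℤ) : cx a (-b) = (starRingEnd ℂ) (cx a b) := by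
  apply Complex.ext <;> simp [cx]

/-- Here the sum comes before the product: it has error `2 * e` and size `2 * C`. The multiplier is
the exact `S` in the lower half of a block and a conjugated table entry in the upper half. -/
theorem Close.ilevel {S : ℤ} {M h : ℕ} {e η C : ℝ} {XR XI TR TI YR YI : ℕ → ℤ} {Z : ℕ → ℂ}
    (hS : 0 < S) (hh : 0 < h) (hM : 2 * h ∣ M) (hX : Close S M e XR XI Z)
    (hT : Close S (M / (2 * h)) η TR TI split) (hZ : ∀ u, ‖Z u‖ ≤ C) (hη : η ≤ S) (hη0 : 0 ≤ η)
    (hY : ∀ u < M,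
      YR u = ((XR (low h u) + (1 - 2 * (half h u : ℤ)) * XR (low h u + h)) *
          ((1 - (half h u : ℤ)) * S + half h u * TR (u / (2 * h))) -
        (XI (low h u) + (1 - 2 * (half h u : ℤ)) * XI (low h u + h)) *
          -(half h u * TI (u / (2 * h)))).tdiv S ∧
      YI u = ((XR (low h u) + (1 - 2 * (half h u : ℤ)) * XR (low h u + h)) *
          -(half h u * TI (u / (2 * h))) +
        (XI (low h u) + (1 - 2 * (half h u : ℤ)) * XI (low h u + h)) *
          ((1 - (half h u : ℤ)) * S + half h u * TR (u / (2 * h)))).tdiv S) :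
    Close S M (4 * e + 2 * C * η + 2) YR YI (ilevel h Z) := by
  intro u hu
  obtain ⟨h₁, h₂⟩ := low_lt hh hM hu
  have hp := hX (low h u) (by omega)
  have hq := hX _ h₁
  have hz₁ := hZ (low h u)
  have hz₂ := hZ (low h u + h)
  have ht := hT _ h₂
  rw [(hY u hu).1, (hY u hu).2, FixedFFT.ilevel]
  have hs : ‖(1 - 2 * (half h u : ℂ))‖ = 1 := by
    rcases half_eq h u with h | h <;> simp [h]
    norm_num
  have hx : ‖cx (XR (low h u) + (1 - 2 * (half h u : ℤ)) * XR (low h u + h))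
      (XI (low h u) + (1 - 2 * (half h u : ℤ)) * XI (low h u + h)) -
      S * (Z (low h u) + (1 - 2 * (half h u : ℂ)) * Z (low h u + h))‖ ≤ 2 * e := by
    rw [← cx_add, ← int_mul_cx]
    set p := cx (XR (low h u)) (XI (low h u))
    set q := cx (XR (low h u + h)) (XI (low h u + h))
    have : p + ((1 - 2 * (half h u : ℤ) : ℤ) : ℂ) * q -
        S * (Z (low h u) + (1 - 2 * (half h u : ℂ)) * Z (low h u + h)) =
        (p - S * Z (low h u)) + (1 - 2 * (half h u : ℂ)) * (q - S * Z (low h u + h)) := by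
      push_cast
      ring
    rw [this]
    refine (norm_add_le _ _).trans ?_
    rw [norm_mul, hs]
    linarith
  have hz : ‖Z (low h u) + (1 - 2 * (half h u : ℂ)) * Z (low h u + h)‖ ≤ 2 * C := by
    refine (norm_add_le _ _).trans ?_
    rw [norm_mul, hs]
    linarith
  have hw : ‖(1 - (half h u : ℂ)) + (half h u : ℂ) * (starRingEnd ℂ) (split (u / (2 * h)))‖ ≤ 1 := by
    rcases half_eq h u with h | h <;> simp [h, norm_split]
  have hy : ‖cx ((1 - (half h u : ℤ)) * S + half h u * TR (u / (2 * h)))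
      (-(half h u * TI (u / (2 * h)))) -
      S * ((1 - (half h u : ℂ)) + (half h u : ℂ) * (starRingEnd ℂ) (split (u / (2 * h))))‖ ≤ η := by
    rcases half_eq h u with h' | h'
    · rw [h']
      have : cx ((1 - ((0 : ℕ) : ℤ)) * S + ((0 : ℕ) : ℤ) * TR (u / (2 * h)))
          (-(((0 : ℕ) : ℤ) * TI (u / (2 * h)))) = S := by
        apply Complex.ext <;> simp [cx]
      rw [this]
      simpa using hη0
    · rw [h']
      have : cx ((1 - ((1 : ℕ) : ℤ)) * S + ((1 : ℕ) : ℤ) * TR (u / (2 * h)))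
          (-(((1 : ℕ) : ℤ) * TI (u / (2 * h)))) =
          (starRingEnd ℂ) (cx (TR (u / (2 * h))) (TI (u / (2 * h)))) := by
        rw [← cx_neg_conj]
        congr 1 <;> simp
      rw [this]
      have e : (S : ℂ) * ((1 - ((1 : ℕ) : ℂ)) + ((1 : ℕ) : ℂ) * (starRingEnd ℂ) (split (u / (2 * h)))) =
          (starRingEnd ℂ) (S * split (u / (2 * h))) := by
        simp
      rw [e, ← map_sub, Complex.norm_conj]
      exact ht
  have := norm_mul_tdiv_sub_le hS hx hy hz hw hη
  linarith

theorem Close.mono {S : ℤ} {M M' : ℕ} {e e' : ℝ} {XR XI : ℕ → ℤ} {Z : ℕ → ℂ}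
    (h : Close S M e XR XI Z) (hM : M' ≤ M) (he : e ≤ e') : Close S M' e' XR XI Z :=
  fun u hu => (h u (by omega)).trans he

/-- The entries of an approximation are bounded. -/
theorem Close.abs_le {S : ℤ} {M : ℕ} {e C : ℝ} {XR XI : ℕ → ℤ} {Z : ℕ → ℂ} (hS : 0 < S)
    (h : Close S M e XR XI Z) (hZ : ∀ u, ‖Z u‖ ≤ C) {u : ℕ} (hu : u < M) {D : ℤ}
    (hD : S * C + e ≤ D) : |XR u| ≤ D ∧ |XI u| ≤ D := by
  have hS' : (0 : ℝ) < S := by exact_mod_cast hS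
  have h₁ : ‖cx (XR u) (XI u)‖ ≤ D := by
    have : cx (XR u) (XI u) = (cx (XR u) (XI u) - S * Z u) + S * Z u := by ring
    rw [this]
    refine (norm_add_le _ _).trans ?_
    rw [norm_mul, Complex.norm_intCast, abs_of_pos hS']
    have := h u hu
    have := mul_le_mul_of_nonneg_left (hZ u) hS'.le
    linarith
  constructor
  · have := (Complex.abs_re_le_norm _).trans h₁
    simp only [cx] at this
    exact_mod_cast this
  · have := (Complex.abs_im_le_norm _).trans h₁
    simp only [cx] at this
    exact_mod_cast this

end FixedFFT

namespace IntProg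

/-! ### Notation for expressions -/

instance : Add Ex := ⟨.add⟩
instance : Sub Ex := ⟨.sub⟩
instance : Mul Ex := ⟨.mul⟩
instance : Div Ex := ⟨.div⟩
instance (n : ℕ) : OfNat Ex n := ⟨.num n⟩

/-- The value of the variable `v`. -/
abbrev V (v : ℕ) : Ex := .var v

section simps

variable (s : St) (B : ℤ) (a b : Ex) (n v : ℕ) (j : Fin 16)

@[simp] theorem Ex.eval_add : (a + b).eval s = a.eval s + b.eval s := rfl
@[simp] theorem Ex.eval_sub : (a - b).eval s = a.eval s - b.eval s := rfl
@[simp] theorem Ex.eval_mul : (a * b).eval s = a.eval s * b.eval s := rfl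
@[simp] theorem Ex.eval_div : (a / b).eval s = (a.eval s).tdiv (b.eval s) := rfl
@[simp] theorem Ex.eval_num : (no_index (OfNat.ofNat n) : Ex).eval s = (n : ℤ) := rfl
@[simp] theorem Ex.eval_var : (Ex.var v).eval s = s.var v := rfl
@[simp] theorem Ex.eval_get : (Ex.get j a).eval s = s.arr j (a.eval s).toNat := rfl
@[simp] theorem Ex.eval_inp :
    (Ex.inp a).eval s = (s.inp.getD (a.eval s).toNat 0 : ℕ) := rfl
@[simp] theorem Ex.safe_add :
    (a + b).Safe B s ↔ a.Safe B s ∧ b.Safe B s ∧ |a.eval s + b.eval s| ≤ B := Iff.rfl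
@[simp] theorem Ex.safe_sub :
    (a - b).Safe B s ↔ a.Safe B s ∧ b.Safe B s ∧ |a.eval s - b.eval s| ≤ B := Iff.rfl
@[simp] theorem Ex.safe_mul :
    (a * b).Safe B s ↔ a.Safe B s ∧ b.Safe B s ∧ |a.eval s * b.eval s| ≤ B := Iff.rfl
@[simp] theorem Ex.safe_div : (a / b).Safe B s ↔ a.Safe B s ∧ b.Safe B s := Iff.rfl
@[simp] theorem Ex.safe_num : (no_index (OfNat.ofNat n) : Ex).Safe B s ↔ (n : ℤ) ≤ B := by
  show |(n : ℤ)| ≤ B ↔ _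
  rw [Nat.abs_cast]
@[simp] theorem Ex.safe_var : (Ex.var v).Safe B s ↔ True := Iff.rfl
@[simp] theorem Ex.safe_get :
    (Ex.get j a).Safe B s ↔ a.Safe B s ∧ 0 ≤ a.eval s := Iff.rfl
@[simp] theorem Ex.safe_inp :
    (Ex.inp a).Safe B s ↔ a.Safe B s ∧ 0 ≤ a.eval s ∧ a.eval s < s.inp.length := Iff.rfl
@[simp] theorem Ex.size_add : (a + b).size = a.size + b.size + 4 := rfl
@[simp] theorem Ex.size_sub : (a - b).size = a.size + b.size + 4 := rfl
@[simp] theorem Ex.size_mul : (a * b).size = a.size + b.size + 8 := rfl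
@[simp] theorem Ex.size_div : (a / b).size = a.size + b.size + 8 := rfl
@[simp] theorem Ex.size_num : (no_index (OfNat.ofNat n) : Ex).size = 2 := rfl
@[simp] theorem Ex.size_var : (Ex.var v).size = 2 := rfl
@[simp] theorem Ex.size_get : (Ex.get j a).size = a.size + 9 := rfl
@[simp] theorem Ex.size_inp : (Ex.inp a).size = a.size + 2 := rfl

end simps

/-- The rule for a loop that fills two arrays one entry at a time. -/
theorem Tri.loop_fill {B : ℤ} {v : ℕ} {e : Ex} {c : Cmd} {s : St} {T n : ℕ} (j₁ j₂ : Fin 16)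
    (F₁ F₂ : ℕ → ℤ) (he : e.Safe B s) (hn : e.eval s = n)
    (h : ∀ j < n, ∀ s', Frame (.loop v e c) s s' → (∀ i ≥ j, s'.arr j₁ i = s.arr j₁ i) →
      (∀ i ≥ j, s'.arr j₂ i = s.arr j₂ i) →
      Tri B c (s'.setVar v j) T (fun s'' =>
        (∀ i, s''.arr j₁ i = if i = j then F₁ j else s'.arr j₁ i) ∧
        ∀ i, s''.arr j₂ i = if i = j then F₂ j else s'.arr j₂ i)) :
    Tri B (.loop v e c) s (n * (T + 7) + e.size + 4) (fun s' =>
      ((∀ i < n, s'.arr j₁ i = F₁ i) ∧ (∀ i < n, s'.arr j₂ i = F₂ i) ∧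
        (∀ i ≥ n, s'.arr j₁ i = s.arr j₁ i) ∧ ∀ i ≥ n, s'.arr j₂ i = s.arr j₂ i) ∧
      Frame (.loop v e c) s s') := by
  refine Tri.loop_frame (fun j s' => (∀ i < j, s'.arr j₁ i = F₁ i) ∧ (∀ i < j, s'.arr j₂ i = F₂ i) ∧
        (∀ i ≥ j, s'.arr j₁ i = s.arr j₁ i) ∧ ∀ i ≥ j, s'.arr j₂ i = s.arr j₂ i) he hn
    ⟨by simp, by simp, by simp, by simp⟩ fun j hj s' hs' hf => ?_
  obtain ⟨h₁, h₂, h₃, h₄⟩ := hs'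
  refine (h j hj s' hf h₃ h₄).mono le_rfl fun s'' hs'' => ⟨fun i hi => ?_, fun i hi => ?_,
    fun i hi => ?_, fun i hi => ?_⟩
  · rw [hs''.1]
    split_ifs with hij
    · rw [hij]
    · exact h₁ i (by omega)
  · rw [hs''.2]
    split_ifs with hij
    · rw [hij]
    · exact h₂ i (by omega)
  · rw [hs''.1, if_neg (by omega)]
    exact h₃ i (by omega)
  · rw [hs''.2, if_neg (by omega)]
    exact h₄ i (by omega)

infixr:60 " ;; " => Cmd.seq

/-! ### Multiplication of bit polynomials

The arrays `4` and `5` hold the coefficients of the factors, array `6` those of the product. The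
arrays `7`, `8` and `9`, `10` hold complex numbers, scaled by the content `S` of variable `8`, and
the arrays `11`, `12` hold the table of roots. Variable `20` is the length `M = 2 ^ m` of the
transform, and variable `21` is `m`. -/

/-- `X[i] := S * (A[i] + B[i] * I)` -/
def mulInit : Cmd :=
  .loop 25 (V 20) (.store 7 (V 25) (.get 4 (V 25) * V 8) ;; .store 8 (V 25) (.get 5 (V 25) * V 8))

/-- `X[i] := Y[i]` -/
def copyBack : Cmd :=
  .loop 25 (V 20) (.store 7 (V 25) (.get 9 (V 25)) ;; .store 8 (V 25) (.get 10 (V 25)))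

/-- Sets the variables `27`, `28`, `29` to the block of position `u`, to the half of the block in
which it lies, and to its partner in the lower half. -/
def blockVars : Cmd :=
  .assign 27 (V 25 / (2 * V 26)) ;; .assign 28 ((V 25 - V 27 * (2 * V 26)) / V 26) ;;
    .assign 29 (V 25 - V 28 * V 26)

def forwardBody : Cmd :=
  blockVars ;;
  .store 9 (V 25) (.get 7 (V 29) + (1 - 2 * V 28) *
    ((.get 7 (V 29 + V 26) * .get 11 (V 27) - .get 8 (V 29 + V 26) * .get 12 (V 27)) / V 8)) ;;
  .store 10 (V 25) (.get 8 (V 29) + (1 - 2 * V 28) *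
    ((.get 7 (V 29 + V 26) * .get 12 (V 27) + .get 8 (V 29 + V 26) * .get 11 (V 27)) / V 8))

def forwardLevel : Cmd := .loop 25 (V 20) forwardBody ;; copyBack

def forward : Cmd :=
  .assign 26 (V 20) ;; .loop 24 (V 21) (.assign 26 (V 26 / 2) ;; forwardLevel)

def squareAll : Cmd :=
  .loop 25 (V 20)
    (.assign 30 ((.get 7 (V 25) * .get 7 (V 25) - .get 8 (V 25) * .get 8 (V 25)) / V 8) ;;
     .assign 31 ((.get 7 (V 25) * .get 8 (V 25) + .get 8 (V 25) * .get 7 (V 25)) / V 8) ;;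
     .store 7 (V 25) (V 30) ;; .store 8 (V 25) (V 31))

def inverseBody : Cmd :=
  blockVars ;;
  .assign 30 (.get 7 (V 29) + (1 - 2 * V 28) * .get 7 (V 29 + V 26)) ;;
  .assign 31 (.get 8 (V 29) + (1 - 2 * V 28) * .get 8 (V 29 + V 26)) ;;
  .assign 32 ((1 - V 28) * V 8 + V 28 * .get 11 (V 27)) ;;
  .assign 33 (0 - V 28 * .get 12 (V 27)) ;;
  .store 9 (V 25) ((V 30 * V 32 - V 31 * V 33) / V 8) ;;
  .store 10 (V 25) ((V 30 * V 33 + V 31 * V 32) / V 8)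

def inverseLevel : Cmd := .loop 25 (V 20) inverseBody ;; copyBack

def inverse : Cmd :=
  .assign 26 1 ;; .loop 24 (V 21) (inverseLevel ;; .assign 26 (2 * V 26))

/-- Rounds the imaginary parts, and reduces them modulo two. -/
def extract : Cmd :=
  .loop 25 (V 20)
    (.assign 30 ((.get 8 (V 25) + V 8 * V 20) / (2 * (V 8 * V 20))) ;;
     .store 6 (V 25) (V 30 - 2 * (V 30 / 2)))

def mulProg : Cmd := mulInit ;; forward ;; squareAll ;; inverse ;; extract

/-! #### Verification -/

open FixedFFT

theorem eval_blockVars {s : St} {u h : ℕ} (hu : s.var 25 = u) (hh : s.var 26 = h) :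
    blockVars.eval s = ((s.setVar 27 (u / (2 * h) : ℕ)).setVar 28 (half h u)).setVar 29
      (low h u) := by
  have h₁ : (u : ℤ).tdiv (2 * h) = ((u / (2 * h) : ℕ) : ℤ) := by
    rw [show (2 * h : ℤ) = ((2 * h : ℕ) : ℤ) by push_cast; rfl]
    exact (Int.ofNat_tdiv _ _).symm
  have h₂ : (u : ℤ) - ((u / (2 * h) : ℕ) : ℤ) * (2 * h) = ((u % (2 * h) : ℕ) : ℤ) := by
    have := Nat.div_add_mod u (2 * h)
    zify at this
    push_cast
    linarith
  have h₃ : ((u % (2 * h) : ℕ) : ℤ).tdiv h = (half h u : ℤ) := (Int.ofNat_tdiv _ _).symm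
  have h₄ : (u : ℤ) - (half h u : ℤ) * h = (low h u : ℤ) := by
    have : half h u * h ≤ u := (Nat.div_mul_le_self _ _).trans (Nat.mod_le _ _)
    rw [show low h u = u - half h u * h from rfl, Nat.cast_sub this]
    push_cast
    rfl
  generalize u / (2 * h) = b at *
  generalize u % (2 * h) = r at *
  simp [blockVars, Cmd.eval, hu, hh, h₁, h₂, h₃, h₄]

theorem abs_le_of_nonneg {x B : ℤ} (h₀ : 0 ≤ x) (h : x ≤ B) : |x| ≤ B := by
  rwa [abs_of_nonneg h₀]

theorem safe_blockVars {B : ℤ} {s : St} {u h : ℕ} (hu : s.var 25 = u) (hh : s.var 26 = h)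
    (hB : (u : ℤ) + 2 * h + 2 ≤ B) : blockVars.Safe B s := by
  have h₁ : (u : ℤ).tdiv (2 * h) = ((u / (2 * h) : ℕ) : ℤ) := by
    rw [show (2 * h : ℤ) = ((2 * h : ℕ) : ℤ) by push_cast; rfl]
    exact (Int.ofNat_tdiv _ _).symm
  have h₂ : (u : ℤ) - ((u / (2 * h) : ℕ) : ℤ) * (2 * h) = ((u % (2 * h) : ℕ) : ℤ) := by
    have := Nat.div_add_mod u (2 * h)
    zify at this
    push_cast
    linarith
  have h₃ : ((u % (2 * h) : ℕ) : ℤ).tdiv h = (half h u : ℤ) := (Int.ofNat_tdiv _ _).symm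
  have h₄ : (half h u : ℤ) * h ≤ u := by
    have : half h u * h ≤ u := (Nat.div_mul_le_self _ _).trans (Nat.mod_le _ _)
    exact_mod_cast this
  have h₅ : ((u / (2 * h) : ℕ) : ℤ) * (2 * h) ≤ u := by
    exact_mod_cast Nat.div_mul_le_self u (2 * h)
  have h₆ : (u % (2 * h) : ℕ) ≤ u := Nat.mod_le _ _
  have h₇ : 0 ≤ ((u / (2 * h) : ℕ) : ℤ) * (2 * h) := by positivity
  have h₈ : 0 ≤ (half h u : ℤ) * h := by positivity
  generalize u / (2 * h) = b at *
  generalize u % (2 * h) = r at *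
  simp [blockVars, Cmd.Safe, Cmd.eval, hu, hh, h₁, h₂, h₃]
  and_intros <;> first | omega | (apply abs_le_of_nonneg <;> omega)

/-- What the transforms need to know about the state: the length `2 ^ m` of the transform divides
`N`, the scaling factor is `N ^ 20`, and there is a table of roots. -/
structure Setting (N m : ℕ) (s : St) : Prop where
  two_le : 2 ≤ N
  dvd : 2 ^ m ∣ N
  len : s.var 20 = (2 ^ m : ℕ)
  log : s.var 21 = m
  scale : s.var 8 = (N : ℤ) ^ 20
  table : Close ((N : ℤ) ^ 20) (N / 2) ((N : ℝ) ^ 6) (s.arr 11) (s.arr 12) split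

theorem Setting.congr {N m : ℕ} {s s' : St} (h : Setting N m s) (h₁ : s'.var 20 = s.var 20)
    (h₂ : s'.var 21 = s.var 21) (h₃ : s'.var 8 = s.var 8) (h₄ : s'.arr 11 = s.arr 11)
    (h₅ : s'.arr 12 = s.arr 12) : Setting N m s' :=
  ⟨h.two_le, h.dvd, h₁ ▸ h.len, h₂ ▸ h.log, h₃ ▸ h.scale, by rw [h₄, h₅]; exact h.table⟩

theorem Setting.frame {N m : ℕ} {s s' : St} {c : Cmd} (h : Setting N m s) (hf : Frame c s s')
    (h₁ : c.keepsVar 20 = true := by rfl) (h₂ : c.keepsVar 21 = true := by rfl)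
    (h₃ : c.keepsVar 8 = true := by rfl) (h₄ : c.keepsArr 11 = true := by rfl)
    (h₅ : c.keepsArr 12 = true := by rfl) : Setting N m s' :=
  h.congr (hf.var _ h₁) (hf.var _ h₂) (hf.var _ h₃) (hf.arr _ h₄) (hf.arr _ h₅)

theorem Tri.then {B : ℤ} {c₁ c₂ : Cmd} {s : St} {T₁ T₂ T : ℕ} {Q R : St → Prop}
    (h₁ : Tri B c₁ s T₁ Q) (h₂ : ∀ s', Q s' → Tri B c₂ s' T₂ R) (hT : T₁ + T₂ ≤ T) :
    Tri B (.seq c₁ c₂) s T R := (h₁.seq h₂).mono hT fun _ h => h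

theorem abs_mul_le_of_le {x y a b : ℤ} (hx : |x| ≤ a) (hy : |y| ≤ b) : |x * y| ≤ a * b := by
  rw [abs_mul]
  exact mul_le_mul hx hy (abs_nonneg _) ((abs_nonneg _).trans hx)

theorem abs_add_le_of_le {x y a b : ℤ} (hx : |x| ≤ a) (hy : |y| ≤ b) : |x + y| ≤ a + b :=
  (abs_add_le _ _).trans (add_le_add hx hy)

theorem abs_sub_le_of_le {x y a b : ℤ} (hx : |x| ≤ a) (hy : |y| ≤ b) : |x - y| ≤ a + b :=
  (abs_sub _ _).trans (add_le_add hx hy)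

theorem abs_tdiv_le_of_le {x y a : ℤ} (hx : |x| ≤ a) : |x.tdiv y| ≤ a := by
  refine le_trans ?_ hx
  rw [Int.abs_eq_natAbs, Int.abs_eq_natAbs, Int.natAbs_tdiv]
  exact_mod_cast Nat.div_le_self _ _

theorem copyBack_tri {B : ℤ} {s : St} {M : ℕ} (hM : s.var 20 = M) :
    Tri B copyBack s (60 * M + 10) (fun s' => ((∀ i < M, s'.arr 7 i = s.arr 9 i) ∧
      ∀ i < M, s'.arr 8 i = s.arr 10 i) ∧ Frame copyBack s s') := by
  refine (Tri.loop_fill (T := 50) (n := M) 7 8 (s.arr 9) (s.arr 10) (by simp) (by simpa using hM)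
    fun j hj s' hf _ _ => ⟨?_, ?_, ?_⟩).mono ?_ fun s' hs' => ⟨⟨hs'.1.1, hs'.1.2.1⟩, hs'.2⟩
  · simp [Cmd.Safe, Cmd.eval]
  · simp [Cmd.cost]
  · have h9 := hf.arr 9 rfl
    have h10 := hf.arr 10 rfl
    simp [Cmd.eval, h9, h10]
  · simp; omega

/-- The results go to the arrays `9` and `10`, so that both partners of a pair read the values from
before the level. As `D` bounds all entries, every intermediate value is at most `8 * (D * D)`. -/
theorem forwardBody_tri {B D : ℤ} {N m : ℕ} {s : St} {u h : ℕ} (hs : Setting N m s)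
    (hu : s.var 25 = u) (hh : s.var 26 = h) (h0 : 0 < h) (hM : 2 * h ∣ 2 ^ m) (huM : u < 2 ^ m)
    (hX : ∀ i < 2 ^ m, |s.arr 7 i| ≤ D ∧ |s.arr 8 i| ≤ D)
    (hT : ∀ i < N / 2, |s.arr 11 i| ≤ D ∧ |s.arr 12 i| ≤ D)
    (hD : (2 : ℤ) ^ m + 2 ≤ D) (hB : 8 * (D * D) ≤ B) :
    Tri B forwardBody s 600 (fun s' =>
      (∀ i, s'.arr 9 i = if i = u then s.arr 7 (low h u) + (1 - 2 * (half h u : ℤ)) *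
        (s.arr 7 (low h u + h) * s.arr 11 (u / (2 * h)) -
          s.arr 8 (low h u + h) * s.arr 12 (u / (2 * h))).tdiv (N ^ 20) else s.arr 9 i) ∧
      (∀ i, s'.arr 10 i = if i = u then s.arr 8 (low h u) + (1 - 2 * (half h u : ℤ)) *
        (s.arr 7 (low h u + h) * s.arr 12 (u / (2 * h)) +
          s.arr 8 (low h u + h) * s.arr 11 (u / (2 * h))).tdiv (N ^ 20) else s.arr 10 i)) := by
  obtain ⟨l₁, l₂⟩ := low_lt h0 hM huM
  have l₃ : u / (2 * h) < N / 2 := by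
    have : 2 ^ m / (2 * h) ≤ N / 2 := by
      have : 2 ^ m ≤ N := Nat.le_of_dvd (by have := hs.two_le; omega) hs.dvd
      exact (Nat.div_le_div_right this).trans (Nat.div_le_div_left (by omega) two_pos)
    omega
  have hM' : 2 * h ≤ 2 ^ m := Nat.le_of_dvd (by positivity) hM
  zify at hM' huM l₁
  have D0 : 0 ≤ D * D := mul_self_nonneg D
  have DD : 2 * D ≤ D * D := by nlinarith
  have e := eval_blockVars hu hh
  have hsafe := safe_blockVars (B := B) hu hh (by linarith)
  have a₁ := hX _ ((Nat.le_add_right _ h).trans_lt (by exact_mod_cast l₁))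
  have a₂ := hX (low h u + h) (by exact_mod_cast l₁)
  have a₃ := hT _ l₃
  have hS := hs.scale
  have m₁ := abs_mul_le_of_le a₂.1 a₃.1
  have m₂ := abs_mul_le_of_le a₂.2 a₃.2
  have m₃ := abs_mul_le_of_le a₂.1 a₃.2
  have m₄ := abs_mul_le_of_le a₂.2 a₃.1
  have m₅ := abs_sub_le_of_le m₁ m₂
  have m₆ := abs_add_le_of_le m₃ m₄
  have hr : |1 - 2 * (half h u : ℤ)| ≤ 1 := by rcases half_eq h u with h | h <;> simp [h]
  have hr' := half_le h u
  have m₇ := abs_mul_le_of_le hr (abs_tdiv_le_of_le (y := (N : ℤ) ^ 20) m₅)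
  have m₈ := abs_mul_le_of_le hr (abs_tdiv_le_of_le (y := (N : ℤ) ^ 20) m₆)
  have m₉ := abs_add_le_of_le a₁.1 m₇
  have m₁₀ := abs_add_le_of_le a₁.2 m₈
  have hq : ((low h u : ℤ) + h).toNat = low h u + h := by omega
  generalize u / (2 * h) = b at *
  refine ⟨⟨hsafe, ?_⟩, ?_, ?_⟩
  · rw [e]
    simp [Cmd.Safe, Cmd.eval, hu, hh, hS, hq, -abs_mul]
    and_intros <;> first | omega | linarith | (apply abs_le_of_nonneg <;> linarith)
  · simp [Cmd.cost, forwardBody, blockVars]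
  · rw [forwardBody, Cmd.eval, e]
    simp [Cmd.eval, hu, hh, hS, hq]

theorem one_le_pow_of_two_le {N : ℕ} (h : 2 ≤ N) (k : ℕ) : (1 : ℝ) ≤ (N : ℝ) ^ k :=
  one_le_pow₀ (by exact_mod_cast (by omega : 1 ≤ N))

theorem Setting.len_le {N m : ℕ} {s : St} (h : Setting N m s) : 2 ^ m ≤ N :=
  Nat.le_of_dvd (by have := h.two_le; omega) h.dvd

theorem Setting.scale_pos {N m : ℕ} {s : St} (h : Setting N m s) : (0 : ℤ) < (N : ℤ) ^ 20 := by
  have := h.two_le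
  positivity

theorem Setting.abs_table_le {N m : ℕ} {s : St} (h : Setting N m s) {i : ℕ} (hi : i < N / 2) :
    |s.arr 11 i| ≤ (N : ℤ) ^ 26 ∧ |s.arr 12 i| ≤ (N : ℤ) ^ 26 := by
  refine h.table.abs_le h.scale_pos (C := 1) (fun u => (norm_split u).le) hi ?_
  push_cast
  have h2 : (2 : ℝ) ≤ N := by exact_mod_cast h.two_le
  have h6 : (N : ℝ) ^ 6 ≤ N ^ 20 := pow_le_pow_right₀ (by linarith) (by norm_num)
  have h26 : (N : ℝ) ^ 26 = N ^ 20 * N ^ 6 := by ring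
  have h20 := one_le_pow_of_two_le h.two_le 20
  have : (2 : ℝ) ^ 6 ≤ N ^ 6 := pow_le_pow_left₀ (by norm_num) h2 6
  nlinarith

theorem Setting.pow_le {N m : ℕ} {s : St} (h : Setting N m s) : (2 : ℤ) ^ m + 2 ≤ (N : ℤ) ^ 26 := by
  have h2 : (2 : ℤ) ≤ N := by exact_mod_cast h.two_le
  have h1 : (2 : ℤ) ^ m ≤ N := by exact_mod_cast h.len_le
  have h3 : (N : ℤ) ^ 2 ≤ N ^ 26 := pow_le_pow_right₀ (by linarith) (by norm_num)
  nlinarith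

theorem Setting.eight_mul_le {N m : ℕ} {s : St} {B : ℤ} (h : Setting N m s) (hB : (N : ℤ) ^ 60 ≤ B) :
    8 * ((N : ℤ) ^ 26 * (N : ℤ) ^ 26) ≤ B := by
  have h2 : (2 : ℤ) ≤ N := by exact_mod_cast h.two_le
  have h8 : (2 : ℤ) ^ 8 ≤ (N : ℤ) ^ 8 := pow_le_pow_left₀ (by norm_num) h2 8
  have h52 : 0 ≤ (N : ℤ) ^ 52 := by positivity
  have : (N : ℤ) ^ 60 = N ^ 52 * N ^ 8 := by ring
  nlinarith

theorem Setting.le_bound {N m : ℕ} {s : St} {B : ℤ} (h : Setting N m s) (hB : (N : ℤ) ^ 60 ≤ B) :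
    (2 : ℤ) ^ m + 2 ≤ B := by
  have h1 := h.pow_le
  have h2 : (2 : ℤ) ≤ N := by exact_mod_cast h.two_le
  exact h1.trans ((pow_le_pow_right₀ (by linarith) (by norm_num)).trans hB)

end IntProg

/-! ### The forward transform -/

namespace IntProg

open FixedFFT

theorem forwardLevel_tri {B : ℤ} {N m : ℕ} {s : St} {h : ℕ} {e C : ℝ} {Z : ℕ → ℂ}
    (hs : Setting N m s) (hh : s.var 26 = h) (h0 : 0 < h) (hM : 2 * h ∣ 2 ^ m)
    (hX : Close ((N : ℤ) ^ 20) (2 ^ m) e (s.arr 7) (s.arr 8) Z) (hZ : ∀ u, ‖Z u‖ ≤ C)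
    (hD : (N : ℝ) ^ 20 * C + e ≤ (N : ℝ) ^ 26) (hB : (N : ℤ) ^ 60 ≤ B) :
    Tri B forwardLevel s (1000 * 2 ^ m) (fun s' =>
      Close ((N : ℤ) ^ 20) (2 ^ m) (3 * e + C * N ^ 6 + 2) (s'.arr 7) (s'.arr 8) (level h Z)) := by
  have hle := hs.le_bound hB
  have hfill := Tri.loop_fill (B := B) (v := 25) (e := V 20) (c := forwardBody) (s := s) (T := 600)
    (n := 2 ^ m) 9 10
    (fun u => s.arr 7 (low h u) + (1 - 2 * (half h u : ℤ)) *
        (s.arr 7 (low h u + h) * s.arr 11 (u / (2 * h)) -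
          s.arr 8 (low h u + h) * s.arr 12 (u / (2 * h))).tdiv (N ^ 20))
    (fun u => s.arr 8 (low h u) + (1 - 2 * (half h u : ℤ)) *
        (s.arr 7 (low h u + h) * s.arr 12 (u / (2 * h)) +
          s.arr 8 (low h u + h) * s.arr 11 (u / (2 * h))).tdiv (N ^ 20))
    (by simp) (by simpa using hs.len) (fun u hu s' hf _ _ => by
      have e7 := hf.arr 7 rfl
      have e8 := hf.arr 8 rfl
      have e11 := hf.arr 11 rfl
      have e12 := hf.arr 12 rfl
      have hs' := hs.frame hf
      have := forwardBody_tri (B := B) (D := (N : ℤ) ^ 26) (s := s'.setVar 25 (u : ℕ)) (u := u)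
        (h := h) (hs'.congr rfl rfl rfl rfl rfl) (by simp)
        (by simpa [hh] using hf.var 26 rfl) h0 hM hu
        (fun i hi => by
          rw [St.setVar_arr, e7, e8]
          exact hX.abs_le hs.scale_pos hZ hi (by push_cast; exact hD))
        (fun i hi => hs'.abs_table_le hi) hs.pow_le (hs.eight_mul_le hB)
      simpa only [St.setVar_arr, e7, e8, e11, e12] using this)
  refine hfill.then (T₂ := 60 * 2 ^ m + 10) (fun s' hs' =>
    (copyBack_tri (M := 2 ^ m) ?_).mono le_rfl fun s'' hs'' => ?_) ?_
  · rw [hs'.2.var 20 rfl, hs.len]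
  · refine Close.level hs.scale_pos h0 hM hX (hs.table.mono ?_ le_rfl) hZ ?_ fun u hu => ?_
    · exact (Nat.div_le_div_right hs.len_le).trans (Nat.div_le_div_left (by omega) two_pos)
    · push_cast
      exact pow_le_pow_right₀ (by exact_mod_cast (by have := hs.two_le; omega : 1 ≤ N))
        (by norm_num)
    · rw [hs''.1.1 u hu, hs''.1.2 u hu, hs'.1.1 u hu, hs'.1.2.1 u hu]
      exact ⟨rfl, rfl⟩
  · have : 1 ≤ 2 ^ m := Nat.one_le_two_pow
    simp only [Ex.size_var]
    omega

/-- The values stay below `2 * N`, so the error obeys `e ↦ 3 * e + A` with `A = 2 * N * N ^ 6 + 2`.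
The invariant `4 ^ l * A` absorbs the additive term, and `4 ^ m ≤ N ^ 2` makes the total at most `N
^ 11`. -/
theorem forward_tri {B : ℤ} {N m : ℕ} {s : St} {Z : ℕ → ℂ} (hs : Setting N m s)
    (hX : Close ((N : ℤ) ^ 20) (2 ^ m) 0 (s.arr 7) (s.arr 8) Z) (hZ : ∀ u, ‖Z u‖ ≤ 2)
    (hB : (N : ℤ) ^ 60 ≤ B) :
    Tri B forward s (1100 * (2 ^ m * (m + 1))) (fun s' =>
      Close ((N : ℤ) ^ 20) (2 ^ m) ((N : ℝ) ^ 11) (s'.arr 7) (s'.arr 8) (stage m Z m)) := by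
  have hle := hs.le_bound hB
  have hpos : (0 : ℤ) < 2 ^ m := by positivity
  have h2 : (2 : ℝ) ≤ N := by exact_mod_cast hs.two_le
  have hMN : (2 : ℝ) ^ m ≤ N := by exact_mod_cast hs.len_le
  have hmono : ∀ l ≤ m, ∀ u, ‖stage m Z l u‖ ≤ 2 * N := fun l hl u => by
    refine (norm_stage_le hZ l u).trans ?_
    have : (2 : ℝ) ^ l ≤ 2 ^ m := pow_le_pow_right₀ (by norm_num) hl
    linarith
  have h4 : ∀ l ≤ m, (4 : ℝ) ^ l ≤ N ^ 2 := fun l hl => by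
    have : (2 : ℝ) ^ l ≤ N := (pow_le_pow_right₀ (by norm_num) hl).trans hMN
    rw [show (4 : ℝ) = 2 ^ 2 by norm_num, ← pow_mul, mul_comm, pow_mul]
    exact pow_le_pow_left₀ (by positivity) this 2
  have hN2 : (2 : ℝ) ^ 2 ≤ (N : ℝ) ^ 2 := pow_le_pow_left₀ (by norm_num) h2 2
  have hN9 : (2 : ℝ) ^ 9 ≤ (N : ℝ) ^ 9 := pow_le_pow_left₀ (by norm_num) h2 9
  have herr : ∀ l ≤ m, (4 : ℝ) ^ l * (2 * N * N ^ 6 + 2) ≤ N ^ 11 := fun l hl => by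
    have h9 : (N : ℝ) ^ 2 * (2 * N * N ^ 6 + 2) = 2 * N ^ 9 + 2 * N ^ 2 := by ring
    have h11 : (N : ℝ) ^ 11 = N ^ 9 * N ^ 2 := by ring
    have : (N : ℝ) ^ 2 ≤ N ^ 9 := pow_le_pow_right₀ (by linarith) (by norm_num)
    have := mul_le_mul_of_nonneg_right (h4 l hl) (show (0 : ℝ) ≤ 2 * N * N ^ 6 + 2 by positivity)
    nlinarith
  refine (Tri.assign (by simp) ?_).then (Q := fun s' => s' = s.setVar 26 (2 ^ m : ℕ))
    (T₂ := m * (1000 * 2 ^ m + 27) + 6) (fun s' hs' => ?_) ?_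
  · simp [hs.len]
  · subst hs'
    refine (Tri.loop_frame (T := 1000 * 2 ^ m + 20) (n := m) (fun l s' =>
      s'.var 26 = (2 ^ (m - l) : ℕ) ∧ Close ((N : ℤ) ^ 20) (2 ^ m)
        (4 ^ l * (2 * N * N ^ 6 + 2)) (s'.arr 7) (s'.arr 8) (stage m Z l)) (by simp)
      (by simpa using hs.log) ?_ ?_).mono ?_ ?_
    · refine ⟨by simp, hX.mono le_rfl ?_⟩
      positivity
    · intro l hl s' hs' hf
      obtain ⟨hv, hc⟩ := hs'
      have hset : Setting N m s' :=
        (hs.congr (s' := s.setVar 26 (2 ^ m : ℕ)) (by simp) (by simp) (by simp) rfl rfl).frame hf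
      have hhalf : (2 ^ (m - l) : ℕ) = 2 * 2 ^ (m - l - 1) := by
        rw [← pow_succ', show m - l - 1 + 1 = m - l by omega]
      refine (Tri.assign (by simp; linarith) ?_).then (T₂ := 1000 * 2 ^ m)
        (Q := fun s'' => s'' = (s'.setVar 24 l).setVar 26 (2 ^ (m - l - 1) : ℕ))
        (fun s'' hs'' => ?_) ?_
      · have : ((2 * 2 ^ (m - l - 1) : ℕ) : ℤ).tdiv 2 = (2 ^ (m - l - 1) : ℕ) := by
          push_cast
          exact Int.mul_tdiv_cancel_left _ (by norm_num)
        simp [hv, hhalf]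
      · subst hs''
        have hfin := forwardLevel_tri (B := B) (s := (s'.setVar 24 l).setVar 26 (2 ^ (m - l - 1) : ℕ))
          (h := 2 ^ (m - l - 1)) (C := 2 * N) (Z := stage m Z l)
          (hset.congr (by simp) (by simp) (by simp) rfl rfl) (by simp) (by positivity)
          (by rw [← hhalf]; exact pow_dvd_pow 2 (by omega)) hc (hmono l hl.le) ?_ hB
        · refine hfin.frame.mono le_rfl fun s₃ h₃ => ⟨?_, h₃.1.mono le_rfl ?_⟩
          · rw [h₃.2.var 26 rfl]
            simp [show m - (l + 1) = m - l - 1 by omega]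
          · have : (1 : ℝ) ≤ 4 ^ l := one_le_pow₀ (by norm_num)
            have h0 : (0 : ℝ) ≤ 2 * N * N ^ 6 + 2 := by positivity
            rw [pow_succ (4 : ℝ)]
            nlinarith
        · have := herr l hl.le
          have h11 : (N : ℝ) ^ 26 = N ^ 20 * N ^ 6 := by ring
          have h23 : (N : ℝ) ^ 11 ≤ N ^ 20 := pow_le_pow_right₀ (by linarith) (by norm_num)
          have hN6 : (N : ℝ) ^ 6 = N ^ 5 * N := by ring
          have hN5 : (2 : ℝ) ^ 5 ≤ (N : ℝ) ^ 5 := pow_le_pow_left₀ (by norm_num) h2 5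
          have : (0 : ℝ) ≤ N ^ 20 := by positivity
          have h6 : 2 * (N : ℝ) + 1 ≤ N ^ 6 := by nlinarith
          nlinarith
      · simp; omega
    · simp
    · intro s' hs'
      exact hs'.1.2.mono le_rfl (herr m le_rfl)
  · have : 1 ≤ 2 ^ m := Nat.one_le_two_pow
    simp only [Ex.size_var]
    nlinarith

end IntProg

/-! ### Pointwise squaring, the inverse transform and rounding -/

namespace IntProg

open FixedFFT

/-- The error of a product with both errors `N ^ 11` and both sizes `2 * N` is `N ^ 11 * (4 * N + 1)
+ 2`. The entries are overwritten in place, hence the detour through the variables `30` and `31`. -/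
theorem squareAll_tri {B : ℤ} {N m : ℕ} {s : St} {Z : ℕ → ℂ} (hs : Setting N m s)
    (hX : Close ((N : ℤ) ^ 20) (2 ^ m) ((N : ℝ) ^ 11) (s.arr 7) (s.arr 8) Z)
    (hZ : ∀ u, ‖Z u‖ ≤ 2 * N) (hB : (N : ℤ) ^ 60 ≤ B) :
    Tri B squareAll s (300 * 2 ^ m) (fun s' =>
      Close ((N : ℤ) ^ 20) (2 ^ m) ((N : ℝ) ^ 15) (s'.arr 7) (s'.arr 8) (fun u => Z u * Z u)) := by
  have h2 : (2 : ℝ) ≤ N := by exact_mod_cast hs.two_le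
  have hN : (1 : ℝ) ≤ N := by linarith
  have h8 := hs.eight_mul_le hB
  have h11 : (N : ℝ) ^ 11 ≤ N ^ 20 := pow_le_pow_right₀ hN (by norm_num)
  have hX' : ∀ i < 2 ^ m, |s.arr 7 i| ≤ (N : ℤ) ^ 26 ∧ |s.arr 8 i| ≤ (N : ℤ) ^ 26 := fun i hi => by
    refine hX.abs_le hs.scale_pos hZ hi ?_
    push_cast
    have h5 : (2 : ℝ) ^ 5 ≤ (N : ℝ) ^ 5 := pow_le_pow_left₀ (by norm_num) h2 5
    have h6 : (N : ℝ) ^ 6 = N ^ 5 * N := by ring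
    have h26 : (N : ℝ) ^ 26 = N ^ 20 * N ^ 6 := by ring
    have h20 : (0 : ℝ) ≤ N ^ 20 := by positivity
    have : 2 * (N : ℝ) + 1 ≤ N ^ 6 := by nlinarith
    nlinarith
  refine (Tri.loop_fill (T := 250) (n := 2 ^ m) 7 8
    (fun u => (s.arr 7 u * s.arr 7 u - s.arr 8 u * s.arr 8 u).tdiv (N ^ 20))
    (fun u => (s.arr 7 u * s.arr 8 u + s.arr 8 u * s.arr 7 u).tdiv (N ^ 20))
    (by simp) (by simpa using hs.len) fun u hu s' hf h7 h8 => ?_).mono ?_ fun s' hs' u hu => ?_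
  · have e7 := h7 u le_rfl
    have e8 := h8 u le_rfl
    have hS := (hs.frame hf).scale
    obtain ⟨b₁, b₂⟩ := hX' u hu
    have m₁ := abs_mul_le_of_le b₁ b₁
    have m₂ := abs_mul_le_of_le b₂ b₂
    have m₃ := abs_mul_le_of_le b₁ b₂
    have m₄ := abs_mul_le_of_le b₂ b₁
    have m₅ := abs_sub_le_of_le m₁ m₂
    have m₆ := abs_add_le_of_le m₃ m₄
    have m₀ : 0 ≤ (N : ℤ) ^ 26 * (N : ℤ) ^ 26 := by positivity
    refine ⟨?_, ?_, ?_⟩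
    · simp [Cmd.Safe, Cmd.eval, hS, e7, e8, -abs_mul, -abs_mul_abs_self]
      and_intros <;> linarith
    · simp [Cmd.cost]
    · simp [Cmd.eval, hS, e7, e8]
  · have : 1 ≤ 2 ^ m := Nat.one_le_two_pow
    simp only [Ex.size_var]
    omega
  · rw [hs'.1.1 u hu, hs'.1.2.1 u hu]
    refine (norm_mul_tdiv_sub_le hs.scale_pos (hX u hu) (hX u hu) (hZ u) (hZ u) ?_).trans ?_
    · push_cast
      exact h11
    · have h15 : (N : ℝ) ^ 15 = N ^ 11 * N ^ 4 := by ring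
      have h4 : (N : ℝ) ^ 4 = N ^ 3 * N := by ring
      have h3 : (2 : ℝ) ^ 3 ≤ (N : ℝ) ^ 3 := pow_le_pow_left₀ (by norm_num) h2 3
      have h11' : (2 : ℝ) ^ 11 ≤ (N : ℝ) ^ 11 := pow_le_pow_left₀ (by norm_num) h2 11
      have : 4 * (N : ℝ) + 2 ≤ N ^ 4 := by nlinarith
      nlinarith

theorem inverseBody_tri {B D : ℤ} {N m : ℕ} {s : St} {u h : ℕ} (hs : Setting N m s)
    (hu : s.var 25 = u) (hh : s.var 26 = h) (h0 : 0 < h) (hM : 2 * h ∣ 2 ^ m) (huM : u < 2 ^ m)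
    (hX : ∀ i < 2 ^ m, |s.arr 7 i| ≤ D ∧ |s.arr 8 i| ≤ D)
    (hT : ∀ i < N / 2, |s.arr 11 i| ≤ D ∧ |s.arr 12 i| ≤ D)
    (hD : (2 : ℤ) ^ m + 2 ≤ D) (hSD : (N : ℤ) ^ 20 ≤ D) (hB : 8 * (D * D) ≤ B) :
    Tri B inverseBody s 600 (fun s' =>
      (∀ i, s'.arr 9 i = if i = u then
        ((s.arr 7 (low h u) + (1 - 2 * (half h u : ℤ)) * s.arr 7 (low h u + h)) *
          ((1 - (half h u : ℤ)) * N ^ 20 + half h u * s.arr 11 (u / (2 * h))) -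
        (s.arr 8 (low h u) + (1 - 2 * (half h u : ℤ)) * s.arr 8 (low h u + h)) *
          -(half h u * s.arr 12 (u / (2 * h)))).tdiv (N ^ 20) else s.arr 9 i) ∧
      (∀ i, s'.arr 10 i = if i = u then
        ((s.arr 7 (low h u) + (1 - 2 * (half h u : ℤ)) * s.arr 7 (low h u + h)) *
          -(half h u * s.arr 12 (u / (2 * h))) +
        (s.arr 8 (low h u) + (1 - 2 * (half h u : ℤ)) * s.arr 8 (low h u + h)) *
          ((1 - (half h u : ℤ)) * N ^ 20 + half h u * s.arr 11 (u / (2 * h)))).tdiv (N ^ 20)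
        else s.arr 10 i)) := by
  obtain ⟨l₁, l₂⟩ := low_lt h0 hM huM
  have l₃ : u / (2 * h) < N / 2 := by
    have : 2 ^ m / (2 * h) ≤ N / 2 :=
      (Nat.div_le_div_right hs.len_le).trans (Nat.div_le_div_left (by omega) two_pos)
    omega
  have hM' : 2 * h ≤ 2 ^ m := Nat.le_of_dvd (by positivity) hM
  zify at hM' huM l₁
  have D0 : 0 ≤ D * D := mul_self_nonneg D
  have DD : 2 * D ≤ D * D := by nlinarith
  have e := eval_blockVars hu hh
  have hsafe := safe_blockVars (B := B) hu hh (by linarith)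
  have a₁ := hX _ ((Nat.le_add_right _ h).trans_lt (by exact_mod_cast l₁))
  have a₂ := hX (low h u + h) (by exact_mod_cast l₁)
  have a₃ := hT _ l₃
  have hS := hs.scale
  have hS0 : |(N : ℤ) ^ 20| ≤ D := by rwa [abs_of_nonneg (by positivity)]
  have hr : |1 - 2 * (half h u : ℤ)| ≤ 1 := by rcases half_eq h u with h | h <;> simp [h]
  have hr₁ : |1 - (half h u : ℤ)| ≤ 1 := by rcases half_eq h u with h | h <;> simp [h]
  have hr₂ : |(half h u : ℤ)| ≤ 1 := by rcases half_eq h u with h | h <;> simp [h]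
  have hr' := half_le h u
  have m₁ := abs_mul_le_of_le hr a₂.1
  have m₂ := abs_mul_le_of_le hr a₂.2
  have m₃ := abs_add_le_of_le a₁.1 m₁
  have m₄ := abs_add_le_of_le a₁.2 m₂
  have m₅ := abs_mul_le_of_le hr₁ hS0
  have m₆ := abs_mul_le_of_le hr₂ a₃.1
  have m₇ := abs_mul_le_of_le hr₂ a₃.2
  have m₈ := abs_add_le_of_le m₅ m₆
  have m₉ := m₇
  rw [← abs_neg] at m₉
  have n₁ := abs_mul_le_of_le m₃ m₈
  have n₂ := abs_mul_le_of_le m₄ m₉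
  have n₃ := abs_mul_le_of_le m₃ m₉
  have n₄ := abs_mul_le_of_le m₄ m₈
  have n₅ := abs_sub_le_of_le n₁ n₂
  have n₆ := abs_add_le_of_le n₃ n₄
  have hq : ((low h u : ℤ) + h).toNat = low h u + h := by omega
  generalize u / (2 * h) = b at *
  refine ⟨⟨hsafe, ?_⟩, ?_, ?_⟩
  · rw [e]
    simp only [Cmd.Safe, Cmd.eval, Ex.safe_add, Ex.safe_sub, Ex.safe_mul, Ex.safe_div, Ex.safe_num,
      Ex.safe_var, Ex.safe_get, Ex.eval_add, Ex.eval_sub, Ex.eval_mul, Ex.eval_div, Ex.eval_num,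
      Ex.eval_var, Ex.eval_get, St.setVar_var, St.setVar_arr, Nat.reduceEqDiff, reduceIte, hu, hh,
      hS, hq, Int.toNat_natCast, Nat.cast_ofNat, Nat.cast_one, Nat.cast_zero, zero_sub, true_and,
      St.setArr_var]
    and_intros <;> first | trivial | omega | linarith | (apply abs_le_of_nonneg <;> linarith)
  · simp [Cmd.cost, inverseBody, blockVars]
  · rw [inverseBody, Cmd.eval, e]
    simp [Cmd.eval, hu, hh, hS, hq]

end IntProg

namespace IntProg

open FixedFFT

theorem inverseLevel_tri {B : ℤ} {N m : ℕ} {s : St} {h : ℕ} {e C : ℝ} {Z : ℕ → ℂ}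
    (hs : Setting N m s) (hh : s.var 26 = h) (h0 : 0 < h) (hM : 2 * h ∣ 2 ^ m)
    (hX : Close ((N : ℤ) ^ 20) (2 ^ m) e (s.arr 7) (s.arr 8) Z) (hZ : ∀ u, ‖Z u‖ ≤ C)
    (hD : (N : ℝ) ^ 20 * C + e ≤ (N : ℝ) ^ 26) (hB : (N : ℤ) ^ 60 ≤ B) :
    Tri B inverseLevel s (1000 * 2 ^ m) (fun s' =>
      Close ((N : ℤ) ^ 20) (2 ^ m) (4 * e + 2 * C * N ^ 6 + 2) (s'.arr 7) (s'.arr 8)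
        (ilevel h Z)) := by
  have hle := hs.le_bound hB
  have hN : (1 : ℤ) ≤ N := by exact_mod_cast (by have := hs.two_le; omega : 1 ≤ N)
  have hfill := Tri.loop_fill (B := B) (v := 25) (e := V 20) (c := inverseBody) (s := s) (T := 600)
    (n := 2 ^ m) 9 10
    (fun u => ((s.arr 7 (low h u) + (1 - 2 * (half h u : ℤ)) * s.arr 7 (low h u + h)) *
          ((1 - (half h u : ℤ)) * N ^ 20 + half h u * s.arr 11 (u / (2 * h))) -
        (s.arr 8 (low h u) + (1 - 2 * (half h u : ℤ)) * s.arr 8 (low h u + h)) *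
          -(half h u * s.arr 12 (u / (2 * h)))).tdiv (N ^ 20))
    (fun u => ((s.arr 7 (low h u) + (1 - 2 * (half h u : ℤ)) * s.arr 7 (low h u + h)) *
          -(half h u * s.arr 12 (u / (2 * h))) +
        (s.arr 8 (low h u) + (1 - 2 * (half h u : ℤ)) * s.arr 8 (low h u + h)) *
          ((1 - (half h u : ℤ)) * N ^ 20 + half h u * s.arr 11 (u / (2 * h)))).tdiv (N ^ 20))
    (by simp) (by simpa using hs.len) (fun u hu s' hf _ _ => by
      have e7 := hf.arr 7 rfl
      have e8 := hf.arr 8 rfl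
      have e11 := hf.arr 11 rfl
      have e12 := hf.arr 12 rfl
      have hs' := hs.frame hf
      have := inverseBody_tri (B := B) (D := (N : ℤ) ^ 26) (s := s'.setVar 25 (u : ℕ)) (u := u)
        (h := h) (hs'.congr rfl rfl rfl rfl rfl) (by simp)
        (by simpa [hh] using hf.var 26 rfl) h0 hM hu
        (fun i hi => by
          rw [St.setVar_arr, e7, e8]
          exact hX.abs_le hs.scale_pos hZ hi (by push_cast; exact hD))
        (fun i hi => hs'.abs_table_le hi) hs.pow_le (pow_le_pow_right₀ hN (by norm_num))
        (hs.eight_mul_le hB)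
      simpa only [St.setVar_arr, e7, e8, e11, e12] using this)
  refine hfill.then (T₂ := 60 * 2 ^ m + 10) (fun s' hs' =>
    (copyBack_tri (M := 2 ^ m) ?_).mono le_rfl fun s'' hs'' => ?_) ?_
  · rw [hs'.2.var 20 rfl, hs.len]
  · refine Close.ilevel hs.scale_pos h0 hM hX (hs.table.mono ?_ le_rfl) hZ ?_ (by positivity)
      fun u hu => ?_
    · exact (Nat.div_le_div_right hs.len_le).trans (Nat.div_le_div_left (by omega) two_pos)
    · push_cast
      exact pow_le_pow_right₀ (by exact_mod_cast hN) (by norm_num)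
    · rw [hs''.1.1 u hu, hs''.1.2 u hu, hs'.1.1 u hu, hs'.1.2.1 u hu]
      exact ⟨rfl, rfl⟩
  · have : 1 ≤ 2 ^ m := Nat.one_le_two_pow
    simp only [Ex.size_var]
    omega

/-- The error obeys `e ↦ 4 * e + 8 * N ^ 3 * N ^ 6 + 2`, and the additive part is at most `N ^ 15`,
that is, at most the current bound. A growth factor of five would do; eight is convenient because `8
^ m ≤ N ^ 3`. -/
theorem inverse_tri {B : ℤ} {N m : ℕ} {s : St} {W : ℕ → ℂ} (hs : Setting N m s)
    (hX : Close ((N : ℤ) ^ 20) (2 ^ m) ((N : ℝ) ^ 15) (s.arr 7) (s.arr 8) W)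
    (hW : ∀ u, ‖W u‖ ≤ 4 * N ^ 2) (hB : (N : ℤ) ^ 60 ≤ B) :
    Tri B inverse s (1100 * (2 ^ m * (m + 1))) (fun s' =>
      Close ((N : ℤ) ^ 20) (2 ^ m) ((N : ℝ) ^ 18) (s'.arr 7) (s'.arr 8) (istage W m)) := by
  have hle := hs.le_bound hB
  have hpos : (0 : ℤ) < 2 ^ m := by positivity
  have h2 : (2 : ℝ) ≤ N := by exact_mod_cast hs.two_le
  have hMN : (2 : ℝ) ^ m ≤ N := by exact_mod_cast hs.len_le
  have hmono : ∀ l ≤ m, ∀ u, ‖istage W l u‖ ≤ 4 * N ^ 3 := fun l hl u => by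
    refine (norm_istage_le hW l u).trans ?_
    have : (2 : ℝ) ^ l ≤ N := (pow_le_pow_right₀ (by norm_num) hl).trans hMN
    have h3 : 4 * (N : ℝ) ^ 3 = N * (4 * N ^ 2) := by ring
    rw [h3]
    gcongr
  have h8 : ∀ l ≤ m, (8 : ℝ) ^ l ≤ N ^ 3 := fun l hl => by
    have : (2 : ℝ) ^ l ≤ N := (pow_le_pow_right₀ (by norm_num) hl).trans hMN
    rw [show (8 : ℝ) = 2 ^ 3 by norm_num, ← pow_mul, mul_comm, pow_mul]
    exact pow_le_pow_left₀ (by positivity) this 3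
  have herr : ∀ l ≤ m, (8 : ℝ) ^ l * N ^ 15 ≤ N ^ 18 := fun l hl => by
    have : (N : ℝ) ^ 18 = N ^ 3 * N ^ 15 := by ring
    rw [this]
    exact mul_le_mul_of_nonneg_right (h8 l hl) (by positivity)
  refine (Tri.assign (by simp; linarith) ?_).then (Q := fun s' => s' = s.setVar 26 (1 : ℕ))
    (T₂ := m * (1000 * 2 ^ m + 37) + 6) (fun s' hs' => ?_) ?_
  · simp
  · subst hs'
    refine (Tri.loop_frame (T := 1000 * 2 ^ m + 30) (n := m) (fun l s' =>
      s'.var 26 = (2 ^ l : ℕ) ∧ Close ((N : ℤ) ^ 20) (2 ^ m)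
        (8 ^ l * N ^ 15) (s'.arr 7) (s'.arr 8) (istage W l)) (by simp)
      (by simpa using hs.log) ?_ ?_).mono ?_ ?_
    · refine ⟨by simp, hX.mono le_rfl ?_⟩
      simp
    · intro l hl s' hs' hf
      obtain ⟨hv, hc⟩ := hs'
      have hset : Setting N m s' :=
        (hs.congr (s' := s.setVar 26 (1 : ℕ)) (by simp) (by simp) (by simp) rfl rfl).frame hf
      have hlm : (2 : ℤ) ^ (l + 1) ≤ 2 ^ m := pow_le_pow_right₀ (by norm_num) hl
      have hl0 : (0 : ℤ) < 2 ^ l := by positivity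
      refine (inverseLevel_tri (B := B) (s := s'.setVar 24 l) (h := 2 ^ l) (C := 4 * N ^ 3)
        (Z := istage W l) (hset.congr (by simp) (by simp) (by simp) rfl rfl) (by simpa using hv)
        (by positivity) (by rw [← pow_succ']; exact pow_dvd_pow 2 hl) hc (hmono l hl.le) ?_
        hB).frame.then (T₂ := 20) (fun s₂ h₂ => ?_) ?_
      · have := herr l hl.le
        have h26 : (N : ℝ) ^ 26 = N ^ 20 * N ^ 6 := by ring
        have h23 : (N : ℝ) ^ 18 ≤ N ^ 20 := pow_le_pow_right₀ (by linarith) (by norm_num)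
        have hN6 : (N : ℝ) ^ 6 = N ^ 3 * N ^ 3 := by ring
        have hN3 : (2 : ℝ) ^ 3 ≤ (N : ℝ) ^ 3 := pow_le_pow_left₀ (by norm_num) h2 3
        have : (0 : ℝ) ≤ N ^ 20 := by positivity
        have h6 : 4 * (N : ℝ) ^ 3 + 1 ≤ N ^ 6 := by nlinarith
        nlinarith
      · have hv₂ : s₂.var 26 = (2 ^ l : ℕ) := by
          rw [h₂.2.var 26 rfl]
          simpa using hv
        have hv₃ : (2 : ℤ) * (2 ^ l : ℕ) = 2 ^ (l + 1) := by push_cast; ring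
        refine (Tri.assign ?_ ⟨?_, h₂.1.mono le_rfl ?_⟩).mono ?_ fun _ h => h
        · simp only [Ex.safe_mul, Ex.safe_num, Ex.safe_var, Ex.eval_num, Ex.eval_var, hv₂]
          push_cast at hv₃ ⊢
          rw [hv₃, abs_of_nonneg (by positivity)]
          refine ⟨?_, trivial, ?_⟩ <;> linarith
        · simp
        · simp [hv₂, pow_succ, mul_comm]
        · have h1 : (1 : ℝ) ≤ 8 ^ l := one_le_pow₀ (by norm_num)
          have h9 : (N : ℝ) ^ 3 * N ^ 6 ≤ N ^ 15 := by
            rw [← pow_add]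
            exact pow_le_pow_right₀ (by linarith) (by norm_num)
          have hN6 : (N : ℝ) ^ 15 = N ^ 14 * N := by ring
          have hN3 : (2 : ℝ) ^ 14 ≤ (N : ℝ) ^ 14 := pow_le_pow_left₀ (by norm_num) h2 14
          have h0 : (0 : ℝ) ≤ N ^ 15 := by positivity
          have hN4 : (N : ℝ) ^ 15 = N ^ 9 * N ^ 6 := by ring
          have hN5 : (2 : ℝ) ^ 6 ≤ (N : ℝ) ^ 6 := pow_le_pow_left₀ (by norm_num) h2 6
          have h99 : 8 * ((N : ℝ) ^ 3 * N ^ 6) + 2 ≤ N ^ 15 := by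
            have : (1 : ℝ) ≤ N ^ 9 := one_le_pow₀ (by linarith)
            nlinarith
          have hmul : (N : ℝ) ^ 15 ≤ 8 ^ l * N ^ 15 := by nlinarith
          rw [pow_succ (8 : ℝ)]
          nlinarith
      · omega
    · simp
    · intro s' hs'
      exact hs'.1.2.mono le_rfl (herr m le_rfl)
  · have : 1 ≤ 2 ^ m := Nat.one_le_two_pow
    simp only [Ex.size_num]
    nlinarith

/-- The exact imaginary parts, scaled, are multiples of `2 * (S * 2 ^ m)` with `S = N ^ 20`. The
error `N ^ 18` is less than half this gap, so adding half the gap and dividing finds the multiple `c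
u`. -/
theorem extract_tri {B : ℤ} {N m : ℕ} {s : St} {Z : ℕ → ℂ} {c : ℕ → ℕ} (hs : Setting N m s)
    (hX : Close ((N : ℤ) ^ 20) (2 ^ m) ((N : ℝ) ^ 18) (s.arr 7) (s.arr 8) Z)
    (hZ : ∀ u, ‖Z u‖ ≤ 4 * N ^ 3) (hc : ∀ u < 2 ^ m, (Z u).im = 2 ^ m * (2 * c u))
    (hB : (N : ℤ) ^ 60 ≤ B) :
    Tri B extract s (300 * 2 ^ m) (fun s' => ∀ u < 2 ^ m, s'.arr 6 u = (c u % 2 : ℕ)) := by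
  have h2 : (2 : ℝ) ≤ N := by exact_mod_cast hs.two_le
  have hN : (1 : ℝ) ≤ N := by linarith
  have h8 := hs.eight_mul_le hB
  have hX' : ∀ i < 2 ^ m, |s.arr 7 i| ≤ (N : ℤ) ^ 26 ∧ |s.arr 8 i| ≤ (N : ℤ) ^ 26 := fun i hi => by
    refine hX.abs_le hs.scale_pos hZ hi ?_
    push_cast
    have h26 : (N : ℝ) ^ 26 = N ^ 20 * N ^ 6 := by ring
    have h23 : (N : ℝ) ^ 18 ≤ N ^ 20 := pow_le_pow_right₀ (by linarith) (by norm_num)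
    have hN6 : (N : ℝ) ^ 6 = N ^ 3 * N ^ 3 := by ring
    have hN3 : (2 : ℝ) ^ 3 ≤ (N : ℝ) ^ 3 := pow_le_pow_left₀ (by norm_num) h2 3
    have : (0 : ℝ) ≤ N ^ 20 := by positivity
    have h6 : 4 * (N : ℝ) ^ 3 + 1 ≤ N ^ 6 := by nlinarith
    nlinarith
  have hZN : (1 : ℤ) ≤ N := by exact_mod_cast (by have := hs.two_le; omega : 1 ≤ N)
  have hSM : (N : ℤ) ^ 20 * 2 ^ m ≤ N ^ 26 := by
    have h1 : (2 : ℤ) ^ m ≤ N := by exact_mod_cast hs.len_le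
    calc (N : ℤ) ^ 20 * 2 ^ m ≤ (N : ℤ) ^ 20 * (N : ℤ) := by gcongr
      _ = (N : ℤ) ^ 21 := by ring
      _ ≤ (N : ℤ) ^ 26 := pow_le_pow_right₀ hZN (by norm_num)
  have hSM0 : 0 < (N : ℤ) ^ 20 * 2 ^ m := mul_pos hs.scale_pos (by positivity)
  have hround : ∀ u < 2 ^ m,
      (s.arr 8 u + (N : ℤ) ^ 20 * 2 ^ m).tdiv (2 * ((N : ℤ) ^ 20 * 2 ^ m)) = (c u : ℤ) := by
    intro u hu
    have h₁ := (Complex.abs_im_le_norm _).trans (hX u hu)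
    have h₂ : (cx (s.arr 7 u) (s.arr 8 u) - ((N : ℤ) ^ 20 : ℤ) * Z u).im =
        s.arr 8 u - N ^ 20 * (2 ^ m * (2 * c u)) := by
      rw [Complex.sub_im, Complex.mul_im, Complex.intCast_im, Complex.intCast_re, hc u hu]
      simp [cx]
    rw [h₂] at h₁
    have h₃ : (N : ℝ) ^ 18 < N ^ 20 * 2 ^ m := by
      have h₄ : (N : ℝ) ^ 20 = N ^ 18 * N ^ 2 := by ring
      have h₅ : (2 : ℝ) ^ 2 ≤ (N : ℝ) ^ 2 := pow_le_pow_left₀ (by norm_num) h2 2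
      have h₆ : (1 : ℝ) ≤ 2 ^ m := one_le_pow₀ (by norm_num)
      have h₇ : (0 : ℝ) < N ^ 18 := by positivity
      have h₈ : (N : ℝ) ^ 20 ≤ N ^ 20 * 2 ^ m := le_mul_of_one_le_right (by positivity) h₆
      nlinarith
    have h₄ : |s.arr 8 u - (N : ℤ) ^ 20 * (2 ^ m * (2 * (c u : ℤ)))| < (N : ℤ) ^ 20 * 2 ^ m := by
      have := lt_of_le_of_lt h₁ h₃
      exact_mod_cast this
    rw [abs_lt] at h₄
    have e : s.arr 8 u + (N : ℤ) ^ 20 * 2 ^ m =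
        (s.arr 8 u - (N : ℤ) ^ 20 * (2 ^ m * (2 * (c u : ℤ))) + (N : ℤ) ^ 20 * 2 ^ m) +
          2 * ((N : ℤ) ^ 20 * 2 ^ m) * (c u : ℤ) := by ring
    generalize s.arr 8 u - (N : ℤ) ^ 20 * (2 ^ m * (2 * (c u : ℤ))) = y at *
    generalize (N : ℤ) ^ 20 * 2 ^ m = z at *
    have hcz : 0 ≤ 2 * z * (c u : ℤ) := by positivity
    rw [e, Int.tdiv_eq_ediv_of_nonneg (by linarith), Int.add_mul_ediv_left _ _ (by linarith),
      Int.ediv_eq_zero_of_lt (by linarith) (by linarith), zero_add]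
  refine (Tri.loop_fill (T := 250) (n := 2 ^ m) 6 6
    (fun u => (c u % 2 : ℕ)) (fun u => (c u % 2 : ℕ))
    (by simp) (by simpa using hs.len) fun u hu s' hf h6 _ => ?_).mono ?_ fun s' hs' u hu =>
      hs'.1.1 u hu
  · have e8 : s'.arr 8 = s.arr 8 := hf.arr 8 rfl
    have hset := hs.frame hf
    have hS := hset.scale
    have hlen : s'.var 20 = 2 ^ m := by simpa using hset.len
    have hr := hround u hu
    have hb := (hX' u hu).2
    have h52 : (N : ℤ) ^ 26 ≤ N ^ 26 * N ^ 26 := by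
      have : (1 : ℤ) ≤ N ^ 26 := one_le_pow₀ hZN
      nlinarith
    have hpow := hs.le_bound hB
    have hpos : (0 : ℤ) < 2 ^ m := by positivity
    have h1 := abs_add_le_of_le hb (abs_le_of_nonneg hSM0.le hSM)
    have habs : |(N : ℤ) ^ 20 * 2 ^ m| ≤ (N : ℤ) ^ 26 := abs_le_of_nonneg hSM0.le hSM
    have hcB : (c u : ℤ) ≤ B := by
      have := abs_tdiv_le_of_le (y := 2 * ((N : ℤ) ^ 20 * 2 ^ m)) h1
      rw [hr, Nat.abs_cast] at this
      linarith
    have h2' : (2 : ℤ).natAbs = 2 := rfl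
    have hdiv : (c u : ℤ).tdiv 2 = (c u / 2 : ℕ) := (Int.ofNat_tdiv _ _).symm
    have hmod : (c u : ℤ) - 2 * (c u / 2 : ℕ) = (c u % 2 : ℕ) := by omega
    generalize (N : ℤ) ^ 20 = S at *
    generalize (2 : ℤ) ^ m = M at *
    refine ⟨?_, ?_, ?_⟩
    · simp only [Cmd.Safe, Cmd.eval, Ex.safe_add, Ex.safe_sub, Ex.safe_mul, Ex.safe_div, Ex.safe_num,
        Ex.safe_var, Ex.safe_get, Ex.eval_add, Ex.eval_mul, Ex.eval_div, Ex.eval_num,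
        Ex.eval_var, Ex.eval_get, St.setVar_var, St.setVar_arr, Nat.reduceEqDiff, reduceIte, hS, e8,
        hlen, Int.toNat_natCast, Nat.cast_ofNat, true_and, hr, hdiv, hmod]
      and_intros <;> first | trivial | omega | linarith | (apply abs_le_of_nonneg <;> linarith)
    · simp [Cmd.cost]
    · simp only [Cmd.eval, Ex.eval_add, Ex.eval_sub, Ex.eval_mul, Ex.eval_div, Ex.eval_num,
        Ex.eval_var, Ex.eval_get, St.setVar_var, St.setVar_arr, Nat.reduceEqDiff, reduceIte, hS, e8,
        hlen, Int.toNat_natCast, Nat.cast_ofNat, hr, hdiv, hmod, St.setArr_arr, true_and]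
      exact ⟨fun _ => trivial, fun _ => trivial⟩
  · have : 1 ≤ 2 ^ m := Nat.one_le_two_pow
    simp only [Ex.size_var]
    omega

end IntProg

/-! ### Multiplication of polynomials over `ℤ₂` -/

namespace IntProg

open FixedFFT Polynomial

theorem mulInit_tri {B : ℤ} {N m : ℕ} {s : St} {a b : ℕ → ℕ} (hs : Setting N m s)
    (ha : ∀ i < 2 ^ m, s.arr 4 i = (a i : ℤ) ∧ a i ≤ 1)
    (hb : ∀ i < 2 ^ m, s.arr 5 i = (b i : ℤ) ∧ b i ≤ 1) (hB : (N : ℤ) ^ 60 ≤ B) :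
    Tri B mulInit s (100 * 2 ^ m) (fun s' => Close ((N : ℤ) ^ 20) (2 ^ m) 0 (s'.arr 7) (s'.arr 8)
      (fun i => (a i : ℂ) + Complex.I * b i)) := by
  have hpos := hs.scale_pos
  have hN : (1 : ℤ) ≤ N := by exact_mod_cast (by have := hs.two_le; omega : 1 ≤ N)
  have h20 : (N : ℤ) ^ 20 ≤ B := (pow_le_pow_right₀ hN (by norm_num)).trans hB
  refine (Tri.loop_fill (T := 80) (n := 2 ^ m) 7 8 (fun u => s.arr 4 u * (N : ℤ) ^ 20)
    (fun u => s.arr 5 u * (N : ℤ) ^ 20) (by simp) (by simpa using hs.len)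
    fun u hu s' hf h7 h8 => ⟨?_, ?_, ?_⟩).mono ?_ fun s' hs' u hu => ?_
  · have h4 := hf.arr 4 rfl
    have h5 := hf.arr 5 rfl
    have hS := (hs.frame hf).scale
    have bound : ∀ x : ℕ, x ≤ 1 → |(x : ℤ) * (N : ℤ) ^ 20| ≤ B := fun x hx => by
      rw [abs_of_nonneg (by positivity)]
      have : (x : ℤ) ≤ 1 := by exact_mod_cast hx
      nlinarith
    have b₁ := bound _ (ha u hu).2
    have b₂ := bound _ (hb u hu).2
    rw [← (ha u hu).1] at b₁
    rw [← (hb u hu).1] at b₂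
    simp [Cmd.Safe, Cmd.eval, h4, h5, hS, -abs_mul]
    exact ⟨b₁, b₂⟩
  · simp [Cmd.cost]
  · have h4 := hf.arr 4 rfl
    have h5 := hf.arr 5 rfl
    have hS := (hs.frame hf).scale
    simp [Cmd.eval, h4, h5, hS]
  · have : 1 ≤ 2 ^ m := Nat.one_le_two_pow
    simp only [Ex.size_var]
    omega
  · rw [hs'.1.1 u hu, hs'.1.2.1 u hu, (ha u hu).1, (hb u hu).1]
    have : cx ((a u : ℤ) * (N : ℤ) ^ 20) ((b u : ℤ) * (N : ℤ) ^ 20) =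
        (((N : ℤ) ^ 20 : ℤ) : ℂ) * ((a u : ℂ) + Complex.I * b u) := by
      rw [show (a u : ℂ) + Complex.I * b u = cx (a u : ℤ) (b u : ℤ) by
        apply Complex.ext <;> simp [cx], int_mul_cx, mul_comm, mul_comm (b u : ℤ)]
    rw [this, sub_self, norm_zero]

/-- The lift of a polynomial over `ℤ₂` with coefficients `0` and `1`. -/
noncomputable def bitLift (p : (ZMod 2)[X]) : ℕ[X] :=
  ∑ i ∈ p.support, monomial i (p.coeff i).val

theorem coeff_bitLift (p : (ZMod 2)[X]) (i : ℕ) : (bitLift p).coeff i = (p.coeff i).val := by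
  simp only [bitLift, finsetSum_coeff, coeff_monomial]
  rw [Finset.sum_ite_eq' p.support i]
  split_ifs with h
  · rfl
  · rw [notMem_support_iff.1 h]; rfl

theorem map_bitLift (p : (ZMod 2)[X]) : (bitLift p).map (Nat.castRingHom (ZMod 2)) = p := by
  ext i
  simp [coeff_map, coeff_bitLift]

theorem natDegree_bitLift_le (p : (ZMod 2)[X]) : (bitLift p).natDegree ≤ p.natDegree := by
  refine natDegree_le_iff_coeff_eq_zero.2 fun i hi => ?_
  rw [coeff_bitLift, coeff_eq_zero_of_natDegree_lt hi]
  rfl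

theorem coeff_bitLift_mul (p q : (ZMod 2)[X]) (u : ℕ) :
    (bitLift p * bitLift q).coeff u % 2 = ((p * q).coeff u).val := by
  rw [← ZMod.val_natCast]
  congr 1
  conv_rhs => rw [← map_bitLift p, ← map_bitLift q, ← Polynomial.map_mul, coeff_map]
  rfl

/-- The array `a` holds the first `M` coefficients of `p`. -/
def Holds (M : ℕ) (a : ℕ → ℤ) (p : (ZMod 2)[X]) : Prop := ∀ i < M, a i = ((p.coeff i).val : ℤ)

theorem Holds.mono {M M' : ℕ} {a : ℕ → ℤ} {p : (ZMod 2)[X]} (h : Holds M a p) (hM : M' ≤ M) :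
    Holds M' a p := fun i hi => h i (hi.trans_le hM)

theorem val_le_one (x : ZMod 2) : x.val ≤ 1 := Nat.le_of_lt_succ x.val_lt

/-- The lifts of both factors to coefficients `0` and `1` are packed into one complex polynomial,
one as real part and one as imaginary part. The imaginary part of its square is twice the product of
the lifts, so a product costs one forward and one inverse transform. -/
theorem mulProg_tri {B : ℤ} {N m : ℕ} {s : St} {p q : (ZMod 2)[X]} (hs : Setting N m s)
    (hp : Holds (2 ^ m) (s.arr 4) p) (hq : Holds (2 ^ m) (s.arr 5) q)
    (hdp : 2 * p.natDegree < 2 ^ m) (hdq : 2 * q.natDegree < 2 ^ m) (hB : (N : ℤ) ^ 60 ≤ B) :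
    Tri B mulProg s (2900 * (2 ^ m * (m + 1))) (fun s' => Holds (2 ^ m) (s'.arr 6) (p * q) ∧
      Frame mulProg s s') := by
  have h2 : (2 : ℝ) ≤ N := by exact_mod_cast hs.two_le
  have hMN : (2 : ℝ) ^ m ≤ N := by exact_mod_cast hs.len_le
  set F : ℂ[X] := (bitLift p).map (Nat.castRingHom ℂ) +
    Polynomial.C Complex.I * (bitLift q).map (Nat.castRingHom ℂ) with hF
  have hFc : (fun i => (((p.coeff i).val : ℕ) : ℂ) + Complex.I * ((q.coeff i).val : ℕ)) =
      F.coeff := by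
    funext i
    simp [hF, coeff_map, coeff_bitLift]
  have hFd : 2 * F.natDegree < 2 ^ m := by
    have h₁ : F.natDegree ≤ max p.natDegree q.natDegree := by
      refine (natDegree_add_le _ _).trans (max_le_max ?_ ?_)
      · exact natDegree_map_le.trans (natDegree_bitLift_le p)
      · exact (natDegree_C_mul_le _ _).trans (natDegree_map_le.trans (natDegree_bitLift_le q))
    rcases max_cases p.natDegree q.natDegree with h | h <;> omega
  have hFn : ∀ i, ‖F.coeff i‖ ≤ 2 := fun i => by
    rw [← hFc]
    have hn : ∀ x : ZMod 2, ‖((x.val : ℕ) : ℂ)‖ ≤ 1 := fun x => by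
      rw [Complex.norm_natCast]
      exact_mod_cast val_le_one x
    refine (norm_add_le _ _).trans ?_
    rw [norm_mul, Complex.norm_I, one_mul]
    linarith [hn (p.coeff i), hn (q.coeff i)]
  have hFF : ∀ u, ((F * F).coeff u).im = 2 * ((bitLift p * bitLift q).coeff u : ℕ) := fun u => by
    have : F * F = ((bitLift p * bitLift p).map (Nat.castRingHom ℂ) -
        (bitLift q * bitLift q).map (Nat.castRingHom ℂ)) +
        Polynomial.C (2 * Complex.I) * (bitLift p * bitLift q).map (Nat.castRingHom ℂ) := by
      simp only [hF, Polynomial.map_mul, Polynomial.C_mul]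
      have hI : (Polynomial.C Complex.I : ℂ[X]) * Polynomial.C Complex.I = -1 := by
        rw [← Polynomial.C_mul, Complex.I_mul_I]
        simp
      have h2 : (Polynomial.C 2 : ℂ[X]) = 2 := rfl
      rw [h2]
      linear_combination ((bitLift q).map (Nat.castRingHom ℂ) *
        (bitLift q).map (Nat.castRingHom ℂ)) * hI
    rw [this, coeff_add, coeff_sub, coeff_C_mul, coeff_map, coeff_map, coeff_map]
    simp
  have hst : ∀ u, ‖stage m F.coeff m u‖ ≤ 2 * N := fun u => by
    refine (norm_stage_le hFn m u).trans ?_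
    linarith
  have hsq : ∀ u, ‖stage m F.coeff m u * stage m F.coeff m u‖ ≤ 4 * (N : ℝ) ^ 2 := fun u => by
    rw [norm_mul]
    have := mul_le_mul (hst u) (hst u) (norm_nonneg _) (by positivity)
    linarith
  have hist : ∀ u, ‖istage (fun i => stage m F.coeff m i * stage m F.coeff m i) m u‖ ≤
      4 * (N : ℝ) ^ 3 := fun u => by
    refine (norm_istage_le hsq m u).trans ?_
    have : 4 * (N : ℝ) ^ 3 = N * (4 * N ^ 2) := by ring
    rw [this]
    gcongr
  refine (Tri.frame ?_).mono le_rfl fun s' h => h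
  have h1 : 2 ^ m ≤ 2 ^ m * (m + 1) := Nat.le_mul_of_pos_right _ (by omega)
  refine (mulInit_tri hs (fun i hi => ⟨hp i hi, val_le_one _⟩)
    (fun i hi => ⟨hq i hi, val_le_one _⟩) hB).frame.then
    (T₂ := 1100 * (2 ^ m * (m + 1)) + (300 * 2 ^ m + (1100 * (2 ^ m * (m + 1)) + 300 * 2 ^ m)))
    (fun s₁ h₁ => ?_) (by omega)
  have t₁ := hs.frame h₁.2
  have c₁ := h₁.1
  rw [hFc] at c₁
  refine (forward_tri t₁ c₁ hFn hB).frame.then (fun s₂ h₂ => ?_) le_rfl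
  have t₂ := t₁.frame h₂.2
  refine (squareAll_tri t₂ h₂.1 hst hB).frame.then (fun s₃ h₃ => ?_) le_rfl
  have t₃ := t₂.frame h₃.2
  refine (inverse_tri t₃ h₃.1 hsq hB).frame.then (fun s₄ h₄ => ?_) le_rfl
  have t₄ := t₃.frame h₄.2
  refine (extract_tri (c := (bitLift p * bitLift q).coeff) t₄ h₄.1 hist (fun u hu => ?_) hB).mono
    le_rfl fun s₅ h₅ u hu => ?_
  · rw [istage_sq F hFd u hu]
    have : (2 : ℂ) ^ m = ((2 ^ m : ℝ) : ℂ) := by push_cast; rfl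
    rw [this, Complex.im_ofReal_mul, hFF]
  · rw [h₅ u hu, coeff_bitLift_mul]

end IntProg

namespace IntProg

open FixedFFT

/-! ### The table of roots

Variable `7` is `k`, and the table gets `2 ^ k` entries. -/

/-- `S := (2 ^ (k + 1)) ^ 20` -/
def scaleInit : Cmd := .assign 8 1 ;; .loop 24 (20 * (V 7 + 1)) (.assign 8 (2 * V 8))

/-- Multiplies the first half of the table by the current root. -/
def doubleTable : Cmd :=
  .loop 25 (V 28)
    (.store 11 (V 28 + V 25) ((.get 11 (V 25) * V 26 - .get 12 (V 25) * V 27) / V 8) ;;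
     .store 12 (V 28 + V 25) ((.get 11 (V 25) * V 27 + .get 12 (V 25) * V 26) / V 8))

def sqrtStep : Cmd :=
  .assign 32 (V 32 / 2) ;;
    .ite (V 30 + 1 - (V 31 + V 32) * (V 31 + V 32)) (.assign 31 (V 31 + V 32)) (.assign 31 (V 31))

def sqrtLoop : Cmd := .loop 25 (20 * (V 7 + 1) + 1) sqrtStep

/-- Halves the angle of the current root. -/
def halve : Cmd :=
  .assign 30 (V 8 * (V 8 + V 26) / 2) ;; .assign 31 0 ;; .assign 32 (2 * V 8) ;; sqrtLoop ;;
    .assign 27 (V 27 * V 8 / (2 * V 31)) ;; .assign 26 (V 31)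

def rootTable : Cmd :=
  scaleInit ;; .assign 26 0 ;; .assign 27 (V 8) ;; .assign 28 1 ;; .store 11 0 (V 8) ;;
    .store 12 0 0 ;; .loop 24 (V 7) (doubleTable ;; .assign 28 (2 * V 28) ;; halve)

/-- The squares `r ^ 2` and `(S * x) ^ 2` differ by at most `S * E / 2 + 2 * r + 2`. Division by `r
+ S * x ≥ r + 7 / 10 * S` leaves at most `E + 3`. The bound `7 / 10` is available because the cosine
of an angle up to `π / 4` is at least `√2 / 2`. -/
theorem abs_sqrt_sub_le {S c r z x E : ℝ} (hS : 10 ≤ S) (hE : |c - S * z| ≤ E)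
    (hx : 7 / 10 ≤ x) (hxz : x ^ 2 = (1 + z) / 2) (hr : 0 ≤ r)
    (h₁ : r * r ≤ S * (S + c) / 2) (h₂ : S * (S + c) / 2 - 1 ≤ (r + 1) * (r + 1)) :
    |r - S * x| ≤ E + 3 := by
  have hE0 : 0 ≤ E := (abs_nonneg _).trans hE
  rw [abs_le] at hE
  have e₁ : (r - S * x) * (r + S * x) = r * r - S * (S + c) / 2 + S * (c - S * z) / 2 := by
    linear_combination (-S ^ 2) * hxz
  have hSx : S * (7 / 10) ≤ S * x := by gcongr
  have m₁ : S * (c - S * z) ≤ S * E := by gcongr; exact hE.2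
  have m₂ : S * (-E) ≤ S * (c - S * z) := by gcongr; exact hE.1
  have m₃ : 0 ≤ S * E := by positivity
  have m₄ : 0 ≤ E * r := by positivity
  rw [abs_le]
  constructor
  · by_contra! h
    have : (E + 3) * (r + S * (7 / 10)) ≤ (S * x - r) * (r + S * x) := by
      apply mul_le_mul <;> linarith
    nlinarith
  · by_contra! h
    have : (E + 3) * (r + S * (7 / 10)) ≤ (r - S * x) * (r + S * x) := by
      apply mul_le_mul <;> linarith
    nlinarith

/-- As `2 * r ≥ S`, the division does not amplify errors: `E` comes from the numerator and `2 * (E +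
3)` from the denominator. -/
theorem abs_div_sub_le {S s r x y E : ℝ} (hS : 0 < S) (hE : |s - S * (2 * x * y)| ≤ E)
    (hr : |r - S * x| ≤ E + 3) (hy : |y| ≤ 1) (hrS : S / 2 ≤ r) :
    |s * S / (2 * r) - S * y| ≤ 3 * E + 6 := by
  have hr0 : 0 < r := by linarith
  have e : s * S / (2 * r) - S * y =
      S / (2 * r) * ((s - S * (2 * x * y)) - 2 * (y * (r - S * x))) := by
    field_simp
    ring
  have h₁ : |S / (2 * r)| ≤ 1 := by
    rw [abs_of_nonneg (by positivity), div_le_one (by positivity)]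
    linarith
  have h₂ : |y * (r - S * x)| ≤ 1 * (E + 3) := by
    rw [abs_mul]
    exact mul_le_mul hy hr (abs_nonneg _) zero_le_one
  have h₃ : |(s - S * (2 * x * y)) - 2 * (y * (r - S * x))| ≤ 3 * E + 6 := by
    rw [abs_le] at *
    constructor <;> linarith [hE.1, hE.2, h₂.1, h₂.2]
  rw [e, abs_mul]
  calc _ ≤ 1 * (3 * E + 6) := mul_le_mul h₁ h₃ (abs_nonneg _) zero_le_one
    _ = _ := one_mul _

theorem scaleInit_tri {B : ℤ} {k : ℕ} {s : St} (h7 : s.var 7 = k)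
    (hB : ((2 ^ (k + 1) : ℕ) : ℤ) ^ 60 ≤ B) :
    Tri B scaleInit s (500 * (k + 1)) (fun s' =>
      s'.var 8 = ((2 ^ (k + 1) : ℕ) : ℤ) ^ 20 ∧ Frame scaleInit s s') := by
  refine (Tri.frame ?_).mono le_rfl fun s' h => h
  have hpow : ∀ n ≤ 60 * (k + 1), (2 : ℤ) ^ n ≤ B := fun n hn => by
    refine le_trans ?_ hB
    push_cast
    rw [← pow_mul]
    exact pow_le_pow_right₀ (by norm_num) (by linarith)
  have hk : 20 * ((k : ℤ) + 1) ≤ B := by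
    have h₁ : 20 * (k + 1) < 2 ^ (20 * (k + 1)) := Nat.lt_two_pow_self
    zify at h₁
    exact h₁.le.trans (hpow _ (by linarith))
  have h4 : (2 : ℤ) ^ 5 ≤ B := hpow 5 (by linarith)
  refine (Tri.assign (by simp; linarith) (Q := fun s' => s' = s.setVar 8 (1 : ℕ)) rfl).then
    (T₂ := 20 * (k + 1) * (14 + 7) + 22) (fun s' hs' => ?_) ?_
  · subst hs'
    refine (Tri.loop (T := 14) (n := 20 * (k + 1)) (fun l s' => s'.var 8 = 2 ^ l) ?_ ?_ ?_
      ?_).mono ?_ ?_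
    · simp only [Ex.safe_mul, Ex.safe_add, Ex.safe_num, Ex.safe_var, Ex.eval_add, Ex.eval_num,
        Ex.eval_var, St.setVar_var, h7, Nat.reduceEqDiff, reduceIte]
      push_cast
      and_intros <;> first | trivial | linarith | (apply abs_le_of_nonneg <;> linarith)
    · simp [h7]
    · simp
    · intro j hj s' hs'
      refine (Tri.assign ?_ ?_).mono (by simp) fun _ h => h
      · have := hpow (j + 1) (by linarith)
        rw [pow_succ'] at this
        have h0 : (0 : ℤ) < 2 ^ j := by positivity
        simp [hs']
        exact ⟨by linarith, by linarith⟩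
      · simp [hs', pow_succ']
    · simp
    · intro s' hs'
      rw [hs']
      push_cast
      rw [← pow_mul, mul_comm]
  · simp; omega

/-- The square root is found one binary digit per round, with the invariant `r ^ 2 ≤ a < (r + g) ^
2`. The step `g` is initially `2 * S = 2 ^ (20 * (k + 1) + 1)` and is halved in each round, so that
it is `1` in the end. -/
theorem sqrtLoop_tri {B a S : ℤ} {k : ℕ} {s : St} (h7 : s.var 7 = k) (hS : S = 2 ^ (20 * (k + 1)))
    (h30 : s.var 30 = a) (h31 : s.var 31 = 0) (h32 : s.var 32 = 2 * S) (ha : 0 ≤ a)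
    (haS : a ≤ S * S) (hB : 16 * (S * S) ≤ B) :
    Tri B sqrtLoop s (2000 * (k + 1)) (fun s' => (∃ r : ℤ, 0 ≤ r ∧ r ≤ S ∧ r * r ≤ a ∧
      a < (r + 1) * (r + 1) ∧ s'.var 31 = r) ∧ Frame sqrtLoop s s') := by
  have hk : 20 * ((k : ℤ) + 1) < S := by
    have h₁ : 20 * (k + 1) < 2 ^ (20 * (k + 1)) := Nat.lt_two_pow_self
    zify at h₁
    linarith
  have hS20 : 20 ≤ S := by linarith [Int.natCast_nonneg k]
  have hSS : 20 * S ≤ S * S := by nlinarith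
  refine (Tri.loop_frame (T := 80) (n := 20 * (k + 1) + 1) (fun l s' => ∃ r : ℤ, 0 ≤ r ∧
    r * r ≤ a ∧ a < (r + s'.var 32) * (r + s'.var 32) ∧ s'.var 31 = r ∧
    s'.var 32 * 2 ^ l = 2 * S ∧ s'.var 32 = 2 ^ (20 * (k + 1) + 1 - l)) ?_ ?_ ?_
    fun l hl s' hs' hf => ?_).mono ?_ ?_
  · simp only [Ex.safe_mul, Ex.safe_add, Ex.safe_num, Ex.safe_var, Ex.eval_add, Ex.eval_num,
      Ex.eval_mul, Ex.eval_var, h7]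
    push_cast
    and_intros <;> first | trivial | linarith | (apply abs_le_of_nonneg <;> linarith)
  · simp [h7]
  · refine ⟨0, le_rfl, by simpa using ha, ?_, h31, by simp [h32], ?_⟩
    · rw [h32]; nlinarith
    · rw [h32, hS, Nat.sub_zero, pow_succ']
  · obtain ⟨r, hr0, hra, har, h31, h32, h32'⟩ := hs'
    have h30 : s'.var 30 = a := by rw [hf.var 30 rfl, h30]
    obtain ⟨g, hg⟩ : ∃ g, g = (2 : ℤ) ^ (20 * (k + 1) - l) := ⟨_, rfl⟩
    have hg0 : 0 < g := by rw [hg]; positivity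
    have hv : s'.var 32 = 2 * g := by
      rw [h32', hg, ← pow_succ']
      congr 1
      omega
    have hgl : g * 2 ^ (l + 1) = 2 * S := by rw [← h32, hv]; ring
    have hgS : g ≤ S := by
      have : (1 : ℤ) ≤ 2 ^ l := one_le_pow₀ (by norm_num)
      have : g * 2 ^ l = S := by rw [pow_succ'] at hgl; linarith
      nlinarith
    have hrS : r ≤ S := by nlinarith
    have hd : (2 * g).tdiv 2 = g := Int.mul_tdiv_cancel_left g (by norm_num)
    have q₁ : 0 ≤ (r + g) * (r + g) := mul_self_nonneg _
    have q₂ : (r + g) * (r + g) ≤ 4 * (S * S) := by nlinarith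
    refine (Tri.assign (Q := fun s'' => s'' = (s'.setVar 25 l).setVar 32 g) (by simp; linarith)
      (by simp [hv, hd])).then (T₂ := 60) (fun s'' hs'' => ?_) (by simp)
    subst hs''
    refine (Tri.ite (T := 10) ?_ (fun h => ?_) (fun h => ?_)).mono (by simp) fun _ h => h
    · simp [h30, h31]
      and_intros <;> first | linarith | (apply abs_le_of_nonneg <;> linarith) |
        (rw [abs_le]; constructor <;> linarith)
    · simp [h30, h31] at h
      refine (Tri.assign ?_ ⟨r + g, by linarith, by linarith, ?_, ?_, ?_, ?_⟩).mono (by simp)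
        fun _ h => h
      · simp [h31]
        apply abs_le_of_nonneg <;> linarith
      · simp
        rw [hv] at har
        linarith
      · simp [h31]
      · simpa using hgl
      · simp [hg]
    · simp [h30, h31] at h
      refine (Tri.assign ?_ ⟨r, hr0, hra, ?_, ?_, ?_, ?_⟩).mono (by simp) fun _ h => h
      · simp
      · simp
        linarith
      · simp [h31]
      · simpa using hgl
      · simp [hg]
  · simp; omega
  · rintro s' ⟨⟨r, hr0, hra, har, h31, -, h32⟩, hf⟩
    rw [Nat.sub_self, pow_zero] at h32
    rw [h32] at har
    exact ⟨⟨r, hr0, by nlinarith, hra, har, h31⟩, hf⟩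

theorem doubleTable_tri {B S c d : ℤ} {j : ℕ} {s : St} {ρ : ℂ} {e η : ℝ} (hS0 : 0 < S)
    (hS : s.var 8 = S) (h26 : s.var 26 = c) (h27 : s.var 27 = d) (h28 : s.var 28 = (2 ^ j : ℕ))
    (hρ : ρ = Complex.exp ((Real.pi / 2 ^ (j + 1) : ℝ) * Complex.I))
    (hc : ‖cx c d - S * ρ‖ ≤ η) (hX : Close S (2 ^ j) e (s.arr 11) (s.arr 12) split)
    (he : e ≤ S) (hη : η ≤ S) (hj : 2 * 2 ^ j ≤ S) (hB : 16 * (S * S) ≤ B) :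
    Tri B doubleTable s (200 * 2 ^ j) (fun s' =>
      Close S (2 ^ (j + 1)) (2 * e + η + 2) (s'.arr 11) (s'.arr 12) split ∧
        Frame doubleTable s s') := by
  have hS0' : (0 : ℝ) < S := by exact_mod_cast hS0
  have hρ1 : ‖ρ‖ ≤ 1 := by rw [hρ]; exact (Complex.norm_exp_ofReal_mul_I _).le
  have hC : Close S 1 η (fun _ => c) (fun _ => d) fun _ => ρ := fun u _ => hc
  have hcd := hC.abs_le hS0 (fun _ => hρ1) zero_lt_one (D := 2 * S) (by push_cast; linarith)
  have hT : ∀ i < 2 ^ j, |s.arr 11 i| ≤ 2 * S ∧ |s.arr 12 i| ≤ 2 * S := fun i hi =>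
    hX.abs_le hS0 (fun u => (norm_split u).le) hi (by push_cast; linarith)
  refine (Tri.loop_frame (T := 150) (n := 2 ^ j) (fun i s' =>
    (∀ u < 2 ^ j, s'.arr 11 u = s.arr 11 u ∧ s'.arr 12 u = s.arr 12 u) ∧
    ∀ u < i, s'.arr 11 (2 ^ j + u) = (s.arr 11 u * c - s.arr 12 u * d).tdiv S ∧
      s'.arr 12 (2 ^ j + u) = (s.arr 11 u * d + s.arr 12 u * c).tdiv S) (by simp)
    (by simpa using h28) ⟨fun _ _ => ⟨rfl, rfl⟩, by simp⟩ fun i hi s' hs' hf => ?_).mono ?_ ?_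
  · have e8 : s'.var 8 = S := by rw [hf.var 8 rfl, hS]
    have e26 : s'.var 26 = c := by rw [hf.var 26 rfl, h26]
    have e27 : s'.var 27 = d := by rw [hf.var 27 rfl, h27]
    have e28 : s'.var 28 = 2 ^ j := by rw [hf.var 28 rfl, h28]; push_cast; rfl
    have hi' : (i : ℤ) < 2 ^ j := by exact_mod_cast hi
    have htn : ((2 : ℤ) ^ j + i).toNat = 2 ^ j + i := by
      rw [show (2 : ℤ) ^ j + i = ((2 ^ j + i : ℕ) : ℤ) by push_cast; rfl, Int.toNat_natCast]
    obtain ⟨h₁, h₂⟩ := hs'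
    obtain ⟨t₁, t₂⟩ := hT i hi
    have m₁ := abs_mul_le_of_le t₁ hcd.1
    have m₂ := abs_mul_le_of_le t₂ hcd.2
    have m₃ := abs_mul_le_of_le t₁ hcd.2
    have m₄ := abs_mul_le_of_le t₂ hcd.1
    have m₅ := abs_sub_le_of_le m₁ m₂
    have m₆ := abs_add_le_of_le m₃ m₄
    have hSS : S ≤ S * S := by nlinarith
    have hp : (0 : ℤ) < 2 ^ j := by positivity
    refine ⟨?_, ?_, ?_, ?_⟩
    · simp [Cmd.Safe, Cmd.eval, e8, e26, e27, e28, (h₁ i hi).1, (h₁ i hi).2, htn, -abs_mul]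
      and_intros <;> first | linarith | (apply abs_le_of_nonneg <;> linarith)
    · simp [Cmd.cost]
    · intro u hu
      have h₃ : u ≠ 2 ^ j + i := by omega
      simpa [Cmd.eval, e28, htn, h₃] using h₁ u hu
    · intro u hu
      rcases Nat.lt_succ_iff_lt_or_eq.1 hu with hu | rfl
      · simpa [Cmd.eval, e28, htn, hu.ne] using h₂ u hu
      · simp [Cmd.eval, e8, e26, e27, e28, htn, (h₁ u hi).1, (h₁ u hi).2]
  · have := Nat.one_le_two_pow (n := j)
    simp only [Ex.size_var]
    omega
  · rintro s' ⟨⟨h₁, h₂⟩, hf⟩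
    refine ⟨fun u hu => ?_, hf⟩
    have hη0 : 0 ≤ η := (norm_nonneg _).trans hc
    rcases lt_or_ge u (2 ^ j) with h | h
    · have he0 : 0 ≤ e := (norm_nonneg _).trans (hX u h)
      rw [(h₁ u h).1, (h₁ u h).2]
      exact (hX u h).trans (by linarith)
    · obtain ⟨v, rfl⟩ := Nat.exists_eq_add_of_le h
      have hv : v < 2 ^ j := by rw [pow_succ] at hu; omega
      rw [(h₂ v hv).1, (h₂ v hv).2, split_two_pow_add j v hv, ← hρ]
      refine (norm_mul_tdiv_sub_le hS0 (hX v hv) hc (norm_split v).le hρ1 hη).trans (le_of_eq ?_)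
      ring

/-- The half-angle formula `cos φ = √((1 + cos 2φ) / 2)` becomes an integer square root of `S * (S +
c) / 2`, and `sin φ = sin 2φ / (2 cos φ)` a division. The errors are `E + 3` and `3 * E + 6`, and
truncating the quotient adds one. -/
theorem halve_tri {B S c d : ℤ} {k : ℕ} {s : St} {φ E : ℝ} (h7 : s.var 7 = k)
    (hS : S = 2 ^ (20 * (k + 1))) (h8 : s.var 8 = S) (h26 : s.var 26 = c) (h27 : s.var 27 = d)
    (hc0 : 0 ≤ c) (hcS : c ≤ S) (hφ0 : 0 ≤ φ) (hφ : φ ≤ Real.pi / 4)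
    (hc : |(c : ℝ) - S * Real.cos (2 * φ)| ≤ E) (hd : |(d : ℝ) - S * Real.sin (2 * φ)| ≤ E)
    (hE : 5 * E + 15 ≤ S) (hB : 16 * (S * S) ≤ B) :
    Tri B halve s (2200 * (k + 1)) (fun s' => (∃ c d : ℤ, s'.var 26 = c ∧ s'.var 27 = d ∧ 0 ≤ c ∧
      c ≤ S ∧ |(c : ℝ) - S * Real.cos φ| ≤ 3 * E + 7 ∧ |(d : ℝ) - S * Real.sin φ| ≤ 3 * E + 7) ∧
      Frame halve s s') := by
  have hE0 : 0 ≤ E := (abs_nonneg _).trans hc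
  have hS15 : (15 : ℝ) ≤ S := by linarith
  have hS15' : (15 : ℤ) ≤ S := by exact_mod_cast hS15
  have hSS : S * 15 ≤ S * S := by gcongr
  have hx : 7 / 10 ≤ Real.cos φ := by
    have h₁ : Real.cos (Real.pi / 4) ≤ Real.cos φ :=
      Real.cos_le_cos_of_nonneg_of_le_pi hφ0 (by linarith [Real.pi_pos]) hφ
    rw [Real.cos_pi_div_four] at h₁
    have : (7 / 5 : ℝ) ≤ √2 := Real.le_sqrt_of_sq_le (by norm_num)
    linarith
  have hx2 : Real.cos φ ^ 2 = (1 + Real.cos (2 * φ)) / 2 := by rw [Real.cos_two_mul]; ring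
  have hdS : |d| ≤ 2 * S := by
    have h₁ : |(d : ℝ)| ≤ 2 * S := by
      have h₂ := Real.abs_sin_le_one (2 * φ)
      have h₃ : |(S : ℝ) * Real.sin (2 * φ)| ≤ S * 1 := by
        rw [abs_mul, abs_of_nonneg (by linarith)]
        gcongr
      rw [abs_le] at *
      constructor <;> linarith [hd.1, hd.2, h₃.1, h₃.2]
    exact_mod_cast h₁
  have hScn : 0 ≤ S * (S + c) := by positivity
  have hScu : S * (S + c) ≤ 2 * (S * S) := by nlinarith
  have ha0 : (0 : ℤ) ≤ (S * (S + c)).tdiv 2 := Int.tdiv_nonneg hScn (by norm_num)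
  have hae : (S * (S + c)).tdiv 2 = (S * (S + c)) / 2 := Int.tdiv_eq_ediv_of_nonneg hScn
  have ha1 : 2 * (S * (S + c)).tdiv 2 ≤ S * (S + c) := by omega
  have ha2 : S * (S + c) ≤ 2 * (S * (S + c)).tdiv 2 + 1 := by omega
  refine (Tri.frame ?_).mono le_rfl fun s' h => h
  refine (Tri.assign (Q := fun s' => s' = s.setVar 30 ((S * (S + c)).tdiv 2)) ?_
    (by simp [h8, h26])).then (T₂ := 2000 * (k + 1) + 150) (fun s₁ h₁ => ?_) (by simp; omega)
  · simp [h8, h26, -abs_mul]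
    and_intros <;> first | linarith | (apply abs_le_of_nonneg <;> linarith)
  refine (Tri.assign (Q := fun s' => s' = s₁.setVar 31 0) (by simp; linarith) (by simp)).then
    (T₂ := 2000 * (k + 1) + 100) (fun s₂ h₂ => ?_) (by simp; omega)
  subst h₁
  refine (Tri.assign (Q := fun s' => s' = s₂.setVar 32 (2 * S)) ?_ (by simp [h₂, h8])).then
    (T₂ := 2000 * (k + 1) + 80) (fun s₃ h₃ => ?_) (by simp; omega)
  · simp [h₂, h8, -abs_mul]
    and_intros <;> first | linarith | (apply abs_le_of_nonneg <;> linarith)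
  subst h₂ h₃
  refine (sqrtLoop_tri (a := (S * (S + c)).tdiv 2) (S := S) (k := k) (by simpa using h7) hS
    (by simp) (by simp) (by simp) ha0 (by linarith) hB).then (T₂ := 80)
    (fun s₄ h₄ => ?_) (by omega)
  obtain ⟨⟨r, hr0, hrS, hra, har, h31⟩, hf⟩ := h₄
  have e27 : s₄.var 27 = d := by rw [hf.var 27 rfl]; simpa using h27
  have e8 : s₄.var 8 = S := by rw [hf.var 8 rfl]; simpa using h8
  have hr1 : |(r : ℝ) - S * Real.cos φ| ≤ E + 3 := by
    refine abs_sqrt_sub_le (by linarith) hc hx hx2 (by exact_mod_cast hr0) ?_ ?_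
    · have : 2 * (r * r) ≤ S * (S + c) := by linarith
      have : 2 * ((r : ℝ) * r) ≤ S * (S + c) := by exact_mod_cast this
      linarith
    · have : S * (S + c) ≤ 2 * ((r + 1) * (r + 1)) := by linarith
      have : (S : ℝ) * (S + c) ≤ 2 * ((r + 1) * (r + 1)) := by exact_mod_cast this
      linarith
  have hr2 : (S : ℝ) / 2 ≤ r := by
    have h₁ : (S : ℝ) * (7 / 10) ≤ S * Real.cos φ := by gcongr
    rw [abs_le] at hr1
    linarith [hr1.1]
  have hr3 : 0 < r := by
    have : (0 : ℝ) < r := by linarith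
    exact_mod_cast this
  refine (Tri.assign (Q := fun s' => s' = s₄.setVar 27 ((d * S).tdiv (2 * r))) ?_
    (by simp [e27, e8, h31])).then (T₂ := 10) (fun s₅ h₅ => ?_) (by simp)
  · have := abs_mul_le_of_le hdS (abs_of_nonneg (by linarith : 0 ≤ S)).le
    simp [e27, e8, h31, -abs_mul]
    and_intros <;> first | linarith | (apply abs_le_of_nonneg <;> linarith)
  subst h₅
  refine (Tri.assign (by simp) ⟨r, (d * S).tdiv (2 * r), by simp [h31], by simp, hr0, hrS,
    hr1.trans (by linarith), ?_⟩).mono (by simp) fun _ h => h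
  have h₁ := abs_tdiv_sub_le (d * S) (S := 2 * r) (by linarith)
  rw [Real.sin_two_mul] at hd
  have h₂ := abs_div_sub_le (S := S) (s := d) (r := r) (x := Real.cos φ) (y := Real.sin φ) (E := E)
    (by linarith) (by convert hd using 3; ring) hr1 (Real.abs_sin_le_one φ) hr2
  push_cast at h₁
  rw [abs_le] at *
  constructor <;> linarith [h₁.1, h₁.2, h₂.1, h₂.2]

/-- The angles start at `π / 2`, where `(0, S)` is exact. Under `E ↦ 3 * E + 7` the error of the
current root stays below `4 * 4 ^ j - 4`, hence below `N ^ 2` in each coordinate. The error of the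
table then obeys `e ↦ 2 * e + η + 2` with `η = 2 * N ^ 2`, which gives `(2 ^ j - 1) * (2 * N ^ 2 +
2) ≤ N ^ 6`. The square roots cost `O(k²)` in all, the doublings `O(2 ^ k)` per round at most. -/
theorem rootTable_tri {B : ℤ} {k : ℕ} {s : St} (h7 : s.var 7 = k)
    (hB : ((2 ^ (k + 1) : ℕ) : ℤ) ^ 60 ≤ B) :
    Tri B rootTable s (8000 * (2 ^ k * (k + 1))) (fun s' =>
      (s'.var 8 = ((2 ^ (k + 1) : ℕ) : ℤ) ^ 20 ∧
      Close (((2 ^ (k + 1) : ℕ) : ℤ) ^ 20) (2 ^ k) (((2 ^ (k + 1) : ℕ) : ℝ) ^ 6)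
        (s'.arr 11) (s'.arr 12) split) ∧ Frame rootTable s s') := by
  refine (Tri.frame ?_).mono le_rfl fun s' h => h
  obtain ⟨N, hN⟩ : ∃ N : ℕ, N = 2 ^ (k + 1) := ⟨_, rfl⟩
  obtain ⟨S, hS⟩ : ∃ S : ℤ, S = (N : ℤ) ^ 20 := ⟨_, rfl⟩
  rw [← hN] at hB ⊢
  have hN2 : 2 ≤ N := by rw [hN, pow_succ]; have := Nat.one_le_two_pow (n := k); omega
  have hNZ : (2 : ℤ) ≤ N := by exact_mod_cast hN2
  have hNR : (2 : ℝ) ≤ N := by exact_mod_cast hN2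
  have hS' : S = 2 ^ (20 * (k + 1)) := by
    rw [hS, hN]; push_cast; rw [← pow_mul, mul_comm]
  have hB16 : 16 * (S * S) ≤ B := by
    have h4 : (2 : ℤ) ^ 4 ≤ (N : ℤ) ^ 4 := pow_le_pow_left₀ (by norm_num) hNZ 4
    have h44 : (N : ℤ) ^ 44 = N ^ 4 * (S * S) := by rw [hS]; ring
    have h60 : (N : ℤ) ^ 44 ≤ N ^ 60 := pow_le_pow_right₀ (by linarith) (by norm_num)
    nlinarith [mul_self_nonneg S]
  have hS0 : 0 < S := by rw [hS]; positivity
  have hSR : (S : ℝ) = (N : ℝ) ^ 20 := by rw [hS]; push_cast; rfl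
  have h1K : 1 ≤ 2 ^ k := Nat.one_le_two_pow
  have hkK : k + 1 ≤ 2 ^ k := Nat.lt_two_pow_self
  have hkK' : 2 ^ k ≤ 2 ^ k * (k + 1) := Nat.le_mul_of_pos_right _ (by omega)
  have hSN : (N : ℝ) ^ 6 * 2 ^ 14 ≤ S := by
    rw [hSR, show (N : ℝ) ^ 20 = N ^ 6 * N ^ 14 by ring]
    gcongr
  have hNS : (N : ℝ) ≤ (N : ℝ) ^ 6 := le_self_pow₀ (by linarith) (by norm_num)
  have hN26 : (N : ℝ) ^ 2 ≤ (N : ℝ) ^ 6 := pow_le_pow_right₀ (by linarith) (by norm_num)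
  have hpow4 : ∀ j ≤ k, 4 * (4 : ℝ) ^ j ≤ N ^ 2 := fun j hj => by
    have : (4 : ℝ) ^ j ≤ 4 ^ k := pow_le_pow_right₀ (by norm_num) hj
    have h₁ : (N : ℝ) ^ 2 = 4 * 4 ^ k := by
      rw [hN, show (4 : ℝ) = 2 ^ 2 by norm_num, ← pow_mul]; push_cast; ring
    linarith
  have hpow2 : ∀ j ≤ k, (2 : ℝ) ^ j * 2 ≤ N := fun j hj => by
    rw [hN]; push_cast; rw [pow_succ]
    gcongr
    norm_num
  have h6pos : (0 : ℝ) < N ^ 2 := by positivity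
  have hNN : ∀ j ≤ k, (2 : ℝ) ^ j * (2 * (N : ℝ) ^ 2 + 2) ≤ N ^ 6 := fun j hj => by
    have hj2 := hpow2 j hj
    have h₂ : (2 : ℝ) ^ j * (2 * (N : ℝ) ^ 2 + 2) ≤ N * (N ^ 2 + 1) := by nlinarith
    have h₃ : (N : ℝ) * (N ^ 2 + 1) ≤ N * (N ^ 2 * 2) := by
      gcongr
      nlinarith
    have h₄ : (N : ℝ) * (N ^ 2 * 2) ≤ N * (N ^ 2 * N) := by gcongr
    have h₅ : (N : ℝ) * (N ^ 2 * N) = N ^ 4 := by ring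
    have h₆ : (N : ℝ) ^ 4 ≤ N ^ 6 := pow_le_pow_right₀ (by linarith) (by norm_num)
    linarith
  refine (scaleInit_tri h7 (hN ▸ hB)).then (T₂ := 7000 * (2 ^ k * (k + 1)))
    (fun s₀ h₀ => ?_) (by nlinarith)
  rw [← hN, ← hS] at h₀
  have e8 := h₀.1
  have e7 : s₀.var 7 = k := by rw [h₀.2.var 7 rfl, h7]
  refine (Tri.assign (Q := fun s' => s' = s₀.setVar 26 0) (by simp; linarith [mul_self_nonneg S])
    (by simp)).then (T₂ := 6900 * (2 ^ k * (k + 1))) (fun s₁ h₁ => ?_) (by simp; omega)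
  subst h₁
  refine (Tri.assign (Q := fun s' => s' = (s₀.setVar 26 0).setVar 27 S) (by simp)
    (by simp [e8])).then (T₂ := 6800 * (2 ^ k * (k + 1))) (fun s₁ h₁ => ?_) (by simp; omega)
  subst h₁
  refine (Tri.assign (Q := fun s' => s' = ((s₀.setVar 26 0).setVar 27 S).setVar 28 1)
    (by simp; nlinarith) (by simp)).then (T₂ := 6700 * (2 ^ k * (k + 1))) (fun s₁ h₁ => ?_)
    (by simp; omega)
  subst h₁
  refine Tri.then (T₁ := 50) (Q := fun s' => s' = (((s₀.setVar 26 0).setVar 27 S).setVar 28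
    1).setArr 11 0 S) ⟨?_, by simp [Cmd.cost], by simp [Cmd.eval, e8]⟩
    (T₂ := 6600 * (2 ^ k * (k + 1))) (fun s₁ h₁ => ?_) (by omega)
  · simp [Cmd.Safe]; nlinarith
  subst h₁
  refine Tri.then (T₁ := 50) (Q := fun s' => s' = ((((s₀.setVar 26 0).setVar 27 S).setVar 28
    1).setArr 11 0 S).setArr 12 0 0) ⟨?_, by simp [Cmd.cost], by simp [Cmd.eval]⟩
    (T₂ := 6500 * (2 ^ k * (k + 1))) (fun s₁ h₁ => ?_) (by omega)
  · simp [Cmd.Safe]; nlinarith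
  refine (Tri.loop_frame (T := 200 * 2 ^ k + 2200 * (k + 1) + 100) (n := k) (fun j s' =>
    (∃ c d : ℤ, s'.var 26 = c ∧ s'.var 27 = d ∧ 0 ≤ c ∧ c ≤ S ∧
      |(c : ℝ) - S * Real.cos (Real.pi / 2 ^ (j + 1))| ≤ 4 * 4 ^ j - 4 ∧
      |(d : ℝ) - S * Real.sin (Real.pi / 2 ^ (j + 1))| ≤ 4 * 4 ^ j - 4) ∧
    s'.var 28 = (2 ^ j : ℕ) ∧
    Close S (2 ^ j) (2 ^ j * (2 * (N : ℝ) ^ 2 + 2) - (2 * (N : ℝ) ^ 2 + 2))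
      (s'.arr 11) (s'.arr 12) split) (by simp) (by simp [h₁, e7]) ?_
    fun j hj s' hs' hf => ?_).mono ?_ ?_
  · refine ⟨⟨0, S, by simp [h₁], by simp [h₁], le_rfl, hS0.le, by simp, by simp⟩, by simp [h₁], ?_⟩
    intro u hu
    have : u = 0 := by simpa using hu
    subst this
    simp [h₁, split_zero, cx]
    apply Complex.ext <;> simp
  · obtain ⟨⟨c, d, h26, h27, hc0, hcS, hc, hd⟩, h28, hX⟩ := hs'
    have e8' : s'.var 8 = S := by rw [hf.var 8 rfl]; simpa [h₁] using e8
    have e7' : s'.var 7 = k := by rw [hf.var 7 rfl]; simpa [h₁] using e7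
    have hj4 := hpow4 j hj.le
    have hj2 := hpow2 j hj.le
    have hNN := hNN j hj.le
    have hj1 : (1 : ℝ) ≤ 4 ^ j := one_le_pow₀ (by norm_num)
    have hη : ‖cx c d - S * Complex.exp ((Real.pi / 2 ^ (j + 1) : ℝ) * Complex.I)‖ ≤
        2 * (N : ℝ) ^ 2 := by
      refine (Complex.norm_le_abs_re_add_abs_im _).trans ?_
      rw [Complex.exp_mul_I, ← Complex.ofReal_cos, ← Complex.ofReal_sin]
      simp only [cx, Complex.sub_re, Complex.sub_im, Complex.mul_re, Complex.mul_im,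
        Complex.intCast_re, Complex.intCast_im, Complex.add_re, Complex.add_im, Complex.ofReal_re,
        Complex.ofReal_im, Complex.I_re, Complex.I_im, mul_zero, mul_one, zero_mul, sub_zero,
        add_zero, zero_add]
      linarith
    refine (doubleTable_tri (B := B) (s := s'.setVar 24 j) hS0 (by simpa using e8')
      (by simpa using h26) (by simpa using h27) (by simpa using h28) rfl hη hX (by linarith)
      (by linarith) ?_ hB16).then (T₂ := 2200 * (k + 1) + 20) (fun s₂ h₂ => ?_) ?_
    · have h₂ : (2 : ℝ) * 2 ^ j ≤ S := by linarith
      exact_mod_cast h₂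
    · refine (Tri.assign (Q := fun s' => s' = s₂.setVar 28 (2 ^ (j + 1) : ℕ)) ?_ ?_).then
        (T₂ := 2200 * (k + 1)) (fun s₃ h₃ => ?_) (by simp; omega)
      · rw [Ex.safe_mul, Ex.eval_num, Ex.eval_var, h₂.2.var 28 rfl]
        have hp : (0 : ℝ) < 2 ^ j := by positivity
        have h₃ : (2 : ℝ) * 2 ^ j ≤ S := by linarith
        have h₃ : (2 : ℤ) * 2 ^ j ≤ S := by exact_mod_cast h₃
        have hp : (0 : ℤ) < 2 ^ j := by positivity
        simp [h28, -abs_mul]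
        exact ⟨by nlinarith, abs_le_of_nonneg (by linarith) (by nlinarith)⟩
      · rw [Ex.eval_mul, Ex.eval_num, Ex.eval_var, h₂.2.var 28 rfl]
        simp [h28, pow_succ']
      · subst h₃
        refine (halve_tri (φ := Real.pi / 2 ^ (j + 2)) (E := 4 * 4 ^ j - 4) (c := c) (d := d)
          (k := k) ?_ hS' ?_ ?_ ?_ hc0 hcS (by positivity) ?_ ?_ ?_ (by linarith)
          hB16).mono le_rfl fun s₄ h₄ => ⟨?_, ?_, ?_⟩
        · simp [h₂.2.var 7 rfl, e7']
        · simp [h₂.2.var 8 rfl, e8']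
        · simp [h₂.2.var 26 rfl, h26]
        · simp [h₂.2.var 27 rfl, h27]
        · have h₅ : (2 : ℝ) ^ 2 ≤ 2 ^ (j + 2) := pow_le_pow_right₀ (by norm_num) (by omega)
          exact div_le_div_of_nonneg_left Real.pi_pos.le (by norm_num) (by linarith)
        · convert hc using 5
          rw [pow_succ 2 (j + 1)]; field_simp
        · convert hd using 5
          rw [pow_succ 2 (j + 1)]; field_simp
        · obtain ⟨⟨c', d', a₁, a₂, a₃, a₄, a₅, a₆⟩, -⟩ := h₄
          refine ⟨c', d', a₁, a₂, a₃, a₄, a₅.trans ?_, a₆.trans ?_⟩ <;>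
          · rw [pow_succ (4 : ℝ)]
            linarith
        · rw [h₄.2.var 28 rfl]; simp
        · rw [h₄.2.arr 11 rfl, h₄.2.arr 12 rfl]
          refine h₂.1.mono le_rfl ?_
          rw [pow_succ (2 : ℝ)]
          linarith
    · have : 2 ^ j ≤ 2 ^ k := Nat.pow_le_pow_right (by norm_num) hj.le
      omega
  · have h₂ : k * (200 * 2 ^ k + 2200 * (k + 1) + 100 + 7) ≤ k * (2507 * 2 ^ k) := by
      gcongr
      omega
    simp only [Ex.size_var]
    nlinarith
  · rintro s' ⟨⟨-, -, hX⟩, hf⟩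
    refine ⟨?_, ?_⟩
    · rw [hf.var 8 rfl, ← hS]; simpa [h₁] using e8
    · rw [← hS]
      refine hX.mono le_rfl ?_
      have h₂ := hNN k le_rfl
      linarith

end IntProg

/-! ### Algebra of the equations -/

namespace IntProg

open Polynomial

/-- The truncation of a polynomial to its first `n` coefficients. -/
noncomputable def trunc (n : ℕ) (p : (ZMod 2)[X]) : (ZMod 2)[X] :=
  ∑ i ∈ Finset.range n, monomial i (p.coeff i)

theorem coeff_trunc (n : ℕ) (p : (ZMod 2)[X]) (i : ℕ) :
    (trunc n p).coeff i = if i < n then p.coeff i else 0 := by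
  simp only [trunc, finsetSum_coeff, coeff_monomial]
  rw [Finset.sum_ite_eq' (Finset.range n) i]
  simp

theorem natDegree_trunc_lt {n : ℕ} (hn : 0 < n) (p : (ZMod 2)[X]) : (trunc n p).natDegree < n := by
  refine Nat.lt_of_le_pred hn (natDegree_le_iff_coeff_eq_zero.2 fun i hi => ?_)
  rw [coeff_trunc, if_neg (by have := Nat.pred_eq_sub_one (n := n); omega)]

theorem trunc_of_natDegree_lt {n : ℕ} {p : (ZMod 2)[X]} (h : p.natDegree < n) : trunc n p = p := by
  ext i
  rw [coeff_trunc]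
  split_ifs with hi
  · rfl
  · rw [coeff_eq_zero_of_natDegree_lt (by omega)]

theorem X_pow_dvd_sub_trunc (n : ℕ) (p : (ZMod 2)[X]) : X ^ n ∣ p - trunc n p := by
  rw [X_pow_dvd_iff]
  intro i hi
  rw [coeff_sub, coeff_trunc, if_pos hi, sub_self]

theorem trunc_eq_of_dvd {n : ℕ} {p q : (ZMod 2)[X]} (h : X ^ n ∣ p - q) : trunc n p = trunc n q := by
  ext i
  rw [coeff_trunc, coeff_trunc]
  split_ifs with hi
  · have := X_pow_dvd_iff.1 h i hi
    rwa [coeff_sub, sub_eq_zero] at this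
  · rfl

/-- One step of the computation of an inverse: from precision `n` to precision `2 * n`. -/
theorem dvd_inverse_step {n : ℕ} {p v : (ZMod 2)[X]} (h : X ^ n ∣ p * v - 1) :
    X ^ (2 * n) ∣ p * trunc (2 * n) (trunc (2 * n) p * expand (ZMod 2) 2 v) - 1 := by
  set q := trunc (2 * n) p * expand (ZMod 2) 2 v with hq
  have h₁ : X ^ (2 * n) ∣ p * p * expand (ZMod 2) 2 v - 1 := by
    -- In characteristic two, squaring `v` is substituting `X ^ 2`, a mere spreading of
    -- coefficients. Hence a Newton step needs only one product.
    have : p * p * expand (ZMod 2) 2 v - 1 = (p * v - 1) ^ 2 := by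
      have e : p * p = expand (ZMod 2) 2 p := by rw [ZMod.expand_card, sq]
      rw [← ZMod.expand_card, e, map_sub, map_mul, map_one]
    rw [this, mul_comm, pow_mul]
    exact pow_dvd_pow_of_dvd h 2
  have h₂ := X_pow_dvd_sub_trunc (2 * n) q
  have h₃ := X_pow_dvd_sub_trunc (2 * n) p
  have e : p * trunc (2 * n) q - 1 = (p * p * expand (ZMod 2) 2 v - 1) - p * (q - trunc (2 * n) q) -
      p * expand (ZMod 2) 2 v * (p - trunc (2 * n) p) := by
    rw [hq]; ring
  rw [e]
  exact dvd_sub (dvd_sub h₁ (h₂.mul_left _)) (h₃.mul_left _)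

/-- A linear equation over the Laurent polynomials is solvable if and only if the division with the
power series inverse leaves no remainder. -/
theorem exists_laurent_iff {K lo : ℕ} {p q v : (ZMod 2)[X]} (hp : p.coeff 0 = 1 ∨ p = 0)
    (hq : q.natDegree < K) (hv : p.coeff 0 = 1 → X ^ K ∣ p * v - 1) :
    (∃ f : LaurentPolynomial (ZMod 2), toLaurent q + toLaurent (X ^ lo * p) * f = 0) ↔
      p * trunc K (q * v) = q := by
  constructor
  · rintro ⟨f, hf⟩
    rcases hp with hp | rfl
    -- Clearing denominators turns the equation into one between polynomials.
    · obtain ⟨n, f', hf'⟩ := LaurentPolynomial.exists_T_pow f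
      have h₁ : q * X ^ n + X ^ lo * p * f' = 0 := by
        apply toLaurent_injective
        rw [map_add, map_mul, map_mul, hf', toLaurent_X_pow, map_zero]
        linear_combination (LaurentPolynomial.T n) * hf
      have h₂ : p ∣ q * X ^ n :=
        ⟨-(X ^ lo * f'), by linear_combination h₁⟩
      -- The constant term of `p` is `1`, so the power of `X` can be cancelled from the
      -- divisibility.
      have h₃ : IsCoprime p (X ^ n) := by
        refine IsCoprime.pow_right ?_
        have : X ∣ p - 1 := by rw [X_dvd_iff, coeff_sub, hp]; simp
        obtain ⟨d, hd⟩ := this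
        exact ⟨1, -d, by linear_combination hd⟩
      obtain ⟨r, hr⟩ := h₃.dvd_of_dvd_mul_right h₂
      have h₄ : r.natDegree < K := by
        rcases eq_or_ne q 0 with h | h
        · have : p ≠ 0 := by rintro rfl; simp at hp
          rw [h, eq_comm, mul_eq_zero, or_iff_right this] at hr
          rw [hr]
          simpa using (Nat.zero_le _).trans_lt hq
        · have hne : p ≠ 0 ∧ r ≠ 0 := by
            rw [hr] at h
            exact ⟨left_ne_zero_of_mul h, right_ne_zero_of_mul h⟩
          rw [hr, natDegree_mul hne.1 hne.2] at hq
          omega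
      -- The quotient `r` has degree below `K`, so it is its own truncation, and modulo `X ^ K` it
      -- equals `q * v`.
      have h₅ : trunc K (q * v) = r := by
        rw [← trunc_of_natDegree_lt h₄]
        refine trunc_eq_of_dvd ?_
        have : q * v - r = r * (p * v - 1) := by rw [hr]; ring
        rw [this]
        exact (hv hp).mul_left r
      rw [h₅, ← hr]
    · rw [mul_zero, map_zero, zero_mul, add_zero] at hf
      have : q = 0 := toLaurent_injective (by rw [hf, map_zero])
      rw [this, zero_mul]
  · intro h
    refine ⟨-(LaurentPolynomial.T (-lo) * toLaurent (trunc K (q * v))), ?_⟩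
    have h₁ : (LaurentPolynomial.T (lo : ℤ) : LaurentPolynomial (ZMod 2)) *
        LaurentPolynomial.T (-lo) = 1 := by
      rw [← LaurentPolynomial.T_add, add_neg_cancel, LaurentPolynomial.T_zero]
    have h₂ := congrArg toLaurent h
    rw [map_mul] at h₂
    rw [map_mul, toLaurent_X_pow]
    linear_combination (-toLaurent p * toLaurent (trunc K (q * v))) * h₁ - h₂

end IntProg

/-! ### The lamplighter group in coordinates fixed at the start -/

namespace Lamplighter

open LaurentPolynomial

/-- The lamps, in coordinates in which the lamplighter starts at `0`. -/
noncomputable def absLamps (g : Lamplighter) : LaurentPolynomial (ZMod 2) := g.lamps * T g.pos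

/-- In the group law the lamps of the left factor are shifted by the right one. In these coordinates
the left factor stays put, so a word can be read from left to right with each letter acting at the
current position only. -/
theorem absLamps_mul (g h : Lamplighter) :
    (g * h).absLamps = g.absLamps + T g.pos * h.absLamps := by
  simp only [absLamps, mul_lamps, mul_pos]
  have : (T (-h.pos) : LaurentPolynomial (ZMod 2)) * T h.pos = 1 := by
    rw [← T_add, neg_add_cancel, T_zero]
  rw [T_add]
  linear_combination (g.lamps * T g.pos) * this

theorem laurent_add_self (f : LaurentPolynomial (ZMod 2)) : f + f = 0 := by
  rw [← two_smul (ZMod 2) f, show (2 : ZMod 2) = 0 from rfl, zero_smul]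

theorem absLamps_inv (g : Lamplighter) : (g⁻¹).absLamps = g.lamps := by
  simp only [absLamps, inv_lamps, inv_pos]
  rw [neg_mul, mul_assoc, ← T_add, add_neg_cancel, T_zero, mul_one]
  exact neg_eq_of_add_eq_zero_left (laurent_add_self _)

theorem eq_one_iff (g : Lamplighter) : g = 1 ↔ g.pos = 0 ∧ g.absLamps = 0 := by
  constructor
  · rintro rfl
    simp [absLamps]
  · rintro ⟨h₁, h₂⟩
    rw [absLamps, h₁, T_zero, mul_one] at h₂
    ext1
    · exact h₁
    · exact h₂

/-- The conjugates of `a` by powers of `t` are the single lamps at all places, and they generate all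
finite configurations. So a solution may be sought as an arbitrary pair `(δ, f)`. -/
theorem evalConst_surjective : Function.Surjective evalConst := by
  have ha : a ∈ evalConst.range := ⟨FreeGroup.of .a, by simp [evalConst]⟩
  have ht : t ∈ evalConst.range := ⟨FreeGroup.of .t, by simp [evalConst]⟩
  have htn : ∀ n : ℤ, t ^ n = ⟨n, 0⟩ := by
    intro n
    induction n using Int.induction_on with
    | zero => rfl
    | succ n ih => rw [zpow_add_one, ih]; ext1 <;> simp [t]
    | pred n ih => rw [zpow_sub_one, ih]; ext1 <;> simp [t, sub_eq_add_neg]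
  have hzpow : ∀ n : ℤ, (⟨n, 0⟩ : Lamplighter) ∈ evalConst.range := fun n => by
    rw [← htn]; exact zpow_mem ht n
  have key : ∀ f : LaurentPolynomial (ZMod 2), (⟨0, f⟩ : Lamplighter) ∈ evalConst.range := by
    intro f
    induction f using LaurentPolynomial.induction_on' with
    | add p q hp hq =>
      have : (⟨0, p + q⟩ : Lamplighter) = ⟨0, p⟩ * ⟨0, q⟩ := by ext1 <;> simp
      rw [this]
      exact mul_mem hp hq
    | C_mul_T n x =>
      have hx : x = 0 ∨ x = 1 := by revert x; decide
      rcases hx with rfl | rfl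
      · have : (⟨0, C 0 * T n⟩ : Lamplighter) = 1 := by ext1 <;> simp
        rw [this]
        exact one_mem _
      · have : (⟨0, C 1 * T n⟩ : Lamplighter) = ⟨n, 0⟩ * a * ⟨-n, 0⟩ := by ext1 <;> simp [a]
        rw [this]
        exact mul_mem (mul_mem (hzpow _) ha) (hzpow _)
  intro g
  have : g = ⟨g.pos, 0⟩ * ⟨0, g.lamps⟩ := by ext1 <;> simp
  rw [← MonoidHom.mem_range, this]
  exact mul_mem (hzpow _) (key _)

end Lamplighter

theorem mem_DP1Lamplighter_iff (w : FreeGroup EqLetter) :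
    w ∈ DP1Lamplighter ↔ ∃ g, evalEq g w = 1 := by
  constructor
  · rintro ⟨s, hs⟩
    exact ⟨_, hs⟩
  · rintro ⟨g, hg⟩
    obtain ⟨s, rfl⟩ := Lamplighter.evalConst_surjective g
    exact ⟨s, hg⟩

/-! ### Reading the equation -/

namespace Lamplighter

/-- The value of a letter when `x` has the value `g`. -/
noncomputable def letterVal (g : Lamplighter) (l : EqLetter × Bool) : Lamplighter :=
  cond l.2 (match l.1 with | .a => a | .t => t | .x => g)
    (match l.1 with | .a => a | .t => t | .x => g)⁻¹

theorem evalEq_eq_prod (g : Lamplighter) (w : FreeGroup EqLetter) :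
    evalEq g w = (w.toWord.map (letterVal g)).prod := by
  conv_lhs => rw [← FreeGroup.mk_toWord (x := w)]
  rw [evalEq, FreeGroup.lift_mk]
  rfl

/-- The contribution of a letter to the exponent sum of `x`. -/
def xSign (l : EqLetter × Bool) : ℤ := if l.1 = .x then (if l.2 then 1 else -1) else 0

/-- The contribution of a letter to the exponent sum of `t`. -/
def tSign (l : EqLetter × Bool) : ℤ := if l.1 = .t then (if l.2 then 1 else -1) else 0

theorem letterVal_pos (g : Lamplighter) (l : EqLetter × Bool) :
    (letterVal g l).pos = xSign l * g.pos + tSign l := by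
  obtain ⟨_ | _ | _, _ | _⟩ := l <;> simp [letterVal, xSign, tSign, a, t]

theorem prod_letterVal_pos (g : Lamplighter) (L : List (EqLetter × Bool)) :
    (L.map (letterVal g)).prod.pos = (L.map xSign).sum * g.pos + (L.map tSign).sum := by
  induction L with
  | nil => simp
  | cons l L ih =>
    simp only [List.map_cons, List.prod_cons, List.sum_cons, mul_pos, ih, letterVal_pos]
    ring

end Lamplighter

/-! ### Exponent sums, and the coefficients of the lamp equation -/

namespace IntProg

open RAM Polynomial Lamplighter LaurentPolynomial

/-- Computes the exponent sums of `x` and `t`. -/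
def countProg : Cmd :=
  .loop 24 (V 0) (.assign 3 (.inp (V 24)) ;;
    .ite (V 3 - 3) (.assign 1 (V 1 + (9 - 2 * V 3)))
      (.ite (V 3 - 1) (.assign 2 (V 2 + (5 - 2 * V 3))) (.assign 2 (V 2))))

theorem getD_letterCodes {w : FreeGroup EqLetter} {j : ℕ} (hj : j < w.toWord.length) :
    (letterCodes w).getD j 0 = letterCode w.toWord[j] := by
  rw [letterCodes, List.getD_eq_getElem _ _ (by simpa using hj), List.getElem_map]

theorem countProg_tri {B : ℤ} {w : FreeGroup EqLetter} (hB : (w.norm : ℤ) + 20 ≤ B) :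
    Tri B countProg (initSt w) (200 * (w.norm + 1)) (fun s' =>
      (s'.var 1 = (w.toWord.map xSign).sum ∧ s'.var 2 = (w.toWord.map tSign).sum ∧
        |s'.var 1| ≤ w.norm ∧ |s'.var 2| ≤ w.norm) ∧ Frame countProg (initSt w) s') := by
  have hn : w.toWord.length = w.norm := rfl
  refine (Tri.loop_frame (T := 100) (n := w.norm) (fun j s' =>
    s'.var 1 = ((w.toWord.take j).map xSign).sum ∧ s'.var 2 = ((w.toWord.take j).map tSign).sum ∧
    |s'.var 1| ≤ j ∧ |s'.var 2| ≤ j) (by simp) (by simp [initSt]) (by simp [initSt])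
    fun j hj s' hs' hf => ?_).mono ?_ ?_
  · obtain ⟨h₁, h₂, h₃, h₄⟩ := hs'
    rw [← hn] at hj
    have hi : s'.inp = letterCodes w := hf.inp
    have hc := getD_letterCodes hj
    have hlen : (j : ℤ) < (letterCodes w).length := by
      rw [length_letterCodes, ← hn]; exact_mod_cast hj
    have hjB : (j : ℤ) + 20 ≤ B := by
      have : (j : ℤ) < w.norm := by rw [← hn]; exact_mod_cast hj
      linarith
    have h20 : 20 ≤ B := by linarith [Int.natCast_nonneg j]
    rw [List.take_add_one, List.getElem?_eq_getElem hj, Option.toList_some, List.map_append,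
      List.map_append, List.sum_append, List.sum_append, ← h₁, ← h₂]
    rw [abs_le] at h₃ h₄
    rcases hl : w.toWord[j] with ⟨_ | _ | _, _ | _⟩ <;> rw [hl] at hc <;>
      simp only [letterCode, Bool.false_eq_true, if_true, if_false, Nat.reduceAdd] at hc
    all_goals
      refine ⟨?_, ?_, ?_, ?_, ?_, ?_⟩
      · simp [Cmd.Safe, Cmd.eval, hi, hc, hlen, -List.getD_eq_getElem?_getD]
        and_intros <;> first | linarith | (rw [abs_le]; constructor <;> linarith)
      · simp [Cmd.cost, Cmd.eval, hi, hc, -List.getD_eq_getElem?_getD]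
      · simp [Cmd.eval, hi, hc, xSign, -List.getD_eq_getElem?_getD]
      · simp [Cmd.eval, hi, hc, tSign, -List.getD_eq_getElem?_getD]
      · simp [Cmd.eval, hi, hc, -List.getD_eq_getElem?_getD]
        rw [abs_le]; constructor <;> linarith
      · simp [Cmd.eval, hi, hc, -List.getD_eq_getElem?_getD]
        rw [abs_le]; constructor <;> linarith
  · simp only [Ex.size_var]; omega
  · rintro s' ⟨⟨h₁, h₂, h₃, h₄⟩, hf⟩
    rw [← hn, List.take_length] at h₁ h₂
    exact ⟨⟨h₁, h₂, h₃, h₄⟩, hf⟩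

/-- The array `a` holds the coefficients of `p`. -/
def HoldsAll (a : ℕ → ℤ) (p : (ZMod 2)[X]) : Prop := ∀ i, a i = ((p.coeff i).val : ℤ)

theorem HoldsAll.toggle {a : ℕ → ℤ} {p : (ZMod 2)[X]} (h : HoldsAll a p) (m : ℕ) :
    HoldsAll (Function.update a m (1 - a m)) (p + X ^ m) := by
  intro i
  rw [Function.update_apply, coeff_add, coeff_X_pow]
  split_ifs with hi
  · rw [h m, hi]
    generalize p.coeff m = x
    revert x
    decide
  · rw [h i, add_zero]

/-- The state of the scan after the letters `L`: the lamplighter is at `p - E`, and the lamps are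
`Q + P * f` if `x` is `(δ, f)`, shifted by `E`, where the arrays `a` and `b` hold `P` and `Q`. -/
structure Scanned (E n : ℕ) (δ : ℤ) (L : List (EqLetter × Bool)) (p : ℤ) (a b : ℕ → ℤ) : Prop where
  abs_le : |p - E| ≤ L.length * (n + 1)
  pos : ∀ f, (L.map (letterVal ⟨δ, f⟩)).prod.pos = p - E
  lamps : ∃ P Q : (ZMod 2)[X], HoldsAll a P ∧ HoldsAll b Q ∧
    (∀ i ≥ 2 * E, P.coeff i = 0 ∧ Q.coeff i = 0) ∧
    ∀ f, T E * (L.map (letterVal ⟨δ, f⟩)).prod.absLamps = toLaurent Q + toLaurent P * f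

namespace Scanned

variable {E n : ℕ} {δ p : ℤ} {L : List (EqLetter × Bool)} {a b : ℕ → ℤ}

theorem nil : Scanned E n δ [] E (fun _ => 0) (fun _ => 0) := by
  refine ⟨by simp, by simp, 0, 0, fun _ => by simp, fun _ => by simp, by simp, fun f => ?_⟩
  simp [absLamps]

/-- The choice of `E` is made here: at most `n` letters, each moving by at most `n + 1`, keep the
lamplighter within `n * (n + 1) < E` of the origin. After the shift by `E` all array indices are
nonnegative and below `2 * E`. -/
theorem range (h : Scanned E n δ L p a b) (hE : E = (n + 1) ^ 2) (hL : L.length ≤ n) :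
    0 < p ∧ p < 2 * E := by
  have h₁ := h.abs_le
  have h₂ : (L.length : ℤ) * (n + 1) ≤ n * (n + 1) := by gcongr
  have h₃ : (E : ℤ) = n * (n + 1) + n + 1 := by rw [hE]; push_cast; ring
  rw [_root_.abs_le] at h₁
  constructor <;> linarith

theorem move (h : Scanned E n δ L p a b) {l : EqLetter × Bool} {e : ℤ} (he : |e| ≤ n + 1)
    (hl : ∀ f, (letterVal ⟨δ, f⟩ l).pos = e) :
    |p + e - E| ≤ (L ++ [l]).length * (n + 1) ∧
      ∀ f, ((L ++ [l]).map (letterVal ⟨δ, f⟩)).prod.pos = p + e - E := by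
  constructor
  · have h₁ := h.abs_le
    simp only [List.length_append, List.length_singleton]
    push_cast
    rw [_root_.abs_le] at *
    constructor <;> linarith
  · intro f
    simp only [List.map_append, List.prod_append, List.map_singleton, List.prod_singleton, mul_pos,
      h.pos, hl]
    ring

theorem absLamps_append (h : Scanned E n δ L p a b) (l : EqLetter × Bool)
    (f : LaurentPolynomial (ZMod 2)) :
    T E * ((L ++ [l]).map (letterVal ⟨δ, f⟩)).prod.absLamps =
      T E * (L.map (letterVal ⟨δ, f⟩)).prod.absLamps + T p * (letterVal ⟨δ, f⟩ l).absLamps := by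
  simp only [List.map_append, List.prod_append, List.map_singleton, List.prod_singleton,
    absLamps_mul, h.pos, mul_add, ← mul_assoc, ← T_add]
  rw [add_sub_cancel]

theorem append_t (h : Scanned E n δ L p a b) (ε : Bool) :
    Scanned E n δ (L ++ [(.t, ε)]) (p + if ε then 1 else -1) a b := by
  obtain ⟨h₁, h₂⟩ := h.move (l := (.t, ε)) (e := if ε then 1 else -1)
    (by rcases ε with _ | _ <;> simp) (fun f => by rcases ε with _ | _ <;> simp [letterVal, t])
  obtain ⟨P, Q, hP, hQ, hd, hPQ⟩ := h.lamps
  refine ⟨h₁, h₂, P, Q, hP, hQ, hd, fun f => ?_⟩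
  rw [h.absLamps_append, hPQ]
  rcases ε with _ | _ <;> simp [letterVal, absLamps, t]

theorem append_a (h : Scanned E n δ L p a b) (ε : Bool) {m : ℕ} (hm : p = m) (hmE : m < 2 * E) :
    Scanned E n δ (L ++ [(.a, ε)]) p a (Function.update b m (1 - b m)) := by
  obtain ⟨h₁, h₂⟩ := h.move (l := (.a, ε)) (e := 0) (by simp; positivity)
    (fun f => by rcases ε with _ | _ <;> simp [letterVal, Lamplighter.a])
  rw [add_zero] at h₁
  simp only [add_zero] at h₂
  obtain ⟨P, Q, hP, hQ, hd, hPQ⟩ := h.lamps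
  refine ⟨h₁, h₂, P, Q + X ^ m, hP, hQ.toggle m, fun i hi => ⟨(hd i hi).1, ?_⟩, fun f => ?_⟩
  · rw [coeff_add, (hd i hi).2, coeff_X_pow, if_neg (by omega), add_zero]
  · have : (letterVal ⟨δ, f⟩ (.a, ε)).absLamps = 1 := by
      rcases ε with _ | _
      · exact (absLamps_inv _).trans rfl
      · simp [letterVal, absLamps, Lamplighter.a]
    rw [h.absLamps_append, hPQ, this, map_add, toLaurent_X_pow, hm]
    ring

/-- For `x` the copy of `f` is placed after the move, because `absLamps` of `(δ, f)` is `f` shifted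
by `δ`. For the inverse it is placed before the move, by `absLamps_inv`. The order of toggling and
moving in `scanProg` reflects this. -/
theorem append_x (h : Scanned E n δ L p a b) (hδ : |δ| ≤ n + 1) {m : ℕ} (hm : p + δ = m)
    (hmE : m < 2 * E) :
    Scanned E n δ (L ++ [(.x, true)]) (p + δ) (Function.update a m (1 - a m)) b := by
  obtain ⟨h₁, h₂⟩ := h.move (l := (.x, true)) (e := δ) hδ (fun f => by simp [letterVal])
  obtain ⟨P, Q, hP, hQ, hd, hPQ⟩ := h.lamps
  refine ⟨h₁, h₂, P + X ^ m, Q, hP.toggle m, hQ, fun i hi => ⟨?_, (hd i hi).2⟩, fun f => ?_⟩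
  · rw [coeff_add, (hd i hi).1, coeff_X_pow, if_neg (by omega), add_zero]
  · have : (letterVal ⟨δ, f⟩ (.x, true)).absLamps = f * T δ := by simp [letterVal, absLamps]
    rw [h.absLamps_append, hPQ, this, map_add, toLaurent_X_pow, ← hm, T_add]
    ring

theorem append_x_inv (h : Scanned E n δ L p a b) (hδ : |δ| ≤ n + 1) {m : ℕ} (hm : p = m)
    (hmE : m < 2 * E) :
    Scanned E n δ (L ++ [(.x, false)]) (p - δ) (Function.update a m (1 - a m)) b := by
  obtain ⟨h₁, h₂⟩ := h.move (l := (.x, false)) (e := -δ) (by rwa [abs_neg])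
    (fun f => by simp [letterVal])
  rw [← sub_eq_add_neg] at h₁
  simp only [← sub_eq_add_neg] at h₂
  obtain ⟨P, Q, hP, hQ, hd, hPQ⟩ := h.lamps
  refine ⟨h₁, h₂, P + X ^ m, Q, hP.toggle m, hQ, fun i hi => ⟨?_, (hd i hi).2⟩, fun f => ?_⟩
  · rw [coeff_add, (hd i hi).1, coeff_X_pow, if_neg (by omega), add_zero]
  · have : (letterVal ⟨δ, f⟩ (.x, false)).absLamps = f := absLamps_inv _
    rw [h.absLamps_append, hPQ, this, map_add, toLaurent_X_pow, hm]
    ring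

end Scanned

def toggle (j : Fin 16) : Cmd := .store j (V 13) (1 - .get j (V 13))

/-- Computes the equation for the lamps. Variable `5` is the initial position `E`, and variable `4`
is the position `δ` of `x`. -/
def scanProg : Cmd :=
  .assign 13 (V 5) ;;
  .loop 24 (V 0) (.assign 3 (.inp (V 24)) ;;
    .ite (V 3 - 4) (toggle 0 ;; .assign 13 (V 13 - V 4))
      (.ite (V 3 - 3) (.assign 13 (V 13 + V 4) ;; toggle 0)
        (.ite (V 3 - 2) (.assign 13 (V 13 - 1))
          (.ite (V 3 - 1) (.assign 13 (V 13 + 1)) (toggle 1)))))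

theorem scanProg_tri {B δ : ℤ} {w : FreeGroup EqLetter} {E : ℕ} {s : St}
    (hE : E = (w.norm + 1) ^ 2) (hB : 3 * (E : ℤ) + 20 ≤ B) (h0 : s.var 0 = w.norm)
    (h4 : s.var 4 = δ) (h5 : s.var 5 = E) (hδ : |δ| ≤ w.norm + 1) (hi : s.inp = letterCodes w)
    (ha : s.arr 0 = fun _ => 0) (hb : s.arr 1 = fun _ => 0) :
    Tri B scanProg s (300 * (w.norm + 1)) (fun s' =>
      Scanned E w.norm δ w.toWord (s'.var 13) (s'.arr 0) (s'.arr 1) ∧ Frame scanProg s s') := by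
  have hn : w.toWord.length = w.norm := rfl
  refine (Tri.frame ?_).mono le_rfl fun s' h => h
  refine (Tri.assign (Q := fun s' => s' = s.setVar 13 E) (by simp) (by simp [h5])).then
    (T₂ := w.norm * 257 + 6) (fun s₁ hs₁ => ?_) (by simp; omega)
  subst hs₁
  refine (Tri.loop_frame (T := 250) (n := w.norm) (fun j s' =>
    Scanned E w.norm δ (w.toWord.take j) (s'.var 13) (s'.arr 0) (s'.arr 1)) (by simp)
    (by simp [h0]) ?_ fun j hj s' hs' hf => ?_).mono (by simp) ?_
  · simp only [List.take_zero, St.setVar_var, St.setVar_arr, ha, hb, if_true]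
    exact Scanned.nil
  · rw [← hn] at hj
    have hi : s'.inp = letterCodes w := by rw [hf.inp]; exact hi
    have e4 : s'.var 4 = δ := by rw [hf.var 4 rfl]; simpa using h4
    have hc := getD_letterCodes hj
    have hlen : (j : ℤ) < (letterCodes w).length := by
      rw [length_letterCodes, ← hn]; exact_mod_cast hj
    obtain ⟨r₁, r₂⟩ := hs'.range hE (by rw [List.length_take]; omega)
    have hnE : (w.norm : ℤ) + 1 ≤ E := by
      rw [hE]; push_cast; nlinarith [Int.natCast_nonneg w.norm]
    have hjn : (j : ℤ) < w.norm := by rw [← hn]; exact_mod_cast hj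
    obtain ⟨m, hm⟩ : ∃ m : ℕ, s'.var 13 = m := ⟨_, (Int.toNat_of_nonneg r₁.le).symm⟩
    have hmE : m < 2 * E := by omega
    have htake : w.toWord.take (j + 1) = w.toWord.take j ++ [w.toWord[j]] := by
      rw [List.take_add_one, List.getElem?_eq_getElem hj, Option.toList_some]
    have hbit : ∀ q : ℕ, 0 ≤ s'.arr 0 q ∧ s'.arr 0 q ≤ 1 ∧ 0 ≤ s'.arr 1 q ∧ s'.arr 1 q ≤ 1 := by
      obtain ⟨P, Q, hP, hQ, -⟩ := hs'.lamps
      intro q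
      rw [hP q, hQ q]
      have h₁ := val_le_one (P.coeff q)
      have h₂ := val_le_one (Q.coeff q)
      omega
    obtain ⟨c₁, c₂, c₃, c₄⟩ := hbit m
    rw [abs_le] at hδ
    rcases hl : w.toWord[j] with ⟨_ | _ | _, _ | _⟩ <;> rw [hl] at hc htake <;>
      simp only [letterCode, Bool.false_eq_true, if_true, if_false, Nat.reduceAdd] at hc <;>
      rw [htake]
    case refine_2.x.true =>
      have hs := hs'
      obtain ⟨q₁, q₂⟩ := (hs'.move (l := (.x, true)) (e := δ) (abs_le.2 hδ)
        (fun f => by simp [letterVal]))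
      -- The bit is toggled at the position after the move, so this position must lie in the arrays
      -- too.
      have q₃ : 0 < s'.var 13 + δ ∧ s'.var 13 + δ < 2 * E := by
        rw [← htake, List.length_take] at q₁
        have h₂ : ((min (j + 1) w.toWord.length : ℕ) : ℤ) * (w.norm + 1) ≤
            w.norm * (w.norm + 1) := by
          gcongr
          omega
        have h₃ : (E : ℤ) = w.norm * (w.norm + 1) + w.norm + 1 := by rw [hE]; push_cast; ring
        rw [abs_le] at q₁
        constructor <;> linarith
      obtain ⟨m', hm'⟩ : ∃ m' : ℕ, (m : ℤ) + δ = m' :=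
        ⟨_, (Int.toNat_of_nonneg (by rw [← hm]; exact q₃.1.le)).symm⟩
      obtain ⟨c₁, c₂, c₃, c₄⟩ := hbit m'
      refine ⟨?_, ?_, ?_⟩
      · simp [Cmd.Safe, Cmd.eval, toggle, hi, hc, hlen, hm, e4, hm', -List.getD_eq_getElem?_getD]
        and_intros <;> first | linarith | (rw [abs_le]; constructor <;> linarith)
      · simp [Cmd.cost, Cmd.eval, toggle, hi, hc, -List.getD_eq_getElem?_getD]
      · have := hs'.append_x (abs_le.2 hδ) (m := m') (by rw [hm, hm']) (by omega)
        rw [hm, hm'] at this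
        simpa [Cmd.eval, toggle, hi, hc, hm, e4, hm', -List.getD_eq_getElem?_getD, St.setArr]
          using this
    all_goals
      refine ⟨?_, ?_, ?_⟩
      · simp [Cmd.Safe, Cmd.eval, toggle, hi, hc, hlen, hm, e4, -List.getD_eq_getElem?_getD]
        and_intros <;> first | linarith | (rw [abs_le]; constructor <;> linarith)
      · simp [Cmd.cost, Cmd.eval, toggle, hi, hc, -List.getD_eq_getElem?_getD]
    · have := hs'.append_a false hm hmE
      simpa [Cmd.eval, toggle, hi, hc, hm, e4, -List.getD_eq_getElem?_getD, St.setArr] using this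
    · have := hs'.append_a true hm hmE
      simpa [Cmd.eval, toggle, hi, hc, hm, e4, -List.getD_eq_getElem?_getD, St.setArr] using this
    · have := hs'.append_t false
      simpa [← sub_eq_add_neg, Cmd.eval, toggle, hi, hc, hm, e4, -List.getD_eq_getElem?_getD, St.setArr] using this
    · have := hs'.append_t true
      simpa [Cmd.eval, toggle, hi, hc, hm, e4, -List.getD_eq_getElem?_getD, St.setArr] using this
    · have := hs'.append_x_inv (abs_le.2 hδ) hm hmE
      simpa [Cmd.eval, toggle, hi, hc, hm, e4, -List.getD_eq_getElem?_getD, St.setArr] using this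
  · rintro s' ⟨h, -⟩
    rwa [← hn, List.take_length] at h

end IntProg

namespace IntProg

open RAM Polynomial Lamplighter LaurentPolynomial FixedFFT

/-- The rule for a loop whose rounds have different costs. -/
theorem Tri.loop_sum {B : ℤ} {v : ℕ} {e : Ex} {c : Cmd} {s : St} {T : ℕ → ℕ} {n : ℕ}
    (Inv : ℕ → St → Prop) (he : e.Safe B s) (hn : e.eval s = n) (h₀ : Inv 0 s)
    (h : ∀ j < n, ∀ s', Inv j s' → Frame (.loop v e c) s s' →
      Tri B c (s'.setVar v j) (T j) (Inv (j + 1))) :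
    Tri B (.loop v e c) s ((∑ j ∈ Finset.range n, (T j + 7)) + e.size + 4)
      (fun s' => Inv n s' ∧ Frame (.loop v e c) s s') := by
  have h' : ∀ j < n, ∀ s', Inv j s' ∧ Frame (.loop v e c) s s' →
      Tri B c (s'.setVar v j) (T j) (fun s'' => Inv (j + 1) s'' ∧ Frame (.loop v e c) s s'') := by
    rintro j hj s' ⟨hs', hf⟩
    refine (h j hj s' hs' hf).frame.mono le_rfl fun s'' hs'' => ⟨hs''.1, fun w hw => ?_,
      fun a ha => ?_, ?_⟩
    · have hw' := hw
      simp only [Cmd.keepsVar, Bool.and_eq_true, bne_iff_ne] at hw'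
      rw [hs''.2.var w hw'.2, ← hf.var w hw]
      exact Function.update_of_ne hw'.1.symm _ _
    · have ha' := ha
      simp only [Cmd.keepsArr] at ha'
      rw [hs''.2.arr a ha', ← hf.arr a ha]
      rfl
    · rw [hs''.2.inp, ← hf.inp]
      rfl
  have hn' : (e.eval s).toNat = n := by omega
  have key : ∀ j ≤ n, Inv j (iter c.eval v j s) ∧ Frame (.loop v e c) s (iter c.eval v j s) := by
    intro j
    induction j with
    | zero => exact fun _ => ⟨h₀, fun _ _ => rfl, fun _ _ => rfl, rfl⟩
    | succ j ih => exact fun hj => (h' j hj _ (ih (by omega))).post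
  refine ⟨⟨he, fun j hj => ?_⟩, ?_, ?_⟩
  · rw [hn'] at hj
    exact (h' j hj _ (key j hj.le)).safe
  · have : ∑ j ∈ Finset.range n, (c.cost ((iter c.eval v j s).setVar v j) + 7) ≤
        ∑ j ∈ Finset.range n, (T j + 7) := by
      refine Finset.sum_le_sum fun j hj => ?_
      have hj := Finset.mem_range.1 hj
      have := (h' j hj _ (key j hj.le)).cost
      omega
    rw [Cmd.cost, hn']
    omega
  · rw [Cmd.eval, hn']
    exact key n le_rfl

/-! ### Auxiliary programs -/

/-- Computes the least power `K = 2 ^ k` of two with `2 * E < K`. -/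
def powProg : Cmd :=
  .assign 6 1 ;; .assign 7 0 ;; .loop 24 (2 * V 0 + 4)
    (.ite (2 * V 5 + 1 - V 6) (.assign 6 (2 * V 6) ;; .assign 7 (V 7 + 1)) (.assign 6 (V 6)))

/-- Doubling happens only while `2 ^ k ≤ 2 * E`, whence `2 ^ k ≤ 4 * E`. There are enough rounds
because `2 ^ (2 * n + 4) = 4 * (2 ^ (n + 1)) ^ 2` exceeds `2 * (n + 1) ^ 2`. -/
theorem powProg_tri {B : ℤ} {n E : ℕ} {s : St} (h0 : s.var 0 = n) (h5 : s.var 5 = E)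
    (hE : E = (n + 1) ^ 2) (hB : 4 * (E : ℤ) + 20 ≤ B) :
    Tri B powProg s (800 * (n + 1)) (fun s' => (∃ k : ℕ, s'.var 6 = (2 ^ k : ℕ) ∧ s'.var 7 = k ∧
      2 * E < 2 ^ k ∧ 2 ^ k ≤ 4 * E) ∧ Frame powProg s s') := by
  have hE1 : 1 ≤ E := by rw [hE]; exact Nat.one_le_pow _ _ (by omega)
  have hnE : (n : ℤ) + 1 ≤ E := by
    rw [hE]; push_cast; nlinarith [Int.natCast_nonneg n]
  refine (Tri.frame ?_).mono le_rfl fun s' h => h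
  refine (Tri.assign (Q := fun s' => s' = s.setVar 6 1) (by simp; linarith) (by simp)).then
    (T₂ := (2 * n + 4) * 97 + 84) (fun s₁ hs₁ => ?_) (by simp; omega)
  refine (Tri.assign (Q := fun s' => s' = s₁.setVar 7 0) (by simp; linarith) (by simp)).then
    (T₂ := (2 * n + 4) * 97 + 50) (fun s₂ hs₂ => ?_) (by simp; omega)
  subst hs₁ hs₂
  refine (Tri.loop_frame (T := 90) (n := 2 * n + 4) (fun j s' => ∃ k : ℕ, s'.var 6 = (2 ^ k : ℕ) ∧
    s'.var 7 = k ∧ k ≤ j ∧ 2 ^ k ≤ 4 * E ∧ (2 * E < 2 ^ k ∨ k = j)) ?_ (by simp [h0]) ?_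
    fun j hj s' hs' hf => ?_).mono (by simp) ?_
  · simp [h0, -abs_mul]
    and_intros <;> first | linarith | (apply abs_le_of_nonneg <;> linarith)
  · exact ⟨0, by simp, by simp, le_rfl, by rw [pow_zero]; omega, Or.inr rfl⟩
  · obtain ⟨k, h6, h7, hkj, hk, hor⟩ := hs'
    have e5 : s'.var 5 = E := by rw [hf.var 5 rfl]; simpa using h5
    obtain ⟨K, hK⟩ : ∃ K, K = 2 ^ k := ⟨_, rfl⟩
    rw [← hK] at h6 hk hor
    have hk' : (K : ℤ) ≤ 4 * E := by exact_mod_cast hk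
    have hk0 : (0 : ℤ) ≤ K := by positivity
    have hjn : (j : ℤ) < 2 * n + 4 := by exact_mod_cast hj
    have hkj' : (k : ℤ) ≤ j := by exact_mod_cast hkj
    refine (Tri.ite (T := 50) ?_ (fun h => ?_) (fun h => ?_)).mono (by simp) fun _ h => h
    · simp [e5, h6, -abs_mul]
      and_intros <;> first | linarith | (rw [abs_le]; constructor <;> linarith)
    · simp [e5, h6] at h
      have h2 : K ≤ 2 * E := by omega
      refine ⟨?_, by simp [Cmd.cost], k + 1, ?_, ?_, by omega, by rw [pow_succ, ← hK]; omega, ?_⟩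
      · simp [Cmd.Safe, Cmd.eval, h6, h7, -abs_mul]
        and_intros <;> first | linarith | (rw [abs_le]; constructor <;> linarith)
      · simp [Cmd.eval, h6, pow_succ', hK]
      · simp [Cmd.eval, h7]
      · rcases hor with h | h
        · omega
        · exact Or.inr (by omega)
    · simp [e5, h6] at h
      refine (Tri.assign (by simp) ⟨k, by simp [h6, hK], by simpa using h7, by omega, hK ▸ hk,
        Or.inl (by omega)⟩).mono (by simp) fun _ h => h
  · rintro s' ⟨⟨k, h6, h7, hkj, hk, hor⟩, -⟩
    refine ⟨k, h6, h7, ?_, hk⟩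
    rcases hor with h | rfl
    · exact h
    · have h₁ : n + 1 < 2 ^ (n + 1) := Nat.lt_two_pow_self
      have h₂ : 2 ^ (2 * n + 4) = 4 * (2 ^ (n + 1)) ^ 2 := by ring
      rw [h₂, hE]
      nlinarith

def clear (j : Fin 16) : Cmd := .loop 25 (V 20) (.store j (V 25) 0)

def copyTo (d j : Fin 16) (e : Ex) : Cmd := .loop 25 e (.store d (V 25) (.get j (V 25)))

/-- Copies a prefix of an array, padded with zeros. -/
def loadPad (d j : Fin 16) (e : Ex) : Cmd := clear d ;; copyTo d j e

theorem clear_tri {B : ℤ} {s : St} {j : Fin 16} {M : ℕ} (h : s.var 20 = M) (hB : 0 ≤ B) :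
    Tri B (clear j) s (30 * M + 10) (fun s' => (∀ i < M, s'.arr j i = 0) ∧ Frame (clear j) s s') := by
  refine (Tri.loop_fill (T := 20) (n := M) j j (fun _ => 0) (fun _ => 0) (by simp) (by simpa using h)
    fun i hi s' hf _ _ => ⟨by simpa [Cmd.Safe] using hB, by simp [Cmd.cost], ?_⟩).mono
    (by simp; omega) fun s' hs' => ⟨hs'.1.1, hs'.2⟩
  simp [Cmd.eval]

theorem copyTo_tri {B : ℤ} {s : St} {d j : Fin 16} {e : Ex} {n : ℕ} (hdj : d ≠ j)
    (he : e.Safe B s) (hn : e.eval s = n) :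
    Tri B (copyTo d j e) s (40 * n + e.size + 10) (fun s' => ((∀ i < n, s'.arr d i = s.arr j i) ∧
      ∀ i ≥ n, s'.arr d i = s.arr d i) ∧ Frame (copyTo d j e) s s') := by
  refine (Tri.loop_fill (T := 30) (n := n) d d (s.arr j) (s.arr j) he hn
    fun i hi s' hf _ _ => ⟨by simp [Cmd.Safe], by simp [Cmd.cost], ?_⟩).mono
    (by omega) fun s' hs' => ⟨⟨hs'.1.1, hs'.1.2.2.1⟩, hs'.2⟩
  have := hf.arr j (by simpa [Cmd.keepsArr] using hdj)
  simp [Cmd.eval, this]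

theorem loadPad_tri {B : ℤ} {s : St} {d j : Fin 16} {e : Ex} {n M : ℕ} {p : (ZMod 2)[X]}
    (hdj : d ≠ j) (h : s.var 20 = M) (hB : 0 ≤ B)
    (he : ∀ s' : St, (∀ v ≠ 25, s'.var v = s.var v) → e.Safe B s' ∧ e.eval s' = n)
    (hp : Holds n (s.arr j) p) :
    Tri B (loadPad d j e) s (30 * M + 40 * n + e.size + 20) (fun s' =>
      Holds M (s'.arr d) (trunc n p) ∧ Frame (loadPad d j e) s s') := by
  refine (Tri.frame ?_).mono le_rfl fun s' h => h
  refine (clear_tri h hB).then (T₂ := 40 * n + e.size + 10) (fun s₁ h₁ => ?_) (by omega)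
  obtain ⟨e₁, e₂⟩ := he s₁ fun v hv =>
    h₁.2.var v (by simpa [clear, Cmd.keepsVar] using hv.symm)
  refine (copyTo_tri hdj e₁ e₂).mono le_rfl fun s₂ h₂ i hi => ?_
  rw [coeff_trunc]
  split_ifs with hin
  · rw [h₂.1.1 i hin, h₁.2.arr j (by simpa [clear, Cmd.keepsArr] using hdj), hp i hin]
  · rw [h₂.1.2 i (by omega), h₁.1 i hi, ZMod.val_zero, Nat.cast_zero]

/-- Spreads an array: `B[2 * i] := V[i]`. -/
def spread : Cmd := clear 5 ;; .loop 25 (V 12) (.store 5 (2 * V 25) (.get 3 (V 25)))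

/-- Over `ℤ₂` this computes the square of `v` in linear time, as required by `dvd_inverse_step`. -/
theorem spread_tri {B : ℤ} {s : St} {L : ℕ} {v : (ZMod 2)[X]} (h12 : s.var 12 = L)
    (h20 : s.var 20 = (4 * L : ℕ)) (hB : 4 * (L : ℤ) + 2 ≤ B) (hv : Holds L (s.arr 3) v)
    (hd : v.natDegree < L) :
    Tri B spread s (300 * L + 30) (fun s' => Holds (4 * L) (s'.arr 5) (expand (ZMod 2) 2 v) ∧
      Frame spread s s') := by
  refine (Tri.frame ?_).mono le_rfl fun s' h => h
  refine (clear_tri h20 (by linarith [Int.natCast_nonneg L])).then (T₂ := 100 * L + 10)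
    (fun s₁ h₁ => ?_) (by omega)
  refine (Tri.loop_frame (T := 60) (n := L) (fun l s' => ∀ i < 4 * L, s'.arr 5 i =
    if 2 ∣ i ∧ i / 2 < l then ((v.coeff (i / 2)).val : ℤ) else 0) (by simp)
    (by simp [h₁.2.var 12 rfl, h12]) (fun i hi => by simp [h₁.1 i hi])
    fun l hl s' hs' hf => ?_).mono (by simp; omega) fun s' hs' i hi => ?_
  · have e3 : s'.arr 3 = s.arr 3 := by rw [hf.arr 3 rfl, h₁.2.arr 3 rfl]
    have hl' : (l : ℤ) < L := by exact_mod_cast hl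
    have ht : (2 * (l : ℤ)).toNat = 2 * l := by omega
    refine ⟨?_, by simp [Cmd.cost], fun i hi => ?_⟩
    · simp [Cmd.Safe, -abs_mul]
      and_intros <;> first | linarith | (apply abs_le_of_nonneg <;> linarith)
    · have h₂ := hs' i hi
      simp only [Cmd.eval, Ex.eval_mul, Ex.eval_num, Ex.eval_var, Ex.eval_get, St.setVar_var,
        if_true, Nat.cast_ofNat, ht, Int.toNat_natCast, St.setArr_arr, St.setVar_arr, true_and, e3]
      by_cases hil : i = 2 * l
      · subst hil
        rw [if_pos rfl, hv l hl, if_pos ⟨by simp, by omega⟩]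
        simp
      · rw [if_neg hil, h₂]
        congr 1
        apply propext
        constructor <;> rintro ⟨⟨a, rfl⟩, h⟩ <;> refine ⟨by simp, by omega⟩
  · rw [hs'.1 i hi, coeff_expand two_pos]
    by_cases h : 2 ∣ i
    · rw [if_pos h]
      split_ifs with h₂
      · rfl
      · rw [coeff_eq_zero_of_natDegree_lt (by by_contra h₃; exact h₂ ⟨h, by omega⟩)]
        simp
    · rw [if_neg h, if_neg fun h₂ => h h₂.1]
      simp

/-- Finds the lowest bit of the array `0`. -/
def lowProg : Cmd :=
  .assign 14 (V 6) ;; .loop 24 (V 6)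
    (.ite (.get 0 (V 6 - 1 - V 24)) (.assign 14 (V 6 - 1 - V 24)) (.assign 14 (V 14)))

/-- The scan runs downwards, so the last bit that it meets is the lowest one. The default `K` means
that there is no bit below `K`. -/
theorem lowProg_tri {B : ℤ} {s : St} {K : ℕ} {P : (ZMod 2)[X]} (h6 : s.var 6 = K)
    (hP : HoldsAll (s.arr 0) P) (hB : (K : ℤ) + 2 ≤ B) :
    Tri B lowProg s (100 * K + 30) (fun s' => (∃ lo : ℕ, s'.var 14 = lo ∧ lo ≤ K ∧
      (∀ i < lo, P.coeff i = 0) ∧ (lo < K → P.coeff lo = 1)) ∧ Frame lowProg s s') := by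
  refine (Tri.frame ?_).mono le_rfl fun s' h => h
  refine (Tri.assign (Q := fun s' => s' = s.setVar 14 K) (by simp) (by simp [h6])).then
    (T₂ := 87 * K + 10) (fun s₁ hs₁ => ?_) (by simp; omega)
  subst hs₁
  have hval : ∀ x : ZMod 2, (0 < x.val → x = 1) ∧ (¬0 < x.val → x = 0) := by decide
  refine (Tri.loop_frame (T := 80) (n := K) (fun j s' => ∃ lo : ℕ, s'.var 14 = lo ∧ lo ≤ K ∧
    (∀ i < lo, K - j ≤ i → P.coeff i = 0) ∧ (lo < K → P.coeff lo = 1) ∧ K - j ≤ lo) (by simp)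
    (by simp [h6]) ⟨K, by simp, le_rfl, by intros; omega, by simp, by omega⟩
    fun j hj s' hs' hf => ?_).mono (by simp; omega) ?_
  · obtain ⟨lo, h14, hlo, h₁, h₂, h₃⟩ := hs'
    have e0 : s'.arr 0 = s.arr 0 := by rw [hf.arr 0 rfl]; rfl
    have e6 : s'.var 6 = K := by rw [hf.var 6 rfl]; simpa using h6
    have ht : (K : ℤ) - 1 - j = (K - 1 - j : ℕ) := by omega
    have hKj : ((K - 1 - j : ℕ) : ℤ) ≤ K := by omega
    have hK1 : (1 : ℤ) ≤ K := by omega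
    refine (Tri.ite (T := 20) ?_ (fun h => ?_) (fun h => ?_)).mono (by simp) fun _ h => h
    · simp only [Ex.safe_get, Ex.safe_sub, Ex.safe_var, Ex.safe_num, Ex.eval_sub, Ex.eval_var,
        Ex.eval_num, St.setVar_var, Nat.reduceEqDiff, if_false, if_true, e6, Nat.cast_one, ht]
      and_intros <;> first | trivial | linarith | (apply abs_le_of_nonneg <;> omega)
    · have h' : 0 < ((P.coeff (K - 1 - j)).val : ℤ) := by
        simpa [e6, ht, e0, hP (K - 1 - j)] using h
      refine (Tri.assign ?_ ⟨K - 1 - j, by simp [e6, ht], by omega, fun i hi hi' => by omega,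
        fun _ => (hval _).1 (by exact_mod_cast h'), by omega⟩).mono (by simp) fun _ h => h
      simp only [Ex.safe_sub, Ex.safe_var, Ex.safe_num, Ex.eval_sub, Ex.eval_var,
        Ex.eval_num, St.setVar_var, Nat.reduceEqDiff, if_false, if_true, e6, Nat.cast_one, ht]
      and_intros <;> first | trivial | linarith | (apply abs_le_of_nonneg <;> omega)
    · have h' : ¬0 < ((P.coeff (K - 1 - j)).val : ℤ) := by
        have : ((P.coeff (K - 1 - j)).val : ℤ) ≤ 0 := by
          simpa [e6, ht, e0, hP (K - 1 - j)] using h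
        linarith
      refine (Tri.assign (by simp) ⟨lo, by simp [h14], hlo, fun i hi hi' => ?_, h₂,
        by omega⟩).mono (by simp) fun _ h => h
      rcases Nat.lt_or_ge i (K - j) with h₄ | h₄
      · have : i = K - 1 - j := by omega
        rw [this]
        exact (hval _).2 (by exact_mod_cast h')
      · exact h₁ i hi h₄
  · rintro s' ⟨⟨lo, h14, hlo, h₁, h₂, h₃⟩, -⟩
    exact ⟨lo, h14, hlo, fun i hi => h₁ i hi (by omega), h₂⟩

/-- Divides by the power of `X`. -/
def shiftProg : Cmd := .loop 25 (V 6) (.store 2 (V 25) (.get 0 (V 25 + V 14)))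

theorem shiftProg_tri {B : ℤ} {s : St} {K lo : ℕ} {P p : (ZMod 2)[X]} (h6 : s.var 6 = K)
    (h14 : s.var 14 = lo) (hlo : lo ≤ K) (hP : HoldsAll (s.arr 0) P) (hp : P = X ^ lo * p)
    (hB : 2 * (K : ℤ) ≤ B) :
    Tri B shiftProg s (100 * K + 30) (fun s' => Holds K (s'.arr 2) p ∧ Frame shiftProg s s') := by
  refine (Tri.loop_fill (T := 50) (n := K) 2 2 (fun i => ((p.coeff i).val : ℤ))
    (fun i => ((p.coeff i).val : ℤ)) (by simp) (by simpa using h6)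
    fun i hi s' hf _ _ => ⟨?_, by simp [Cmd.cost], ?_⟩).mono
    (by simp; omega) fun s' hs' => ⟨hs'.1.1, hs'.2⟩
  · have e14 : s'.var 14 = lo := by rw [hf.var 14 rfl, h14]
    have hi' : (i : ℤ) < K := by exact_mod_cast hi
    have hlo' : (lo : ℤ) ≤ K := by exact_mod_cast hlo
    simp only [Cmd.Safe, Ex.safe_get, Ex.safe_add, Ex.safe_var, Ex.eval_add, Ex.eval_var,
        St.setVar_var, Nat.reduceEqDiff, if_false, if_true, e14]
    and_intros <;> first | trivial | linarith | (apply abs_le_of_nonneg <;> omega)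
  · have e14 : s'.var 14 = lo := by rw [hf.var 14 rfl, h14]
    have e0 : s'.arr 0 = s.arr 0 := hf.arr 0 rfl
    have ht : ((i : ℤ) + lo).toNat = i + lo := by omega
    have := hP (i + lo)
    rw [hp, coeff_X_pow_mul] at this
    simp [Cmd.eval, e14, e0, ht, this]

/-- Compares the arrays `6` and `1`. -/
def compareProg : Cmd :=
  .assign 0 1 ;; .loop 24 (V 20)
    (.ite ((.get 6 (V 24) - .get 1 (V 24)) * (.get 6 (V 24) - .get 1 (V 24))) (.assign 0 0)
      (.assign 0 (V 0)))

/-- Conditionals test positivity only, so the program tests inequality by the square of the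
difference. -/
theorem compareProg_tri {B : ℤ} {s : St} {M : ℕ} {p q : (ZMod 2)[X]} (h20 : s.var 20 = M)
    (hp : Holds M (s.arr 6) p) (hq : HoldsAll (s.arr 1) q) (hB : 4 ≤ B) :
    Tri B compareProg s (100 * M + 30) (fun s' => 0 < s'.var 0 ↔ ∀ i < M, p.coeff i = q.coeff i) := by
  refine (Tri.assign (Q := fun s' => s' = s.setVar 0 1) (by simp; linarith) (by simp)).then
    (T₂ := 97 * M + 10) (fun s₁ hs₁ => ?_) (by simp; omega)
  subst hs₁
  refine (Tri.loop_frame (T := 90) (n := M) (fun j s' =>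
    (s'.var 0 = 1 ∧ ∀ i < j, p.coeff i = q.coeff i) ∨
      (s'.var 0 = 0 ∧ ∃ i < j, p.coeff i ≠ q.coeff i)) (by simp)
    (by simp [h20]) (Or.inl ⟨by simp, by simp⟩)
    fun j hj s' hs' hf => ?_).mono (by simp; omega) ?_
  · have e6 : s'.arr 6 j = ((p.coeff j).val : ℤ) := by rw [hf.arr 6 rfl]; exact hp j hj
    have e1 : s'.arr 1 j = ((q.coeff j).val : ℤ) := by rw [hf.arr 1 rfl]; exact hq j
    have hval : ∀ x y : ZMod 2,
        0 < ((x.val : ℤ) - y.val) * ((x.val : ℤ) - y.val) ↔ x ≠ y := by decide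
    have hab : ∀ x y : ZMod 2, |(x.val : ℤ) - y.val| ≤ 1 ∧
        |((x.val : ℤ) - y.val) * ((x.val : ℤ) - y.val)| ≤ 1 := by decide
    obtain ⟨a₁, a₂⟩ := hab (p.coeff j) (q.coeff j)
    refine (Tri.ite (T := 10) ?_ (fun h => ?_) (fun h => ?_)).mono (by simp) fun _ h => h
    · simp [e6, e1, -abs_mul, -ZMod.natCast_val]
      exact ⟨by linarith, by linarith⟩
    · have h' : p.coeff j ≠ q.coeff j := by
        rw [← hval]
        simpa [e6, e1] using h
      exact (Tri.assign (by simp; linarith) (Or.inr ⟨by simp, j, by omega, h'⟩)).mono (by simp)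
        fun _ h => h
    · have h' : p.coeff j = q.coeff j := by
        by_contra h₁
        rw [← Ne, ← hval] at h₁
        have : ((p.coeff j).val - (q.coeff j).val : ℤ) *
          ((p.coeff j).val - (q.coeff j).val : ℤ) ≤ 0 := by simpa [e6, e1] using h
        linarith
      refine (Tri.assign (by simp) ?_).mono (by simp) fun _ h => h
      rcases hs' with ⟨h₁, h₂⟩ | ⟨h₁, i, hi, h₂⟩
      · refine Or.inl ⟨by simpa using h₁, fun i hi => ?_⟩
        rcases Nat.lt_succ_iff_lt_or_eq.1 hi with hi | rfl
        · exact h₂ i hi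
        · exact h'
      · exact Or.inr ⟨by simpa using h₁, i, by omega, h₂⟩
  · rintro s' ⟨⟨h₁, h₂⟩ | ⟨h₁, i, hi, h₂⟩, -⟩
    · simpa [h₁] using h₂
    · simp only [h₁, lt_irrefl, false_iff]
      exact fun h => h₂ (h i hi)

end IntProg

namespace IntProg

open RAM Polynomial Lamplighter LaurentPolynomial FixedFFT

/-! ### The main program -/

/-- The state after the table of roots has been computed. -/
structure Base (k : ℕ) (s : St) : Prop where
  len : s.var 6 = (2 ^ k : ℕ)
  log : s.var 7 = k
  scale : s.var 8 = ((2 ^ (k + 1) : ℕ) : ℤ) ^ 20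
  table : Close (((2 ^ (k + 1) : ℕ) : ℤ) ^ 20) (2 ^ k) (((2 ^ (k + 1) : ℕ) : ℝ) ^ 6)
    (s.arr 11) (s.arr 12) split

theorem Base.congr {k : ℕ} {s s' : St} (h : Base k s) (h₁ : s'.var 6 = s.var 6)
    (h₂ : s'.var 7 = s.var 7) (h₃ : s'.var 8 = s.var 8) (h₄ : s'.arr 11 = s.arr 11)
    (h₅ : s'.arr 12 = s.arr 12) : Base k s' :=
  ⟨h₁ ▸ h.len, h₂ ▸ h.log, h₃ ▸ h.scale, by rw [h₄, h₅]; exact h.table⟩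

theorem Base.frame {k : ℕ} {s s' : St} {c : Cmd} (h : Base k s) (hf : Frame c s s')
    (h₁ : c.keepsVar 6 = true := by rfl) (h₂ : c.keepsVar 7 = true := by rfl)
    (h₃ : c.keepsVar 8 = true := by rfl) (h₄ : c.keepsArr 11 = true := by rfl)
    (h₅ : c.keepsArr 12 = true := by rfl) : Base k s' :=
  h.congr (hf.var _ h₁) (hf.var _ h₂) (hf.var _ h₃) (hf.arr _ h₄) (hf.arr _ h₅)

theorem Base.setting {k m : ℕ} {s : St} (h : Base k s) (hm : m ≤ k + 1)
    (h₁ : s.var 20 = (2 ^ m : ℕ)) (h₂ : s.var 21 = m) : Setting (2 ^ (k + 1)) m s := by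
  refine ⟨?_, pow_dvd_pow 2 hm, h₁, h₂, h.scale, ?_⟩
  · rw [pow_succ]
    have := Nat.one_le_two_pow (n := k)
    omega
  · have : 2 ^ (k + 1) / 2 = 2 ^ k := by rw [pow_succ]; simp
    rw [this]
    exact h.table

theorem le_bound_of_pow {k : ℕ} {B : ℤ} (hB : ((2 ^ (k + 1) : ℕ) : ℤ) ^ 60 ≤ B) :
    100 * ((2 ^ k : ℕ) : ℤ) + 100 ≤ B := by
  refine le_trans ?_ hB
  have h₁ : (1 : ℤ) ≤ (2 ^ k : ℕ) := by exact_mod_cast Nat.one_le_two_pow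
  have h₂ : ((2 ^ (k + 1) : ℕ) : ℤ) = 2 * (2 ^ k : ℕ) := by push_cast; ring
  rw [h₂, mul_pow]
  have h₃ : ((2 ^ k : ℕ) : ℤ) ≤ (2 ^ k : ℕ) ^ 60 := le_self_pow₀ h₁ (by norm_num)
  have h₄ : (2 : ℤ) ^ 10 ≤ 2 ^ 60 := by norm_num
  nlinarith

/-- Doubles the precision of the inverse in array `3`. -/
def inverseStep : Cmd :=
  .assign 20 (4 * V 12) ;; .assign 21 (V 21 + 1) ;; loadPad 4 2 (2 * V 12) ;; spread ;; mulProg ;;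
    copyTo 3 6 (2 * V 12) ;; .assign 12 (2 * V 12)

/-- Both factors have degree below `2 * 2 ^ j`, so the length `2 ^ (j + 2)` excludes wrap-around.
Since `j < k`, this length divides `2 ^ (k + 1)`, as the table of roots requires. -/
theorem inverseStep_tri {B : ℤ} {k j : ℕ} {s : St} {p v : (ZMod 2)[X]} (hs : Base k s)
    (hj : j < k) (h12 : s.var 12 = (2 ^ j : ℕ)) (h21 : s.var 21 = (j + 1 : ℕ))
    (hp : Holds (2 ^ k) (s.arr 2) p) (hv : Holds (2 ^ j) (s.arr 3) v) (hd : v.natDegree < 2 ^ j)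
    (hB : ((2 ^ (k + 1) : ℕ) : ℤ) ^ 60 ≤ B) :
    Tri B inverseStep s (24000 * (2 ^ j * (k + 1))) (fun s' =>
      s'.var 12 = (2 ^ (j + 1) : ℕ) ∧ s'.var 21 = (j + 2 : ℕ) ∧
      Holds (2 ^ (j + 1)) (s'.arr 3)
        (trunc (2 ^ (j + 1)) (trunc (2 ^ (j + 1)) p * expand (ZMod 2) 2 v))) := by
  have hb := le_bound_of_pow hB
  have hjk : 2 ^ j ≤ 2 ^ k := Nat.pow_le_pow_right two_pos hj.le
  have hjk2 : 2 ^ (j + 1) ≤ 2 ^ k := Nat.pow_le_pow_right two_pos hj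
  have hkk : k < 2 ^ k := Nat.lt_two_pow_self
  obtain ⟨L, hL⟩ : ∃ L, L = 2 ^ j := ⟨_, rfl⟩
  obtain ⟨K, hK⟩ : ∃ K, K = 2 ^ k := ⟨_, rfl⟩
  have hL2 : 2 ^ (j + 1) = 2 * L := by rw [hL, pow_succ']
  have hL4 : 2 ^ (j + 2) = 4 * L := by rw [hL]; ring
  have hL1 : 1 ≤ L := by rw [hL]; exact Nat.one_le_two_pow
  have hLk : L ≤ L * (k + 1) := Nat.le_mul_of_pos_right _ (by omega)
  have hLj : L * (j + 3) ≤ 2 * (L * (k + 1)) := by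
    have : L * (j + 3) ≤ L * (2 * (k + 1)) := Nat.mul_le_mul_left _ (by omega)
    linarith
  rw [hL2, ← hL]
  rw [← hL] at h12 hv hd hjk
  rw [← hK] at hp hb hjk hkk hjk2
  have hLK : (L : ℤ) ≤ K := by exact_mod_cast hjk
  have hjK : (j : ℤ) ≤ K := by exact_mod_cast (hj.trans hkk).le
  have hL0 : (1 : ℤ) ≤ L := by exact_mod_cast hL1
  refine (Tri.assign (Q := fun s' => s' = s.setVar 20 (4 * L : ℕ)) ?_ (by simp [h12])).then
    (T₂ := 11600 * (L * (j + 3)) + 700 * L + 80) (fun s₁ h₁ => ?_) (by simp; omega)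
  · simp [h12, -abs_mul]
    and_intros <;> first | linarith | (apply abs_le_of_nonneg <;> linarith)
  refine (Tri.assign (Q := fun s' => s' = s₁.setVar 21 (j + 2 : ℕ)) ?_ ?_).then
    (T₂ := 11600 * (L * (j + 3)) + 700 * L + 60) (fun s₂ h₂ => ?_) (by simp; omega)
  · simp [h₁, h21]
    and_intros <;> first | linarith | (apply abs_le_of_nonneg <;> linarith)
  · simp [h₁, h21, add_assoc, one_add_one_eq_two]
  subst h₁
  have b₂ : Base k s₂ := by subst h₂; exact hs.congr (by simp) (by simp) (by simp) rfl rfl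
  have hcnt : ∀ s' : St, s'.var 12 = L → (2 * V 12 : Ex).Safe B s' ∧
      (2 * V 12 : Ex).eval s' = (2 * L : ℕ) := fun s' h => by
    simp [h, -abs_mul]
    and_intros <;> first | linarith | (apply abs_le_of_nonneg <;> linarith)
  refine (loadPad_tri (M := 4 * L) (n := 2 * L) (p := p) (by decide) (by simp [h₂])
    (by linarith) (fun s' h => hcnt s' ?_) ?_).then
    (T₂ := 11600 * (L * (j + 3)) + 400 * L + 60) (fun s₃ h₃ => ?_) ?_
  · rw [h 12 (by norm_num), h₂]; simp [h12]
  · rw [h₂]; exact hp.mono (hL2 ▸ hjk2)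
  · refine (spread_tri (L := L) (v := v) ?_ ?_ (by linarith) ?_ hd).then
      (T₂ := 11600 * (L * (j + 3)) + 80 * L + 40) (fun s₄ h₄ => ?_) (by omega)
    · rw [h₃.2.var 12 rfl, h₂]; simp [h12]
    · rw [h₃.2.var 20 rfl, h₂]; simp
    · rw [h₃.2.arr 3 rfl, h₂]; exact hv
    have e20 : s₄.var 20 = (2 ^ (j + 2) : ℕ) := by
      rw [h₄.2.var 20 rfl, h₃.2.var 20 rfl, h₂, hL4]; simp
    have e21 : s₄.var 21 = (j + 2 : ℕ) := by
      rw [h₄.2.var 21 rfl, h₃.2.var 21 rfl, h₂]; simp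
    refine (mulProg_tri (p := trunc (2 * L) p) (q := expand (ZMod 2) 2 v)
      ((b₂.frame h₃.2).frame h₄.2 |>.setting (by omega) e20 e21) ?_ ?_ ?_ ?_ hB).then
      (T₂ := 80 * L + 40) (fun s₅ h₅ => ?_) ?_
    · rw [h₄.2.arr 4 rfl, hL4]; exact h₃.1
    · rw [hL4]; exact h₄.1
    · have := natDegree_trunc_lt (n := 2 * L) (by omega) p
      omega
    · rw [natDegree_expand]
      omega
    · have e12 : s₅.var 12 = L := by
        rw [h₅.2.var 12 rfl, h₄.2.var 12 rfl, h₃.2.var 12 rfl, h₂]; simp [h12]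
      refine (copyTo_tri (n := 2 * L) (by decide) (hcnt _ e12).1 (hcnt _ e12).2).then
        (T₂ := 14) (fun s₆ h₆ => ?_) (by simp; omega)
      have e12' : s₆.var 12 = L := by rw [h₆.2.var 12 rfl, e12]
      refine (Tri.assign (hcnt _ e12').1 ⟨?_, ?_, ?_⟩).mono (by simp) fun _ h => h
      · rw [(hcnt _ e12').2]; simp
      · have : s₆.var 21 = (j + 2 : ℕ) := by rw [h₆.2.var 21 rfl, h₅.2.var 21 rfl, e21]
        simpa using this
      · intro i hi
        rw [coeff_trunc, if_pos hi, St.setVar_arr, h₆.1.1 i hi]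
        exact h₅.1 i (by omega)
    · rw [hL4, show 4 * L * (j + 2 + 1) = 4 * (L * (j + 3)) by ring]
      omega
  · simp; omega

/-- Computes an inverse modulo `X ^ K` of the polynomial in array `2`. -/
def inverseProg : Cmd :=
  .store 3 0 1 ;; .assign 12 1 ;; .assign 21 1 ;; .loop 15 (V 7) inverseStep

/-- The costs of the rounds form a geometric series dominated by the last one, so the iteration adds
no logarithmic factor. If the constant term of `p` is zero, the resulting `v` has no meaning, but
the program is still safe and as fast. -/
theorem inverseProg_tri {B : ℤ} {k : ℕ} {s : St} {p : (ZMod 2)[X]} (hs : Base k s)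
    (hp : Holds (2 ^ k) (s.arr 2) p) (hB : ((2 ^ (k + 1) : ℕ) : ℤ) ^ 60 ≤ B) :
    Tri B inverseProg s (24200 * (2 ^ k * (k + 1))) (fun s' =>
      (∃ v : (ZMod 2)[X], Holds (2 ^ k) (s'.arr 3) v ∧ v.natDegree < 2 ^ k ∧
        (p.coeff 0 = 1 → X ^ 2 ^ k ∣ p * v - 1)) ∧ Frame inverseProg s s') := by
  have hb := le_bound_of_pow hB
  have hk1 : 1 ≤ 2 ^ k := Nat.one_le_two_pow
  have hkk : k < 2 ^ k := Nat.lt_two_pow_self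
  have h1B : (1 : ℤ) ≤ B := by
    have : (0 : ℤ) ≤ (2 ^ k : ℕ) := by positivity
    linarith
  have hK : 2 ^ k ≤ 2 ^ k * (k + 1) := Nat.le_mul_of_pos_right _ (by omega)
  refine (Tri.frame ?_).mono le_rfl fun s' h => h
  refine Tri.then (T₁ := 20) (Q := fun s' => s' = s.setArr 3 0 1) ⟨?_, by simp [Cmd.cost],
    by simp [Cmd.eval]⟩ (T₂ := 24100 * (2 ^ k * (k + 1))) (fun s₁ h₁ => ?_) (by omega)
  · simp [Cmd.Safe]; omega
  refine (Tri.assign (Q := fun s' => s' = s₁.setVar 12 1) (by simpa using h1B) (by simp)).then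
    (T₂ := 24090 * (2 ^ k * (k + 1))) (fun s₂ h₂ => ?_) (by simp; omega)
  refine (Tri.assign (Q := fun s' => s' = s₂.setVar 21 1) (by simpa using h1B) (by simp)).then
    (T₂ := 24080 * (2 ^ k * (k + 1))) (fun s₃ h₃ => ?_) (by simp; omega)
  subst h₁ h₂
  refine (Tri.loop_sum (T := fun j => 24000 * (2 ^ j * (k + 1))) (n := k) (fun j s' =>
    s'.var 12 = (2 ^ j : ℕ) ∧ s'.var 21 = (j + 1 : ℕ) ∧ ∃ v : (ZMod 2)[X],
      Holds (2 ^ j) (s'.arr 3) v ∧ v.natDegree < 2 ^ j ∧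
        (p.coeff 0 = 1 → X ^ 2 ^ j ∣ p * v - 1)) (by simp) (by simp [h₃, hs.log]) ?_
    fun j hj s' hs' hf => ?_).mono ?_ fun s' h => h.1.2.2
  · refine ⟨by simp [h₃], by simp [h₃], 1, fun i hi => ?_, by simp, fun h => ?_⟩
    · have : i = 0 := by simpa using hi
      subst this
      simp [h₃, ZMod.val_one]
    · rw [pow_zero, pow_one, mul_one, X_dvd_iff, coeff_sub, h]
      simp
  · obtain ⟨e12, e21, v, hv, hd, hi⟩ := hs'
    have hbase : Base k s' := by
      refine Base.frame (s := s₃) ?_ hf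
      rw [h₃]
      exact hs.congr (by simp) (by simp) (by simp) (by simp [St.setArr]) (by simp [St.setArr])
    refine (inverseStep_tri (s := s'.setVar 15 j) (p := p)
      (hbase.congr (by simp) (by simp) (by simp) rfl rfl) hj
      (by simpa using e12) (by simpa using e21) ?_ hv hd hB).mono le_rfl
      fun s'' h => ⟨h.1, h.2.1, _, h.2.2, ?_, fun h0 => ?_⟩
    · have : s'.arr 2 = s.arr 2 := by rw [hf.arr 2 rfl, h₃]; simp [St.setArr]
      rw [St.setVar_arr, this]
      exact hp
    · exact natDegree_trunc_lt (by positivity) _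
    · rw [pow_succ']
      exact dvd_inverse_step (hi h0)
  · rw [Finset.sum_add_distrib, ← Finset.mul_sum, ← Finset.sum_mul,
      Nat.geomSum_eq le_rfl, Finset.sum_const, Finset.card_range, smul_eq_mul]
    have h₁ : (2 ^ k - 1) / (2 - 1) * (k + 1) ≤ 2 ^ k * (k + 1) :=
      Nat.mul_le_mul_right _ ((Nat.div_le_self _ _).trans (Nat.sub_le _ _))
    simp only [Ex.size_var]
    omega

/-- Decides whether the equation for the lamps is solvable. -/
def solveProg : Cmd :=
  .assign 20 (2 * V 6) ;; .assign 21 (V 7 + 1) ;; loadPad 4 1 (V 6) ;; loadPad 5 3 (V 6) ;;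
    mulProg ;; loadPad 4 6 (V 6) ;; loadPad 5 2 (V 6) ;; mulProg ;; compareProg

/-- The program forms `q * v`, truncates it, and multiplies by `p`. All factors have degree below `K
= 2 ^ k`, so transforms of length `2 * K` are exact and comparing the first `2 * K` coefficients
decides the equality. -/
theorem solveProg_tri {B : ℤ} {k : ℕ} {s : St} {p q v : (ZMod 2)[X]} (hs : Base k s)
    (hp : Holds (2 ^ k) (s.arr 2) p) (hq : HoldsAll (s.arr 1) q) (hv : Holds (2 ^ k) (s.arr 3) v)
    (hdp : p.natDegree < 2 ^ k) (hdq : q.natDegree < 2 ^ k) (hdv : v.natDegree < 2 ^ k)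
    (hB : ((2 ^ (k + 1) : ℕ) : ℤ) ^ 60 ≤ B) :
    Tri B solveProg s (24500 * (2 ^ k * (k + 1))) (fun s' =>
      0 < s'.var 0 ↔ p * trunc (2 ^ k) (q * v) = q) := by
  have hb := le_bound_of_pow hB
  have hkk : k < 2 ^ k := Nat.lt_two_pow_self
  obtain ⟨K, hK⟩ : ∃ K, K = 2 ^ k := ⟨_, rfl⟩
  have hK2 : 2 ^ (k + 1) = 2 * K := by rw [hK, pow_succ']
  have h6 := hs.len
  have h7 := hs.log
  rw [← hK] at hp hv hdp hdq hdv hkk hb h6 ⊢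
  have hkK : (k : ℤ) ≤ K := by exact_mod_cast hkk.le
  have hK1 : 1 ≤ K := by omega
  have hK1' : (1 : ℤ) ≤ K := by exact_mod_cast hK1
  have hKk : K ≤ K * (k + 1) := Nat.le_mul_of_pos_right _ (by omega)
  have hKk2 : K * (k + 2) ≤ 2 * (K * (k + 1)) := by
    have : K * (k + 2) ≤ K * (2 * (k + 1)) := Nat.mul_le_mul_left _ (by omega)
    linarith
  refine (Tri.assign (Q := fun s' => s' = s.setVar 20 (2 * K : ℕ)) ?_ (by simp [h6])).then
    (T₂ := 11600 * (K * (k + 2)) + 1000 * K + 150) (fun s₁ h₁ => ?_) (by simp; omega)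
  · simp [h6, -abs_mul]
    and_intros <;> first | linarith | (apply abs_le_of_nonneg <;> linarith)
  refine (Tri.assign (Q := fun s' => s' = s₁.setVar 21 (k + 1 : ℕ)) ?_ (by simp [h₁, h7])).then
    (T₂ := 11600 * (K * (k + 2)) + 1000 * K + 140) (fun s₂ h₂ => ?_) (by simp; omega)
  · simp [h₁, h7]
    and_intros <;> first | linarith | (apply abs_le_of_nonneg <;> linarith)
  subst h₁
  have b₂ : Base k s₂ := by subst h₂; exact hs.congr (by simp) (by simp) (by simp) rfl rfl
  have f₂ : s₂.var 20 = (2 * K : ℕ) ∧ s₂.var 21 = (k + 1 : ℕ) ∧ s₂.arr = s.arr := by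
    subst h₂; simp
  clear h₂
  have hcnt : ∀ s' s'' : St, Base k s' → (∀ v ≠ 25, s''.var v = s'.var v) →
      (V 6).Safe B s'' ∧ (V 6).eval s'' = K := fun s' s'' h h' =>
    ⟨trivial, by rw [Ex.eval_var, h' 6 (by norm_num), h.len, hK]⟩
  have h0B : 0 ≤ B := by linarith
  refine (loadPad_tri (M := 2 * K) (n := K) (p := q) (by decide) f₂.1 h0B
    (fun s' h => hcnt _ s' b₂ h) (by rw [f₂.2.2]; exact fun i _ => hq i)).then
    (T₂ := 11600 * (K * (k + 2)) + 900 * K + 118) (fun s₃ h₃ => ?_) (by simp; omega)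
  have b₃ := b₂.frame h₃.2
  refine (loadPad_tri (M := 2 * K) (n := K) (p := v) (by decide)
    (by rw [h₃.2.var 20 rfl, f₂.1]) h0B (fun s' h => hcnt _ s' b₃ h)
    (by rw [h₃.2.arr 3 rfl, f₂.2.2]; exact hv)).then
    (T₂ := 11600 * (K * (k + 2)) + 800 * K + 96) (fun s₄ h₄ => ?_) (by simp; omega)
  have b₄ := b₃.frame h₄.2
  have e20 : s₄.var 20 = (2 ^ (k + 1) : ℕ) := by
    rw [h₄.2.var 20 rfl, h₃.2.var 20 rfl, f₂.1, hK2]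
  have e21 : s₄.var 21 = (k + 1 : ℕ) := by rw [h₄.2.var 21 rfl, h₃.2.var 21 rfl, f₂.2.1]
  have d₁ : ∀ r : (ZMod 2)[X], 2 * (trunc K r).natDegree < 2 ^ (k + 1) := fun r => by
    have := natDegree_trunc_lt hK1 r
    omega
  refine (mulProg_tri (p := trunc K q) (q := trunc K v) (b₄.setting le_rfl e20 e21)
    (by rw [h₄.2.arr 4 rfl, hK2]; exact h₃.1) (by rw [hK2]; exact h₄.1) (d₁ q) (d₁ v) hB).then
    (T₂ := 5800 * (K * (k + 2)) + 800 * K + 96) (fun s₅ h₅ => ?_) ?_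
  swap
  · rw [hK2, show 2 * K * (k + 1 + 1) = 2 * (K * (k + 2)) by ring]
    omega
  rw [trunc_of_natDegree_lt hdq, trunc_of_natDegree_lt hdv] at h₅
  have b₅ := b₄.frame h₅.2
  refine (loadPad_tri (M := 2 * K) (n := K) (p := q * v) (by decide)
    (by rw [h₅.2.var 20 rfl, e20, hK2]) h0B (fun s' h => hcnt _ s' b₅ h)
    (h₅.1.mono (by omega))).then
    (T₂ := 5800 * (K * (k + 2)) + 700 * K + 74) (fun s₆ h₆ => ?_) (by simp; omega)
  have b₆ := b₅.frame h₆.2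
  refine (loadPad_tri (M := 2 * K) (n := K) (p := p) (by decide)
    (by rw [h₆.2.var 20 rfl, h₅.2.var 20 rfl, e20, hK2]) h0B (fun s' h => hcnt _ s' b₆ h)
    (by rw [h₆.2.arr 2 rfl, h₅.2.arr 2 rfl, h₄.2.arr 2 rfl, h₃.2.arr 2 rfl, f₂.2.2]; exact hp)).then
    (T₂ := 5800 * (K * (k + 2)) + 600 * K + 52) (fun s₇ h₇ => ?_) (by simp; omega)
  have b₇ := b₆.frame h₇.2
  have e20' : s₇.var 20 = (2 ^ (k + 1) : ℕ) := by
    rw [h₇.2.var 20 rfl, h₆.2.var 20 rfl, h₅.2.var 20 rfl, e20]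
  have e21' : s₇.var 21 = (k + 1 : ℕ) := by
    rw [h₇.2.var 21 rfl, h₆.2.var 21 rfl, h₅.2.var 21 rfl, e21]
  refine (mulProg_tri (p := trunc K (q * v)) (q := trunc K p) (b₇.setting le_rfl e20' e21')
    (by rw [h₇.2.arr 4 rfl, hK2]; exact h₆.1) (by rw [hK2]; exact h₇.1) (d₁ _) (d₁ p) hB).then
    (T₂ := 200 * K + 30) (fun s₈ h₈ => ?_) ?_
  swap
  · rw [hK2, show 2 * K * (k + 1 + 1) = 2 * (K * (k + 2)) by ring]
    omega
  rw [trunc_of_natDegree_lt hdp, mul_comm _ p] at h₈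
  refine (compareProg_tri (M := 2 * K) (p := p * trunc K (q * v)) (q := q) ?_ (hK2 ▸ h₈.1) ?_
    (by linarith)).mono (by omega) fun s' h => h.trans ?_
  · rw [h₈.2.var 20 rfl, e20', hK2]
  · rw [h₈.2.arr 1 rfl, h₇.2.arr 1 rfl, h₆.2.arr 1 rfl, h₅.2.arr 1 rfl, h₄.2.arr 1 rfl,
      h₃.2.arr 1 rfl, f₂.2.2]
    exact hq
  · constructor
    · intro h
      ext i
      rcases Nat.lt_or_ge i (2 * K) with hi | hi
      · exact h i hi
      · have h₁ := natDegree_mul_le (p := p) (q := trunc K (q * v))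
        have h₂ := natDegree_trunc_lt hK1 (q * v)
        rw [coeff_eq_zero_of_natDegree_lt (by omega), coeff_eq_zero_of_natDegree_lt (by omega)]
    · intro h i _
      rw [h]

end IntProg

/-! ### The decision procedure and its running time -/

namespace IntProg

open RAM Polynomial Lamplighter LaurentPolynomial FixedFFT

/-- Decides whether there are lamps that solve the equation, when `x` has the position `δ`. -/
def mainProg : Cmd :=
  .assign 5 ((V 0 + 1) * (V 0 + 1)) ;; powProg ;; rootTable ;; scanProg ;; lowProg ;; shiftProg ;;
    inverseProg ;; solveProg

/-- The time that the main program needs, up to a constant factor. -/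
def mainTime (n : ℕ) : ℕ := 4 * (n + 1) ^ 2 * (Nat.log 2 (4 * (n + 1) ^ 2) + 1)

theorem exists_eq_X_pow_mul {K lo : ℕ} {P : (ZMod 2)[X]} (hlo : lo ≤ K)
    (hP : ∀ i ≥ K, P.coeff i = 0) (h₁ : ∀ i < lo, P.coeff i = 0) (h₂ : lo < K → P.coeff lo = 1) :
    ∃ p, P = X ^ lo * p ∧ (p.coeff 0 = 1 ∨ p = 0) ∧ ∀ i ≥ K, p.coeff i = 0 := by
  obtain ⟨p, rfl⟩ := X_pow_dvd_iff.2 h₁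
  refine ⟨p, rfl, ?_, fun i hi => ?_⟩
  · rcases hlo.lt_or_eq with h | rfl
    · left
      have := h₂ h
      rwa [← coeff_X_pow_mul p lo 0, Nat.zero_add]
    -- No bit was found, so `P` vanishes.
    · right
      ext i
      rw [coeff_zero, ← hP (i + lo) (by omega), coeff_X_pow_mul]
  · rw [← hP (i + lo) (by omega), coeff_X_pow_mul]

theorem natDegree_lt_of_coeff {K : ℕ} {p : (ZMod 2)[X]} (hK : 0 < K)
    (h : ∀ i ≥ K, p.coeff i = 0) : p.natDegree < K :=
  Nat.lt_of_le_pred hK (natDegree_le_iff_coeff_eq_zero.2 fun i hi =>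
    h i (by have := Nat.pred_eq_sub_one (n := K); omega))

/-- The single size `2 ^ k`, between `2 * E` and `4 * E`, serves all parts: it exceeds the degrees
of the coefficients and is quadratic in the length of `w`. Each part costs a constant times `2 ^ k *
(k + 1)` or less. -/
theorem mainProg_tri {B δ : ℤ} {w : FreeGroup EqLetter} {s : St}
    (hB : ((8 * (w.norm + 1) ^ 2 : ℕ) : ℤ) ^ 60 ≤ B) (h0 : s.var 0 = w.norm) (h4 : s.var 4 = δ)
    (hδ : |δ| ≤ w.norm) (hi : s.inp = letterCodes w) (ha : s.arr 0 = fun _ => 0)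
    (hb : s.arr 1 = fun _ => 0) :
    Tri B mainProg s (60000 * mainTime w.norm) (fun s' =>
      (0 < s'.var 0 ↔ ∃ f, (evalEq ⟨δ, f⟩ w).absLamps = 0) ∧ Frame mainProg s s') := by
  refine (Tri.frame ?_).mono le_rfl fun s' h => h
  obtain ⟨n, hn⟩ : ∃ n, n = w.norm := ⟨_, rfl⟩
  obtain ⟨E, hE⟩ : ∃ E, E = (n + 1) ^ 2 := ⟨_, rfl⟩
  rw [← hn] at hB h0 hδ ⊢
  have hE1 : 1 ≤ E := by rw [hE]; exact Nat.one_le_pow _ _ (by omega)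
  have hEB : 100 * (E : ℤ) + 100 ≤ B := by
    refine le_trans ?_ hB
    rw [← hE]
    push_cast
    have h₁ : (1 : ℤ) ≤ E := by exact_mod_cast hE1
    rw [mul_pow]
    have h₃ : (E : ℤ) ≤ (E : ℤ) ^ 60 := le_self_pow₀ h₁ (by norm_num)
    have h₄ : (200 : ℤ) ≤ 8 ^ 60 := by norm_num
    nlinarith
  have hkB : ∀ k, 2 ^ k ≤ 4 * E → ((2 ^ (k + 1) : ℕ) : ℤ) ^ 60 ≤ B := fun k hk => by
    refine le_trans ?_ hB
    have : 2 ^ (k + 1) ≤ 8 * (n + 1) ^ 2 := by rw [← hE, pow_succ]; omega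
    exact pow_le_pow_left₀ (by positivity) (by exact_mod_cast this) _
  clear hB
  have hnE' : n + 1 ≤ E := by rw [hE]; exact Nat.le_self_pow (by norm_num) _
  have hnE : (n : ℤ) + 1 ≤ E := by exact_mod_cast hnE'
  have hn0 := Int.natCast_nonneg n
  have hT : 4 * E ≤ mainTime n := by
    rw [mainTime, ← hE]; exact Nat.le_mul_of_pos_right _ (by omega)
  refine (Tri.assign (Q := fun s' => s' = s.setVar 5 E) ?_ ?_).then
    (T₂ := 59990 * mainTime n) (fun s₁ h₁ => ?_) (by simp; omega)
  · have : ((n : ℤ) + 1) * (n + 1) = E := by rw [hE]; push_cast; ring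
    simp only [Ex.safe_mul, Ex.safe_add, Ex.safe_var, Ex.safe_num, Ex.eval_add, Ex.eval_var,
      Ex.eval_num, h0, Nat.cast_one, this]
    and_intros <;> first | trivial | linarith | (apply abs_le_of_nonneg <;> linarith)
  · simp only [Ex.eval_mul, Ex.eval_add, Ex.eval_var, Ex.eval_num, h0, hE]
    push_cast
    ring_nf
  refine (powProg_tri (n := n) (E := E) (by simp [h₁, h0]) (by simp [h₁]) hE (by linarith)).then
    (T₂ := 59500 * mainTime n) (fun s₂ h₂ => ?_) (by omega)
  obtain ⟨⟨k, h6, h7, hEk, hkE⟩, f₂⟩ := h₂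
  have hkT : 2 ^ k * (k + 1) ≤ mainTime n := by
    rw [mainTime, ← hE]
    refine Nat.mul_le_mul hkE (Nat.succ_le_succ ?_)
    exact (Nat.le_log_iff_pow_le (by norm_num) (by omega)).2 hkE
  have hkk : 2 ^ k ≤ 2 ^ k * (k + 1) := Nat.le_mul_of_pos_right _ (by omega)
  have hkB := hkB k hkE
  have hKB := le_bound_of_pow hkB
  have hK0 : (0 : ℤ) ≤ (2 ^ k : ℕ) := by positivity
  have hk0 : 0 < 2 ^ k := by positivity
  refine (rootTable_tri h7 hkB).then
    (T₂ := 51500 * mainTime n) (fun s₃ h₃ => ?_) (by omega)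
  have b₃ : Base k s₃ := ⟨by rw [h₃.2.var 6 rfl, h6], by rw [h₃.2.var 7 rfl, h7], h₃.1.1, h₃.1.2⟩
  refine (scanProg_tri (E := E) (δ := δ) (hn ▸ hE) (by linarith) ?_ ?_ ?_
    (hn ▸ hδ.trans (by linarith)) ?_ ?_ ?_).then
    (T₂ := 51000 * mainTime n) (fun s₄ h₄ => ?_) (by rw [← hn]; omega)
  · rw [h₃.2.var 0 rfl, f₂.var 0 rfl, h₁]; simp [h0, hn]
  · rw [h₃.2.var 4 rfl, f₂.var 4 rfl, h₁]; simp [h4]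
  · rw [h₃.2.var 5 rfl, f₂.var 5 rfl, h₁]; simp
  · rw [h₃.2.inp, f₂.inp, h₁]; exact hi
  · rw [h₃.2.arr 0 rfl, f₂.arr 0 rfl, h₁]; exact ha
  · rw [h₃.2.arr 1 rfl, f₂.arr 1 rfl, h₁]; exact hb
  have b₄ := b₃.frame h₄.2
  obtain ⟨P, Q, hP, hQ, hd, hPQ⟩ := h₄.1.lamps
  have hdP : ∀ i ≥ 2 ^ k, P.coeff i = 0 := fun i hi => (hd i (by omega)).1
  have hdQ : ∀ i ≥ 2 ^ k, Q.coeff i = 0 := fun i hi => (hd i (by omega)).2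
  refine (lowProg_tri b₄.len hP (by linarith)).then
    (T₂ := 50500 * mainTime n) (fun s₅ h₅ => ?_) (by omega)
  obtain ⟨⟨lo, h14, hlo, hlow, hbit⟩, f₅⟩ := h₅
  have b₅ := b₄.frame f₅
  obtain ⟨p, hp, hp1, hdp⟩ := exists_eq_X_pow_mul hlo hdP hlow hbit
  refine (shiftProg_tri b₅.len h14 hlo (by rw [f₅.arr 0 rfl]; exact hP) hp (by linarith)).then
    (T₂ := 50000 * mainTime n) (fun s₆ h₆ => ?_) (by omega)
  have b₆ := b₅.frame h₆.2
  refine (inverseProg_tri b₆ h₆.1 hkB).then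
    (T₂ := 25000 * mainTime n) (fun s₇ h₇ => ?_) (by omega)
  obtain ⟨⟨v, hv, hdv, hinv⟩, f₇⟩ := h₇
  refine (solveProg_tri (b₆.frame f₇) (by rw [f₇.arr 2 rfl]; exact h₆.1)
    (by rw [f₇.arr 1 rfl, h₆.2.arr 1 rfl, f₅.arr 1 rfl]; exact hQ) hv
    (natDegree_lt_of_coeff hk0 hdp) (natDegree_lt_of_coeff hk0 hdQ) hdv hkB).mono (by omega)
    fun s' h => h.trans ?_
  rw [← exists_laurent_iff (lo := lo) hp1 (natDegree_lt_of_coeff hk0 hdQ) hinv, ← hp]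
  refine exists_congr fun f => ?_
  -- The shift by `E` is multiplication by a unit, so it does not affect whether the lamps vanish.
  rw [evalEq_eq_prod, ← hPQ, (isUnit_T _).mul_right_eq_zero]

/-- The decision program. Its answer is correct if the variable `10` is positive in the end. -/
def decideProg : Cmd :=
  countProg ;; .assign 10 (V 1 * V 1) ;; .assign 4 ((0 - V 2) / V 1) ;;
    .ite ((V 1 * V 4 + V 2) * (V 1 * V 4 + V 2)) (.assign 0 0) mainProg

theorem sigmaX_eq (w : FreeGroup EqLetter) : sigmaX w = (w.toWord.map xSign).sum := rfl

theorem evalEq_pos (g : Lamplighter) (w : FreeGroup EqLetter) :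
    (evalEq g w).pos = sigmaX w * g.pos + (w.toWord.map tSign).sum := by
  rw [evalEq_eq_prod, prod_letterVal_pos, sigmaX_eq]

/-- The position equation leaves only one candidate for `δ`. Truncated division finds it when the
division is exact, and substituting the result detects when it is not. -/
theorem mem_DP1Lamplighter_iff_of_sigmaX_ne_zero {w : FreeGroup EqLetter} (h : sigmaX w ≠ 0) {δ : ℤ}
    (hδ : δ = (0 - (w.toWord.map tSign).sum).tdiv (sigmaX w)) :
    w ∈ DP1Lamplighter ↔ sigmaX w * δ + (w.toWord.map tSign).sum = 0 ∧
      ∃ f, (evalEq ⟨δ, f⟩ w).absLamps = 0 := by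
  rw [mem_DP1Lamplighter_iff]
  constructor
  · rintro ⟨g, hg⟩
    rw [Lamplighter.eq_one_iff, evalEq_pos] at hg
    have : g.pos = δ := by
      rw [hδ, show 0 - (w.toWord.map tSign).sum = sigmaX w * g.pos by linarith [hg.1],
        Int.mul_tdiv_cancel_left _ h]
    subst this
    exact ⟨hg.1, g.lamps, hg.2⟩
  · rintro ⟨h₁, f, hf⟩
    exact ⟨⟨δ, f⟩, (Lamplighter.eq_one_iff _).2 ⟨by rw [evalEq_pos]; exact h₁, hf⟩⟩

/-- Safety and the bound on the cost hold for every `w`. For exponent sum zero, division by zero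
gives `δ = 0` and the program runs on harmlessly; only variable `10` tells that its answer must be
discarded. -/
theorem decideProg_tri {B : ℤ} (w : FreeGroup EqLetter)
    (hB : ((8 * (w.norm + 1) ^ 2 : ℕ) : ℤ) ^ 60 ≤ B) :
    Tri B decideProg (initSt w) (61000 * mainTime w.norm) (fun s' =>
      (0 < s'.var 10 ↔ sigmaX w ≠ 0) ∧
        (sigmaX w ≠ 0 → (0 < s'.var 0 ↔ w ∈ DP1Lamplighter))) := by
  obtain ⟨n, hn⟩ : ∃ n, n = w.norm := ⟨_, rfl⟩
  obtain ⟨E, hE⟩ : ∃ E, E = (n + 1) ^ 2 := ⟨_, rfl⟩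
  have hE1 : 1 ≤ E := by rw [hE]; exact Nat.one_le_pow _ _ (by omega)
  have hEB : 100 * ((E : ℤ) * E) + 100 ≤ B := by
    refine le_trans ?_ hB
    rw [← hn, ← hE]
    push_cast
    have h₁ : (1 : ℤ) ≤ E := by exact_mod_cast hE1
    rw [mul_pow]
    have h₃ : (E : ℤ) ^ 2 ≤ (E : ℤ) ^ 60 := pow_le_pow_right₀ h₁ (by norm_num)
    have h₄ : (200 : ℤ) ≤ 8 ^ 60 := by norm_num
    have h₅ : (1 : ℤ) ≤ E ^ 60 := one_le_pow₀ h₁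
    nlinarith
  have hn0 := Int.natCast_nonneg n
  have hEn : (E : ℤ) = n * n + 2 * n + 1 := by rw [hE]; push_cast; ring
  have hnn : (0 : ℤ) ≤ n * n := by positivity
  have hEE : (E : ℤ) ≤ E * E := by nlinarith
  have hT : 4 * (n + 1) ≤ mainTime n := by
    have : n + 1 ≤ (n + 1) ^ 2 := Nat.le_self_pow (by norm_num) _
    refine (Nat.mul_le_mul_left 4 this).trans ?_
    exact Nat.le_mul_of_pos_right _ (by omega)
  refine (countProg_tri (B := B) (w := w) (by rw [← hn]; linarith)).then
    (T₂ := 60500 * mainTime n) (fun s₁ h₁ => ?_) (by rw [← hn]; omega)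
  obtain ⟨⟨e₁, e₂, a₁, a₂⟩, f₁⟩ := h₁
  rw [← hn] at a₁ a₂
  have m₁ := abs_mul_le_of_le a₁ a₁
  refine (Tri.assign (Q := fun s' => s' = s₁.setVar 10 (s₁.var 1 * s₁.var 1))
    (by simp only [Ex.safe_mul, Ex.safe_var, Ex.eval_var, true_and]; linarith) (by simp)).then
    (T₂ := 60400 * mainTime n) (fun s₂ h₂ => ?_) (by simp; omega)
  obtain ⟨δ, hδ⟩ : ∃ δ, δ = (0 - s₁.var 2).tdiv (s₁.var 1) := ⟨_, rfl⟩
  have a₃ : |0 - s₁.var 2| ≤ n := by rwa [zero_sub, abs_neg]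
  have a₄ : |δ| ≤ n := hδ ▸ abs_tdiv_le_of_le a₃
  refine (Tri.assign (Q := fun s' => s' = s₂.setVar 4 δ) ?_ ?_).then
    (T₂ := 60300 * mainTime n) (fun s₃ h₃ => ?_) (by simp; omega)
  · simp only [Ex.safe_div, Ex.safe_sub, Ex.safe_var, Ex.safe_num, Ex.eval_num, Ex.eval_var,
      true_and, and_true, h₂, St.setVar_var, Nat.reduceEqDiff, if_false, Nat.cast_zero]
    exact ⟨by linarith, by linarith⟩
  · simp [h₂, hδ]
  subst h₂
  have m₂ := abs_mul_le_of_le a₁ a₄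
  have m₃ := abs_add_le_of_le m₂ a₂
  have m₄ := abs_mul_le_of_le m₃ m₃
  have hbig : ((n : ℤ) * n + n) * (n * n + n) ≤ E * E :=
    mul_le_mul (by linarith) (by linarith) (by positivity) (by positivity)
  have q₁ : s₃.var 1 = s₁.var 1 := by simp [h₃]
  have q₂ : s₃.var 2 = s₁.var 2 := by simp [h₃]
  have q₄ : s₃.var 4 = δ := by simp [h₃]
  have q₁₀ : 0 < s₃.var 10 ↔ sigmaX w ≠ 0 := by
    rw [sigmaX_eq, ← e₁]
    have : s₃.var 10 = s₁.var 1 * s₁.var 1 := by simp [h₃]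
    rw [this]
    exact mul_self_pos
  rw [← sigmaX_eq] at e₁
  have hmem : sigmaX w ≠ 0 → (w ∈ DP1Lamplighter ↔ s₁.var 1 * δ + s₁.var 2 = 0 ∧
      ∃ f, (evalEq ⟨δ, f⟩ w).absLamps = 0) := fun h => by
    rw [e₁, e₂]
    exact mem_DP1Lamplighter_iff_of_sigmaX_ne_zero h (by rw [hδ, e₁, e₂])
  refine (Tri.ite (T := 60000 * mainTime n) ?_ (fun h => ?_) (fun h => ?_)).mono (by simp; omega)
    fun _ h => h
  · simp only [Ex.safe_mul, Ex.safe_add, Ex.safe_var, Ex.eval_add, Ex.eval_mul, Ex.eval_var,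
      true_and, q₁, q₂, q₄]
    exact ⟨⟨by linarith, by linarith⟩, ⟨by linarith, by linarith⟩, by linarith⟩
  · simp only [Ex.eval_add, Ex.eval_mul, Ex.eval_var, q₁, q₂, q₄, mul_self_pos] at h
    refine (Tri.assign (by simp; linarith) ⟨by simpa using q₁₀, fun hs => ?_⟩).mono
      (by simp; omega) fun _ h => h
    rw [hmem hs]
    simp [h]
  · simp only [Ex.eval_add, Ex.eval_mul, Ex.eval_var, q₁, q₂, q₄] at h
    have h' := mul_self_eq_zero.1 (le_antisymm h (mul_self_nonneg _))
    rw [hn]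
    refine (mainProg_tri (w := w) (δ := δ) hB ?_ q₄ (hn ▸ a₄) ?_ ?_ ?_).mono le_rfl
      fun s' hs' => ⟨?_, fun hs => ?_⟩
    · rw [h₃, St.setVar_var, if_neg (by norm_num), St.setVar_var, if_neg (by norm_num),
        f₁.var 0 rfl]
      simp [initSt]
    · rw [h₃, St.setVar_inp, St.setVar_inp, f₁.inp]; rfl
    · rw [h₃, St.setVar_arr, St.setVar_arr, f₁.arr 0 rfl]; rfl
    · rw [h₃, St.setVar_arr, St.setVar_arr, f₁.arr 1 rfl]; rfl
    · rw [hs'.2.var 10 rfl]; exact q₁₀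
    · rw [hs'.1, hmem hs]
      simp [h']

theorem decideProg_partiallyDecides :
    PartiallyDecides (decideProg.program 10) DP1Lamplighter ∧
      ∀ w ∈ {w | sigmaX w ≠ 0},
        RunsWithin (decideProg.program 10) 312 w (62000 * mainTime w.norm) := by
  have hbase : ∀ n : ℕ, n + 5 ≤ (8 * (n + 1) ^ 2) ^ 60 := fun n => by
    have h₁ : n + 5 ≤ 8 * (n + 1) ^ 2 := by nlinarith
    exact h₁.trans (Nat.le_self_pow (by norm_num) _)
  refine Cmd.partiallyDecides (T := fun n => 62000 * mainTime n)
    (B := fun n => (((8 * (n + 1) ^ 2) ^ 60 : ℕ) : ℤ)) {w | sigmaX w ≠ 0} (fun n => ?_) (fun n => ?_)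
    (fun n => ?_) (fun w => (decideProg_tri w (by push_cast; rfl)).safe) (fun w => ?_) (fun w => ?_)
    fun w hw => ?_
  · exact_mod_cast (by have := hbase n; omega)
  · exact_mod_cast (by have := hbase n; omega)
  · rw [Int.toNat_natCast]
    -- The scale parameter `N` is at most `8 * (n + 1) ^ 2 ≤ (n + 2) ^ 5`, and all integers are at
    -- most `N ^ 60`. The memory layout costs a further constant factor, absorbed by `(n + 2) ^ 12`.
    have h₁ : (8 * (n + 1) ^ 2) ^ 60 ≤ (n + 2) ^ 300 := by
      have : 8 * (n + 1) ^ 2 ≤ (n + 2) ^ 5 := by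
        have h₂ : (n + 1) ^ 2 ≤ (n + 2) ^ 2 := Nat.pow_le_pow_left (by omega) 2
        have h₃ : 2 ^ 3 ≤ (n + 2) ^ 3 := Nat.pow_le_pow_left (by omega) 3
        calc 8 * (n + 1) ^ 2 ≤ (n + 2) ^ 3 * (n + 2) ^ 2 := Nat.mul_le_mul h₃ h₂
          _ = (n + 2) ^ 5 := by ring
      calc _ ≤ ((n + 2) ^ 5) ^ 60 := Nat.pow_le_pow_left this 60
        _ = (n + 2) ^ 300 := by rw [← pow_mul]
    have h₂ : n + 64 ≤ 64 * (n + 2) ^ 300 := by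
      have : n + 2 ≤ (n + 2) ^ 300 := Nat.le_self_pow (by norm_num) _
      omega
    have h₃ : 2 ^ 12 ≤ (n + 2) ^ 12 := Nat.pow_le_pow_left (by omega) 12
    calc _ ≤ 2 ^ 12 * (n + 2) ^ 300 := by omega
      _ ≤ (n + 2) ^ 12 * (n + 2) ^ 300 := Nat.mul_le_mul_right _ h₃
      _ = (n + 2) ^ 312 := by rw [← pow_add]
  · have := (decideProg_tri w le_rfl).cost
    have h₁ : 1 ≤ mainTime w.norm := by
      rw [mainTime]
      exact Nat.mul_pos (by positivity) (by omega)
    omega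
  · exact (decideProg_tri w le_rfl).post.1
  · exact (decideProg_tri w le_rfl).post.2 hw

/-- The time is `O(n² log n)`. The remaining factor `log (log n)` is eventually at least one and is
simply given away. -/
theorem mainTime_isBigO (C : ℕ) :
    (fun n => ((C * mainTime n : ℕ) : ℝ)) =O[atTop]
      (fun n : ℕ => (n : ℝ) ^ 2 * Real.log n * Real.log (Real.log n)) := by
  refine IsBigO.of_bound (C * 160 : ℝ) ?_
  have hlog : Tendsto (fun n : ℕ => Real.log (n : ℝ)) atTop atTop :=
    Real.tendsto_log_atTop.comp tendsto_natCast_atTop_atTop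
  have hloglog : Tendsto (fun n : ℕ => Real.log (Real.log (n : ℝ))) atTop atTop :=
    Real.tendsto_log_atTop.comp hlog
  filter_upwards [eventually_ge_atTop 4, hlog.eventually_ge_atTop 1,
    hloglog.eventually_ge_atTop 1] with n hn h₁ h₂
  have hn' : (4 : ℝ) ≤ n := by exact_mod_cast hn
  have h₃ : 4 * (n + 1) ^ 2 ≤ n ^ 4 := by
    have e₁ : n + 1 ≤ 2 * n := by omega
    calc 4 * (n + 1) ^ 2 ≤ 4 * (2 * n) ^ 2 := by gcongr
      _ = 4 ^ 2 * n ^ 2 := by ring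
      _ ≤ n ^ 2 * n ^ 2 := by gcongr
      _ = n ^ 4 := by ring
  have h₄ : (Nat.log 2 (4 * (n + 1) ^ 2) : ℝ) ≤ 8 * Real.log n := by
    have e₁ : 2 ^ Nat.log 2 (4 * (n + 1) ^ 2) ≤ n ^ 4 :=
      (Nat.pow_log_le_self 2 (by positivity)).trans h₃
    have e₂ : (2 : ℝ) ^ Nat.log 2 (4 * (n + 1) ^ 2) ≤ (n : ℝ) ^ 4 := by exact_mod_cast e₁
    have e₃ := Real.log_le_log (by positivity) e₂
    rw [Real.log_pow, Real.log_pow] at e₃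
    have e₄ := Real.log_two_gt_d9
    have e₅ : (0 : ℝ) ≤ Nat.log 2 (4 * (n + 1) ^ 2) := by positivity
    push_cast at e₃
    nlinarith
  have h₅ : (mainTime n : ℝ) ≤ 160 * ((n : ℝ) ^ 2 * Real.log n) := by
    rw [mainTime]
    push_cast
    have e₁ : 4 * ((n : ℝ) + 1) ^ 2 ≤ 16 * n ^ 2 := by nlinarith
    have e₂ : (Nat.log 2 (4 * (n + 1) ^ 2) : ℝ) + 1 ≤ 10 * Real.log n := by linarith
    calc _ ≤ (16 * (n : ℝ) ^ 2) * (10 * Real.log n) :=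
          mul_le_mul e₁ e₂ (by positivity) (by positivity)
      _ = _ := by ring
  have h₆ : 0 ≤ (n : ℝ) ^ 2 * Real.log n := by positivity
  rw [Real.norm_of_nonneg (by positivity), Real.norm_of_nonneg (by positivity)]
  push_cast
  calc (C : ℝ) * mainTime n ≤ C * (160 * ((n : ℝ) ^ 2 * Real.log n)) := by gcongr
    _ = C * 160 * ((n : ℝ) ^ 2 * Real.log n * 1) := by ring
    _ ≤ _ := by gcongr

end IntProg

/-! ### Genericity -/

namespace ReducedWords

open Lamplighter FreeGroup

instance : Fintype EqLetter := ⟨{.a, .t, .x}, by rintro ⟨⟩ <;> simp⟩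

theorem sum_letters {M : Type*} [AddCommMonoid M] (F : EqLetter × Bool → M) :
    ∑ l, F l = F (.a, true) + F (.a, false) + (F (.t, true) + F (.t, false)) +
      (F (.x, true) + F (.x, false)) := by
  rw [Fintype.sum_prod_type]
  have : (Finset.univ : Finset EqLetter) = {.a, .t, .x} := rfl
  simp [this, add_assoc]

/-- The exponent sum of `x` in a word. -/
def xSum (L : List (EqLetter × Bool)) : ℤ := (L.map xSign).sum

/-- The reduced words of length `m` that remain reduced after the letter `l`. -/
def wordsAfter : ℕ → EqLetter × Bool → Finset (List (EqLetter × Bool))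
  | 0, _ => {[]}
  | m + 1, l => (Finset.univ.filter fun l' : EqLetter × Bool => l.1 = l'.1 → l.2 = l'.2).biUnion
      fun l' => (wordsAfter m l').image (List.cons l')

theorem mem_wordsAfter {m : ℕ} {l : EqLetter × Bool} {L : List (EqLetter × Bool)} :
    L ∈ wordsAfter m l ↔ L.length = m ∧ IsReduced (l :: L) := by
  induction m generalizing l L with
  | zero =>
    simp only [wordsAfter, Finset.mem_singleton, List.length_eq_zero_iff]
    constructor
    · rintro rfl
      exact ⟨rfl, IsReduced.singleton⟩
    · exact fun h => h.1
  | succ m ih =>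
    simp only [wordsAfter, Finset.mem_biUnion, Finset.mem_filter, Finset.mem_univ, true_and,
      Finset.mem_image, ih]
    constructor
    · rintro ⟨l', hl, L', ⟨h₁, h₂⟩, rfl⟩
      exact ⟨by simp [h₁], List.isChain_cons_cons.2 ⟨hl, h₂⟩⟩
    · rintro ⟨h₁, h₂⟩
      rcases L with _ | ⟨l', L'⟩
      · simp at h₁
      · obtain ⟨h₃, h₄⟩ := List.isChain_cons_cons.1 h₂
        exact ⟨l', h₃, L', ⟨by simpa using h₁, h₄⟩, rfl⟩

/-- The reduced words of length `m + 1`. -/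
def words (m : ℕ) : Finset (List (EqLetter × Bool)) :=
  Finset.univ.biUnion fun l => (wordsAfter m l).image (List.cons l)

theorem mem_words {m : ℕ} {L : List (EqLetter × Bool)} :
    L ∈ words m ↔ L.length = m + 1 ∧ IsReduced L := by
  simp only [words, Finset.mem_biUnion, Finset.mem_univ, true_and, Finset.mem_image, mem_wordsAfter]
  constructor
  · rintro ⟨l, L, ⟨h₁, h₂⟩, rfl⟩
    exact ⟨by simp [h₁], h₂⟩
  · rintro ⟨h₁, h₂⟩
    rcases L with _ | ⟨l, L⟩
    · simp at h₁
    · exact ⟨l, L, ⟨by simpa using h₁, h₂⟩, rfl⟩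

theorem sum_biUnion_cons {M : Type*} [AddCommMonoid M] (s : Finset (EqLetter × Bool))
    (W : EqLetter × Bool → Finset (List (EqLetter × Bool))) (F : List (EqLetter × Bool) → M) :
    ∑ L ∈ s.biUnion fun l => (W l).image (List.cons l), F L =
      ∑ l ∈ s, ∑ L ∈ W l, F (l :: L) := by
  rw [Finset.sum_biUnion]
  · exact Finset.sum_congr rfl fun l _ => Finset.sum_image (List.cons_injective.injOn)
  · intro l _ l' _ hll
    rw [Function.onFun, Finset.disjoint_left]
    intro L h₁ h₂
    simp only [Finset.mem_image] at h₁ h₂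
    obtain ⟨L₁, -, rfl⟩ := h₁
    obtain ⟨L₂, -, h⟩ := h₂
    simp only [List.cons.injEq] at h
    exact hll h.1.symm

/-- The generating function of the exponent sums of the words after the letter `l`. -/
noncomputable def weight (u : ℂ) (m : ℕ) (l : EqLetter × Bool) : ℂ :=
  ∑ L ∈ wordsAfter m l, u ^ xSum L

theorem xSum_cons (l : EqLetter × Bool) (L : List (EqLetter × Bool)) :
    xSum (l :: L) = xSign l + xSum L := by simp [xSum]

theorem weight_succ {u : ℂ} (hu : u ≠ 0) (m : ℕ) (l : EqLetter × Bool) :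
    weight u (m + 1) l =
      ∑ l' : EqLetter × Bool, if l.1 = l'.1 → l.2 = l'.2 then u ^ xSign l' * weight u m l' else 0 := by
  rw [weight, wordsAfter, sum_biUnion_cons, Finset.sum_filter]
  simp only [xSum_cons, zpow_add₀ hu, weight, Finset.mul_sum]

theorem sum_words {u : ℂ} (hu : u ≠ 0) (m : ℕ) :
    ∑ L ∈ words m, u ^ xSum L = ∑ l : EqLetter × Bool, u ^ xSign l * weight u m l := by
  rw [words, sum_biUnion_cons]
  simp only [xSum_cons, zpow_add₀ hu, weight, Finset.mul_sum]

/-- The values of `weight` for a constant letter, for `x`, and for the inverse of `x`. -/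
noncomputable def triple (u : ℂ) : ℕ → ℂ × ℂ × ℂ
  | 0 => (1, 1, 1)
  | m + 1 => (3 * (triple u m).1 + u * (triple u m).2.1 + u⁻¹ * (triple u m).2.2,
      4 * (triple u m).1 + u * (triple u m).2.1, 4 * (triple u m).1 + u⁻¹ * (triple u m).2.2)

/-- The letters `a`, `t` and their inverses are interchangeable for the exponent sum of `x`, so the
recursion over the six letters collapses to three components. -/
theorem weight_eq {u : ℂ} (hu : u ≠ 0) (m : ℕ) (l : EqLetter × Bool) :
    weight u m l = match l with
      | (.x, true) => (triple u m).2.1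
      | (.x, false) => (triple u m).2.2
      | _ => (triple u m).1 := by
  induction m generalizing l with
  | zero => obtain ⟨_ | _ | _, _ | _⟩ := l <;> simp [weight, wordsAfter, triple, xSum]
  | succ m ih =>
    rw [weight_succ hu, sum_letters]
    obtain ⟨_ | _ | _, _ | _⟩ := l <;> simp [ih, triple, xSign] <;> ring

theorem sum_words_eq {u : ℂ} (hu : u ≠ 0) (m : ℕ) :
    ∑ L ∈ words m, u ^ xSum L =
      4 * (triple u m).1 + u * (triple u m).2.1 + u⁻¹ * (triple u m).2.2 := by
  rw [sum_words hu, sum_letters]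
  simp [weight_eq hu, xSign]
  ring

/-- The generating function at `u = 1`. -/
theorem card_words (m : ℕ) : (words m).card = 6 * 5 ^ m := by
  have h : ∀ m, triple 1 m = (5 ^ m, 5 ^ m, 5 ^ m) := by
    intro m
    induction m with
    | zero => simp [triple]
    | succ m ih =>
      rw [triple, ih]
      ext <;> simp <;> ring
  have := sum_words_eq one_ne_zero m
  rw [h] at this
  simp only [one_zpow, Finset.sum_const, nsmul_eq_mul, mul_one, inv_one, one_mul] at this
  have h' : ((words m).card : ℂ) = ((6 * 5 ^ m : ℕ) : ℂ) := by
    rw [this]; push_cast; ring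
  exact_mod_cast h'

theorem norm_add_add_le {a b c g h k : ℂ} {α β γ A : ℝ} (ha : ‖a‖ ≤ α) (hb : ‖b‖ ≤ β)
    (hc : ‖c‖ ≤ γ) (hg : ‖g‖ ≤ A) (hh : ‖h‖ ≤ A) (hk : ‖k‖ ≤ A) :
    ‖a * g + b * h + c * k‖ ≤ (α + β + γ) * A := by
  have hA := (norm_nonneg _).trans hg
  have key : ∀ {x y : ℂ} {ξ : ℝ}, ‖x‖ ≤ ξ → ‖y‖ ≤ A → ‖x * y‖ ≤ ξ * A := fun hx hy => by
    rw [norm_mul]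
    exact mul_le_mul hx hy (norm_nonneg _) ((norm_nonneg _).trans hx)
  refine (norm_add₃_le).trans ?_
  linarith [key ha hg, key hb hh, key hc hk]

/-- A single step has coefficients whose absolute values sum to `5` for every `u` on the unit
circle, so cancellation shows only after two steps. With `τ = ‖1 + u‖ ≤ 2`, the coefficients of the
squared recursion sum to at most `8 * τ + 9` for the first component and `17 + 4 * τ` for the
others, and the former is at most the latter. -/
theorem norm_triple_le {u : ℂ} (hu : ‖u‖ = 1) {r : ℝ} (hr1 : 1 ≤ r)
    (hr : 17 + 4 * ‖1 + u‖ ≤ r ^ 2) (m : ℕ) :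
    ‖(triple u m).1‖ ≤ 5 * r ^ m ∧ ‖(triple u m).2.1‖ ≤ 5 * r ^ m ∧
      ‖(triple u m).2.2‖ ≤ 5 * r ^ m := by
  have hu0 : u ≠ 0 := by rintro rfl; simp at hu
  have hu' : ‖u⁻¹‖ = 1 := by rw [norm_inv, hu, inv_one]
  have hinv : ‖1 + u⁻¹‖ = ‖1 + u‖ := by
    have : 1 + u⁻¹ = u⁻¹ * (1 + u) := by field_simp; ring
    rw [this, norm_mul, hu', one_mul]
  have ht : ‖1 + u‖ ≤ 2 := by
    refine (norm_add_le _ _).trans ?_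
    rw [NormOneClass.norm_one, hu]
    norm_num
  have hmul : ∀ (c : ℝ) (z : ℂ), 0 ≤ c → ‖(c : ℂ) * z‖ = c * ‖z‖ := fun c z hc => by
    rw [norm_mul, Complex.norm_real, Real.norm_of_nonneg hc]
  induction m using Nat.twoStepInduction with
  | zero => simp [triple]
  | one =>
    have n3 : ‖(3 : ℂ)‖ ≤ 3 := by simp
    have n4 : ‖(4 : ℂ)‖ ≤ 4 := by simp
    have o : ‖(1 : ℂ)‖ ≤ 1 := by simp
    have z : ‖(0 : ℂ)‖ ≤ 0 := by simp
    have h₁ := norm_add_add_le n3 hu.le hu'.le o o o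
    have h₂ := norm_add_add_le n4 hu.le z o o o
    have h₃ := norm_add_add_le n4 z hu'.le o o o
    simp only [triple, mul_one, add_zero] at h₁ h₂ h₃ ⊢
    exact ⟨by linarith, by linarith, by linarith⟩
  | more m ih _ =>
    obtain ⟨hg, hh, hk⟩ := ih
    have hA : 0 ≤ 5 * r ^ m := by positivity
    have a₁ : ‖9 + 4 * u + 4 * u⁻¹‖ ≤ 8 * ‖1 + u‖ + 1 := by
      have : 9 + 4 * u + 4 * u⁻¹ = ((4 : ℝ) : ℂ) * (1 + u) + ((4 : ℝ) : ℂ) * (1 + u⁻¹) + 1 := by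
        push_cast; ring
      rw [this]
      refine norm_add₃_le.trans ?_
      rw [hmul _ _ (by norm_num), hmul _ _ (by norm_num), hinv, NormOneClass.norm_one]
      linarith
    have a₂ : ∀ v : ℂ, ‖v‖ = 1 → ‖1 + v‖ = ‖1 + u‖ → ‖12 + 4 * v‖ ≤ 8 + 4 * ‖1 + u‖ :=
      fun v _ hv' => by
        have : 12 + 4 * v = ((8 : ℝ) : ℂ) * 1 + ((4 : ℝ) : ℂ) * (1 + v) := by push_cast; ring
        rw [this]
        refine (norm_add_le _ _).trans ?_
        rw [hmul _ _ (by norm_num), hmul _ _ (by norm_num), hv', NormOneClass.norm_one]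
        linarith
    have a₃ : ∀ (c : ℝ) (v : ℂ), 0 ≤ c → ‖v‖ = 1 → ‖(c : ℂ) * v + v ^ 2‖ ≤ c + 1 :=
      fun c v hc hv => by
        refine (norm_add_le _ _).trans ?_
        rw [hmul _ _ hc, norm_pow, hv]
        linarith
    have a₄ : ∀ v : ℂ, ‖v‖ = 1 → ‖((4 : ℝ) : ℂ) * v‖ ≤ 4 := fun v hv => by
      rw [hmul _ _ (by norm_num), hv, mul_one]
    have e : 5 * r ^ (m + 2) = r ^ 2 * (5 * r ^ m) := by ring
    have final : (17 + 4 * ‖1 + u‖) * (5 * r ^ m) ≤ r ^ 2 * (5 * r ^ m) := by gcongr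
    have final' : (8 * ‖1 + u‖ + 1 + (3 + 1) + (3 + 1)) * (5 * r ^ m) ≤ r ^ 2 * (5 * r ^ m) := by
      gcongr
      linarith
    rw [e]
    refine ⟨?_, ?_, ?_⟩
    · refine le_trans (le_of_eq ?_) ((norm_add_add_le a₁ (a₃ 3 u (by norm_num) hu)
        (a₃ 3 u⁻¹ (by norm_num) hu') hg hh hk).trans final')
      simp only [triple]
      push_cast
      congr 1
      ring
    · refine le_trans (le_of_eq ?_) ((norm_add_add_le (a₂ u hu rfl) (a₃ 4 u (by norm_num) hu)
        (a₄ u⁻¹ hu') hg hh hk).trans (le_trans (le_of_eq ?_) final))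
      · simp only [triple]
        push_cast
        congr 1
        ring
      · ring
    · refine le_trans (le_of_eq ?_) ((norm_add_add_le (a₂ u⁻¹ hu' hinv) (a₄ u hu)
        (a₃ 4 u⁻¹ (by norm_num) hu') hg hh hk).trans (le_trans (le_of_eq ?_) final))
      · simp only [triple]
        push_cast
        congr 1
        ring
      · ring

theorem norm_one_add_lt {u : ℂ} (hu : ‖u‖ = 1) (h1 : u ≠ 1) : ‖1 + u‖ < 2 := by
  have h₁ : u.re * u.re + u.im * u.im = 1 := by
    have := Complex.normSq_eq_norm_sq u
    rw [hu, Complex.normSq_apply] at this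
    linarith
  have h₂ : u.re < 1 := by
    refine lt_of_le_of_ne (by nlinarith [mul_self_nonneg u.im]) fun h => h1 ?_
    apply Complex.ext
    · simpa using h
    · rw [h] at h₁
      have : u.im * u.im = 0 := by linarith
      simpa using this
  have h₃ : ‖1 + u‖ ^ 2 < 2 ^ 2 := by
    rw [← Complex.normSq_eq_norm_sq, Complex.normSq_apply]
    simp only [Complex.add_re, Complex.one_re, Complex.add_im, Complex.one_im, zero_add]
    nlinarith
  exact lt_of_pow_lt_pow_left₀ 2 (by norm_num) h₃

/-- For `u ≠ 1` the growth over two steps is at most `17 + 4 * ‖1 + u‖ < 25`, hence exponentially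
smaller than that of the number of words. -/
theorem tendsto_norm_sum_words {u : ℂ} (hu : ‖u‖ = 1) (h1 : u ≠ 1) :
    Tendsto (fun m => ‖∑ L ∈ words m, u ^ xSum L‖ / (6 * 5 ^ m)) atTop (𝓝 0) := by
  have hu0 : u ≠ 0 := by rintro rfl; simp at hu
  have hu' : ‖u⁻¹‖ = 1 := by rw [norm_inv, hu, inv_one]
  obtain ⟨r, hr⟩ : ∃ r, r = √(17 + 4 * ‖1 + u‖) := ⟨_, rfl⟩
  have hr2 : r ^ 2 = 17 + 4 * ‖1 + u‖ := by rw [hr, Real.sq_sqrt (by positivity)]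
  have hr0 : 0 ≤ r := hr ▸ Real.sqrt_nonneg _
  have hr1 : 1 ≤ r := by nlinarith [norm_nonneg (1 + u)]
  have hr5 : r < 5 := by nlinarith [norm_one_add_lt hu h1]
  have ht : Tendsto (fun m => 5 * (r / 5) ^ m) atTop (𝓝 (5 * 0)) :=
    (tendsto_pow_atTop_nhds_zero_of_lt_one (by positivity)
      (by rw [div_lt_one (by norm_num)]; exact hr5)).const_mul 5
  rw [mul_zero] at ht
  refine squeeze_zero (fun m => by positivity) (fun m => ?_) ht
  obtain ⟨hg, hh, hk⟩ := norm_triple_le hu hr1 hr2.ge m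
  have h4 : ‖(4 : ℂ)‖ ≤ 4 := by simp
  have := norm_add_add_le h4 hu.le hu'.le hg hh hk
  rw [sum_words_eq hu0, div_le_iff₀ (by positivity), div_pow]
  refine this.trans (le_of_eq ?_)
  field_simp
  ring

/-- The reduced words with exponent sum zero are at most a fraction `1 / q`, up to the contribution
of nontrivial roots of unity. -/
theorem card_filter_le {q : ℕ} (hq : 0 < q) (m : ℕ) :
    (q : ℝ) * ((words m).filter fun L => xSum L = 0).card ≤
      ∑ j ∈ Finset.range q,
        ‖∑ L ∈ words m, (Complex.exp (2 * Real.pi * Complex.I / q) ^ j) ^ xSum L‖ := by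
  obtain ⟨ζ, hζ⟩ : ∃ ζ, ζ = Complex.exp (2 * Real.pi * Complex.I / q) := ⟨_, rfl⟩
  rw [← hζ]
  have hζq : ζ ^ q = 1 := hζ ▸ (Complex.isPrimitiveRoot_exp q hq.ne').pow_eq_one
  -- The character sum is `q` if `q` divides `s` and zero otherwise, so it dominates `q` times the
  -- indicator of `s = 0`.
  have key : ∀ s : ℤ, (if s = 0 then (q : ℝ) else 0) ≤
      (∑ j ∈ Finset.range q, (ζ ^ j) ^ s).re := by
    intro s
    have e : ∑ j ∈ Finset.range q, (ζ ^ j) ^ s = ∑ j ∈ Finset.range q, (ζ ^ s) ^ j := by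
      refine Finset.sum_congr rfl fun j _ => ?_
      rw [← zpow_natCast, ← zpow_natCast, ← zpow_mul, ← zpow_mul, mul_comm]
    rw [e]
    by_cases h : ζ ^ s = 1
    · simp only [h, one_pow, Finset.sum_const, Finset.card_range, nsmul_eq_mul, mul_one,
        Complex.natCast_re]
      split_ifs <;> simp
    · have hs : s ≠ 0 := by rintro rfl; simp at h
      have : ζ ^ s ^ 1 - 1 ≠ 0 := by rw [pow_one]; exact sub_ne_zero.2 h
      rw [geom_sum_eq h, ← zpow_natCast, ← zpow_mul, mul_comm, zpow_mul, zpow_natCast, hζq, one_zpow]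
      simp [hs]
  calc (q : ℝ) * ((words m).filter fun L => xSum L = 0).card
      = ∑ L ∈ words m, if xSum L = 0 then (q : ℝ) else 0 := by
        rw [← Finset.sum_filter, Finset.sum_const, nsmul_eq_mul, mul_comm]
    _ ≤ ∑ L ∈ words m, (∑ j ∈ Finset.range q, (ζ ^ j) ^ xSum L).re :=
        Finset.sum_le_sum fun L _ => key _
    _ = ∑ j ∈ Finset.range q, (∑ L ∈ words m, (ζ ^ j) ^ xSum L).re := by
        simp only [Complex.re_sum]
        exact Finset.sum_comm
    _ ≤ _ := Finset.sum_le_sum fun j _ => Complex.re_le_norm _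

/-- For fixed `q` only the trivial root of unity contributes in the limit, so the proportion is
eventually below any number exceeding `1 / q`. As `q` is arbitrary, the limit is zero; no rate is
needed. -/
theorem tendsto_card_filter :
    Tendsto (fun m => (((words m).filter fun L => xSum L = 0).card : ℝ) / (6 * 5 ^ m)) atTop
      (𝓝 0) := by
  rw [Metric.tendsto_atTop]
  intro ε hε
  obtain ⟨q, hq⟩ := exists_nat_gt (1 / ε)
  have hq0' : (0 : ℝ) < q := (by positivity : 0 < 1 / ε).trans hq
  have hq0 : 0 < q := by exact_mod_cast hq0'
  have hqε : 1 < q * ε := by rwa [div_lt_iff₀ hε] at hq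
  obtain ⟨ζ, hζ⟩ : ∃ ζ, ζ = Complex.exp (2 * Real.pi * Complex.I / q) := ⟨_, rfl⟩
  have hprim : IsPrimitiveRoot ζ q := hζ ▸ Complex.isPrimitiveRoot_exp q hq0.ne'
  have hnorm : ‖ζ‖ = 1 := hprim.norm'_eq_one hq0.ne'
  have hlim : Tendsto (fun m => ∑ j ∈ Finset.range q,
      ‖∑ L ∈ words m, (ζ ^ j) ^ xSum L‖ / (6 * 5 ^ m)) atTop
      (𝓝 (∑ j ∈ Finset.range q, if j = 0 then (1 : ℝ) else 0)) := by
    refine tendsto_finsetSum _ fun j hj => ?_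
    split_ifs with h0
    · refine tendsto_const_nhds.congr fun m => ?_
      simp only [h0, pow_zero, one_zpow, Finset.sum_const, nsmul_eq_mul, mul_one,
        Complex.norm_natCast, card_words]
      push_cast
      rw [div_self (by positivity)]
    · refine tendsto_norm_sum_words (by rw [norm_pow, hnorm, one_pow]) fun h => ?_
      exact hprim.pow_ne_one_of_pos_of_lt h0 (Finset.mem_range.1 hj) h
  rw [Finset.sum_ite_eq' (Finset.range q) 0, if_pos (Finset.mem_range.2 hq0)] at hlim
  obtain ⟨M, hM⟩ := eventually_atTop.1 (hlim.eventually_lt_const hqε)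
  refine ⟨M, fun m hm => ?_⟩
  rw [Real.dist_eq, sub_zero, abs_of_nonneg (by positivity)]
  have h₁ := hM m hm
  have h₂ := card_filter_le hq0 m
  rw [← hζ] at h₂
  rw [← Finset.sum_div] at h₁
  have h₃ : (q : ℝ) * (((words m).filter fun L => xSum L = 0).card / (6 * 5 ^ m)) < q * ε := by
    rw [← mul_div_assoc]
    exact (div_le_div_of_nonneg_right h₂ (by positivity)).trans_lt h₁
  exact lt_of_mul_lt_mul_left h₃ hq0'.le

theorem ncard_inter_wordSphere (p : ℤ → Prop) [DecidablePred p] (m : ℕ) :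
    ({w | p (sigmaX w)} ∩ wordSphere (m + 1)).ncard =
      ((words m).filter fun L => p (xSum L)).card := by
  rw [← Set.ncard_image_of_injective _ (FreeGroup.toWord_injective (α := EqLetter)),
    ← Set.ncard_coe_finset]
  congr 1
  ext L
  simp only [Set.mem_image, Set.mem_inter_iff, Set.mem_ofPred_eq, wordSphere, Finset.coe_filter,
    mem_words]
  constructor
  · rintro ⟨w, ⟨h₁, h₂⟩, rfl⟩
    exact ⟨⟨h₂, FreeGroup.isReduced_toWord⟩, h₁⟩
  · rintro ⟨⟨h₁, h₂⟩, h₃⟩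
    have hL : (FreeGroup.mk L).toWord = L := by rw [FreeGroup.toWord_mk, h₂.reduce_eq]
    refine ⟨FreeGroup.mk L, ⟨?_, ?_⟩, hL⟩
    · rw [sigmaX, hL]; exact h₃
    · rw [FreeGroup.norm, hL, h₁]

end ReducedWords

open ReducedWords in
theorem isGenericSet_sigmaX_ne_zero : IsGenericSet {w | sigmaX w ≠ 0} := by
  -- The finset `words m` consists of the words of length `m + 1`, hence the shift of the index.
  rw [IsGenericSet, ← tendsto_add_atTop_iff_nat 1]
  have hlim : Tendsto (fun m => 1 - (((words m).filter fun L => xSum L = 0).card : ℝ) / (6 * 5 ^ m))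
      atTop (𝓝 1) := by
    simpa using tendsto_card_filter.const_sub 1
  refine hlim.congr fun m => ?_
  have h₁ := ncard_inter_wordSphere (fun s => s ≠ 0) m
  have h₂ := ncard_inter_wordSphere (fun _ => True) m
  have h₃ := Finset.card_filter_add_card_filter_not (s := words m) fun L => xSum L = 0
  rw [card_words] at h₃
  simp only [Set.ofPred_true, Set.univ_inter, Finset.filter_true, card_words] at h₂
  rw [h₁, h₂]
  have h₄ : (((words m).filter fun L => xSum L ≠ 0).card : ℝ) =
      6 * 5 ^ m - ((words m).filter fun L => xSum L = 0).card := by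
    rw [eq_sub_iff_add_eq', ← Nat.cast_add, h₃]
    push_cast
    rfl
  rw [h₄, sub_div]
  push_cast
  rw [div_self (by positivity)]

/-- Monotonicity of `Set.ncard` requires finite sets, since infinite sets have `ncard` zero; so the
finiteness of the spheres is established first. -/
theorem IsGenericSet.mono {S S' : Set (FreeGroup EqLetter)} (h : IsGenericSet S) (hS : S ⊆ S') :
    IsGenericSet S' := by
  have hfin : ∀ m, (wordSphere m).Finite := fun m => by
    rcases m with _ | m
    · refine Set.Finite.subset (Set.finite_singleton 1) fun w hw => ?_
      exact FreeGroup.norm_eq_zero.1 hw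
    · have h₂ := ReducedWords.ncard_inter_wordSphere (fun _ => True) m
      simp only [Set.ofPred_true, Set.univ_inter, Finset.filter_true, ReducedWords.card_words] at h₂
      exact Set.finite_of_ncard_pos (by rw [h₂]; positivity)
  refine tendsto_of_tendsto_of_tendsto_of_le_of_le h tendsto_const_nhds (fun m => ?_) fun m => ?_
  · have := Set.ncard_le_ncard (Set.inter_subset_inter_left (wordSphere m) hS)
      ((hfin m).subset Set.inter_subset_right)
    exact div_le_div_of_nonneg_right (Nat.cast_le.2 this) (by positivity)
  · have := Set.ncard_le_ncard (Set.inter_subset_right (s := S') (t := wordSphere m)) (hfin m)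
    exact div_le_one_of_le₀ (Nat.cast_le.2 this) (by positivity)

theorem mainTheorem6 :
    RAM.HasGenericCaseTime DP1Lamplighter
        (fun n : ℕ => (n : ℝ) ^ 2 * Real.log n * Real.log (Real.log n)) ∧
      IsGenericSet {w | sigmaX w ≠ 0} ∧
      ∃ (P : RAM.Program) (d : ℕ) (T : ℕ → ℕ),
        RAM.PartiallyDecides P DP1Lamplighter ∧
          ((fun n : ℕ => (T n : ℝ)) =O[atTop]
            (fun n : ℕ => (n : ℝ) ^ 2 * Real.log n * Real.log (Real.log n))) ∧
          ∀ w : FreeGroup EqLetter, sigmaX w ≠ 0 → RAM.RunsWithin P d w (T w.norm) := by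
  obtain ⟨h₁, h₂⟩ := IntProg.decideProg_partiallyDecides
  have h₃ := IntProg.mainTime_isBigO 62000
  exact ⟨⟨_, _, fun n => 62000 * IntProg.mainTime n, h₁, h₃, isGenericSet_sigmaX_ne_zero.mono h₂⟩,
    isGenericSet_sigmaX_ne_zero, _, _, fun n => 62000 * IntProg.mainTime n, h₁, h₃, h₂⟩
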